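/- **Setting.** Let $C$ be a unital $C^*$-algebra and $\alpha\colon C\to C$ a unital $*$-endomorphism. Ideals are closed and two-sided. *Adding a tail.* Let $M(\ker\alpha)$ be the multiplier algebra of $\ker\alpha$ and $\theta\colon C\to M(\ker\alpha)$ the unital $*$-homomorphism extending the embedding $\ker\alpha\to M(\ker\alpha)$ (so $\theta(c)$ is multiplication by $c$). Put $T=c_0(\theta(C))$, $B=C\oplus T$ and $\beta\colon B\to B$, $\beta(c,(x_1,x_2,\dots))=(\alpha(c),(\theta(c),x_1,x_2,\dots))$. *Direct limits.* For a $*$-endomorphism $\varphi$ of a $C^*$-algebra $A$, let $A_\infty$ be the $C^*$-algebra direct limit of $A\xrightarrow{\varphi}A\xrightarrow{\varphi}A\to\cdots$ and $\varphi_\infty$ the $*$-automorphism $[x_0,x_1,\dots]\mapsto[\varphi(x_0),\varphi(x_1),\dots]$ of $A_\infty$. This defines $(B_\infty,\beta_\infty)$ and $(C_\infty,\alpha_\infty)$. *Minimality.* $(A,\varphi)$ is *minimal* if $0$ and $A$ are the only ideals $J$ of $A$ with $\varphi(J)\subseteq J$; if $\varphi$ is a $*$-automorphism, $(A,\varphi)$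 is *bi-minimal* if $0$ and $A$ are the only ideals $J$ with $\varphi(J)=J$. *Crossed products.* For a $*$-automorphism $\gamma$ of a $C^*$-algebra $A$, the crossed product $A\rtimes_\gamma\mathbb Z$ is the universal $C^*$-algebra spanned densely by the elements $U^na$ ($n\in\mathbb Z$, $a\in A$), for covariant pairs of a $*$-representation of $A$ and a unitary $U$ with $aU=U\gamma(a)$. Let $E(F)=\int_{\mathbb T}\beta_z(F)\,dz$, where $\beta_z(U^na)=z^nU^na$ is the gauge action and $dz$ is normalized Haar measure, and $E_n(F)=E(U^{-n}F)$. An ideal $I$ of $A\rtimes_\gamma\mathbb Z$ is *Fourier-invariant* if $E_n(I)\subseteq I$ for all $n\in\mathbb Z$. *Semicrossed products.* Let $\ell^1(\mathbb Z_+,C,\alpha)_l$ be $\ell^1(\mathbb Z_+,C)$ with the product $(\delta_n\otimes c)(\delta_m\otimes y)=\delta_{n+m}\otimes\alpha^m(c)y$. A left covariant pair $(\pi,V)$ consists of a $*$-representation $\pi$ of $C$ on a Hilbert space $H$ and a contraction $V$ on $H$ with $\pi(c)V=V\pi(\alpha(c))$; it yields the representation $(V\times\pi)(\sum_n\delta_n\otimes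 c_n)=\sum_nV^n\pi(c_n)$. The four left semicrossed products of $(C,\alpha)$ are the Hausdorff completions of $\ell^1(\mathbb Z_+,C,\alpha)_l$ in the seminorm $\sup\|(V\times\pi)(F)\|$, the supremum over the left covariant pairs in which $V$ is, respectively, an arbitrary contraction, an isometry, a co-isometry, a unitary. Matrices over them are normed by $\sup\|[(V\times\pi)(F_{ij})]\|$ over the same pairs. *$C^*$-envelopes.* A $C^*$-cover of such an operator algebra $\mathcal A$ is a $C^*$-algebra $D$ with a completely isometric homomorphism $j\colon\mathcal A\to D$ whose range generates $D$. It is the $C^*$-envelope of $\mathcal A$ if for every $C^*$-cover $(D',j')$ there is a surjective $*$-homomorphism $\Phi\colon D'\to D$ with $\Phi\circ j'=j$. **Theorem.** The following are equivalent: 1. $(C,\alpha)$ is minimal; 2. $(B,\beta)$ is minimal; 3. $(B_\infty,\beta_\infty)$ is bi-minimal; 4. $B_\infty\rtimes_{\beta_\infty}\mathbb Z$ has no Fourier-invariant ideals other than $0$ and itself. If these conditions hold, then $\alpha$ is injective and $(C,\alpha)=(B,\beta)$ (that is, $c\mapsto(c,0)$ is a bijection from $C$ onto $B$ that intertwines $\alpha$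 and $\beta$). Moreover, the four left semicrossed products of $(C,\alpha)$ are then completely isometrically isomorphic to one another, through the isomorphisms that fix (the images of) the elements of $\ell^1(\mathbb Z_+,C,\alpha)_l$, and each of them has the $C^*$-envelope $C_\infty\rtimes_{\alpha_\infty}\mathbb Z$, through the embedding $\delta_n\otimes c\mapsto U^n[c,\alpha(c),\alpha^2(c),\dots]$. -/

import Mathlib

open Filter Topology UniformSpace
open scoped MultiplierAlgebra ZeroAtInfty

universe u v

noncomputable section

namespace CStarDyn


set_option linter.unusedSectionVars false

section Completion

/-- A `*`-algebra with a submultiplicative seminorm that satisfies `‖x* x‖ = ‖x‖²`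
(no completeness, and nonzero vectors of seminorm zero are allowed). -/
class IsPreCStar (X : Type u) [NonUnitalSeminormedRing X] [StarRing X] : Prop where
  norm_star_mul : ∀ x : X, ‖star x * x‖ = ‖x‖ * ‖x‖

theorem IsPreCStar.norm_star {X : Type u} [NonUnitalSeminormedRing X] [StarRing X]
    [IsPreCStar X] (x : X) : ‖star x‖ = ‖x‖ := by
  have key : ∀ y : X, ‖y‖ ≤ ‖star y‖ := by
    intro y
    have h := norm_mul_le (star y) y
    rw [IsPreCStar.norm_star_mul] at h
    by_cases hy : ‖y‖ = 0
    · rw [hy]; positivity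
    · exact le_of_mul_le_mul_right h (lt_of_le_of_ne (norm_nonneg y) (Ne.symm hy))
  refine le_antisymm ?_ (key x)
  simpa using key (star x)

variable (X : Type u) [NonUnitalSeminormedRing X] [StarRing X] [NormedSpace ℂ X]
  [IsScalarTower ℂ X X] [SMulCommClass ℂ X X] [StarModule ℂ X] [IsPreCStar X]

/-- The `C*`-algebra obtained from a `*`-algebra with a `C*`-seminorm by dividing out the null
space and completing (`UniformSpace.Completion` does both at once). -/
def CStarCompletion : Type u := UniformSpace.Completion X

instance : NormedAddCommGroup (CStarCompletion X) :=
  inferInstanceAs (NormedAddCommGroup (UniformSpace.Completion X))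
instance : NormedSpace ℂ (CStarCompletion X) :=
  inferInstanceAs (NormedSpace ℂ (UniformSpace.Completion X))
instance : CompleteSpace (CStarCompletion X) :=
  inferInstanceAs (CompleteSpace (UniformSpace.Completion X))

variable {X}

namespace CStarCompletion

/-- The canonical map `X → CStarCompletion X`. -/
def ofFun (x : X) : CStarCompletion X := (x : UniformSpace.Completion X)

theorem continuous_ofFun : Continuous (ofFun (X := X)) :=
  UniformSpace.Completion.continuous_coe X

theorem denseRange_ofFun : DenseRange (ofFun (X := X)) :=
  UniformSpace.Completion.denseRange_coe

theorem ofFun_add (x y : X) : ofFun (x + y) = ofFun x + ofFun y :=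
  UniformSpace.Completion.coe_add x y

theorem ofFun_zero : ofFun (0 : X) = 0 := UniformSpace.Completion.coe_zero

theorem ofFun_smul (c : ℂ) (x : X) : ofFun (c • x) = c • ofFun x :=
  UniformSpace.Completion.coe_smul c x

theorem norm_ofFun (x : X) : ‖ofFun x‖ = ‖x‖ := UniformSpace.Completion.norm_coe x

theorem induction_on {p : CStarCompletion X → Prop} (a : CStarCompletion X)
    (hp : IsClosed {a | p a}) (ih : ∀ x : X, p (ofFun x)) : p a :=
  UniformSpace.Completion.induction_on (α := X) (p := p) a hp ih

theorem isDenseInducing_ofFun : IsDenseInducing (ofFun (X := X)) :=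
  UniformSpace.Completion.isDenseInducing_coe

instance : Mul (CStarCompletion X) :=
  ⟨Function.curry <| (isDenseInducing_ofFun.prodMap isDenseInducing_ofFun).extend
    (fun p : X × X => ofFun (p.1 * p.2))⟩

theorem ofFun_mul (x y : X) : ofFun (x * y) = ofFun x * ofFun y :=
  ((isDenseInducing_ofFun.prodMap isDenseInducing_ofFun).extend_eq
      (f := fun p : X × X => ofFun (p.1 * p.2))
      (continuous_ofFun.comp (continuous_fst.mul continuous_snd)) (x, y)).symm

instance : ContinuousMul (CStarCompletion X) where
  continuous_mul := by
    let j : X →+ CStarCompletion X := ⟨⟨ofFun, ofFun_zero⟩, ofFun_add⟩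
    let m := (AddMonoidHom.mul : X →+ X →+ X).compr₂ j
    have : Continuous fun p : X × X => m p.1 p.2 := continuous_ofFun.comp continuous_mul
    have di : IsDenseInducing (j : X → CStarCompletion X) := isDenseInducing_ofFun
    exact (di.extend_Z_bilin di this :)

instance : Star (CStarCompletion X) :=
  ⟨UniformSpace.Completion.map (star : X → X)⟩

theorem uniformContinuous_star_pre : UniformContinuous (star : X → X) :=
  (AddMonoidHomClass.isometry_of_norm (starAddEquiv : X ≃+ X)
    (fun x => IsPreCStar.norm_star x)).uniformContinuous

theorem ofFun_star (x : X) : ofFun (star x) = star (ofFun x) :=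
  (UniformSpace.Completion.map_coe uniformContinuous_star_pre x).symm

instance : ContinuousStar (CStarCompletion X) where
  continuous_star := UniformSpace.Completion.continuous_map

theorem induction_on₂ {p : CStarCompletion X → CStarCompletion X → Prop}
    (a b : CStarCompletion X) (hp : IsClosed {a : CStarCompletion X × CStarCompletion X | p a.1 a.2})
    (ih : ∀ x y : X, p (ofFun x) (ofFun y)) : p a b :=
  UniformSpace.Completion.induction_on₂ (α := X) (β := X) (p := p) a b hp ih

theorem induction_on₃ {p : CStarCompletion X → CStarCompletion X → CStarCompletion X → Prop}
    (a b c : CStarCompletion X)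
    (hp : IsClosed {a : CStarCompletion X × CStarCompletion X × CStarCompletion X |
      p a.1 a.2.1 a.2.2})
    (ih : ∀ x y z : X, p (ofFun x) (ofFun y) (ofFun z)) : p a b c :=
  UniformSpace.Completion.induction_on₃ (α := X) (β := X) (γ := X) (p := p) a b c hp ih

instance : NonUnitalNormedRing (CStarCompletion X) :=
  { (inferInstance : NormedAddCommGroup (CStarCompletion X)),
    (inferInstance : Mul (CStarCompletion X)) with
    left_distrib := fun a b c => by
      induction a, b, c using induction_on₃ with
      | hp => exact isClosed_eq (by fun_prop) (by fun_prop)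
      | ih x y z => simp only [← ofFun_add, ← ofFun_mul, mul_add]
    right_distrib := fun a b c => by
      induction a, b, c using induction_on₃ with
      | hp => exact isClosed_eq (by fun_prop) (by fun_prop)
      | ih x y z => simp only [← ofFun_add, ← ofFun_mul, add_mul]
    zero_mul := fun a => by
      induction a using induction_on with
      | hp => exact isClosed_eq (by fun_prop) (by fun_prop)
      | ih x => rw [← ofFun_zero, ← ofFun_mul, zero_mul]
    mul_zero := fun a => by
      induction a using induction_on with
      | hp => exact isClosed_eq (by fun_prop) (by fun_prop)
      | ih x => rw [← ofFun_zero, ← ofFun_mul, mul_zero]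
    mul_assoc := fun a b c => by
      induction a, b, c using induction_on₃ with
      | hp => exact isClosed_eq (by fun_prop) (by fun_prop)
      | ih x y z => simp only [← ofFun_mul, mul_assoc]
    norm_mul_le := fun a b => by
      induction a, b using induction_on₂ with
      | hp => exact isClosed_le (by fun_prop) (by fun_prop)
      | ih x y => simp only [← ofFun_mul, norm_ofFun]; exact norm_mul_le x y }

instance : StarRing (CStarCompletion X) where
  star_involutive a := by
    induction a using induction_on with
    | hp => exact isClosed_eq (by fun_prop) (by fun_prop)
    | ih x => rw [← ofFun_star, ← ofFun_star, star_star]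
  star_mul a b := by
    induction a, b using induction_on₂ with
    | hp => exact isClosed_eq (by fun_prop) (by fun_prop)
    | ih x y => simp only [← ofFun_star, ← ofFun_mul, star_mul]
  star_add a b := by
    induction a, b using induction_on₂ with
    | hp => exact isClosed_eq (by fun_prop) (by fun_prop)
    | ih x y => simp only [← ofFun_star, ← ofFun_add, star_add]

instance : NonUnitalCStarAlgebra (CStarCompletion X) where
  __ := (inferInstance : CompleteSpace (CStarCompletion X))
  __ := (inferInstance : Module ℂ (CStarCompletion X))
  norm_mul_self_le a := by
    induction a using induction_on with
    | hp => exact isClosed_le (by fun_prop) (by fun_prop)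
    | ih x => rw [← ofFun_star, ← ofFun_mul, norm_ofFun, norm_ofFun, IsPreCStar.norm_star_mul]
  norm_smul_le := norm_smul_le
  smul_assoc c a b := by
    change (c • a) * b = c • (a * b)
    induction a, b using induction_on₂ with
    | hp => exact isClosed_eq ((continuous_fst.const_smul c).mul continuous_snd)
              ((continuous_fst.mul continuous_snd).const_smul c)
    | ih x y => rw [← ofFun_smul, ← ofFun_mul, ← ofFun_mul, ← ofFun_smul, smul_mul_assoc]
  smul_comm c a b := by
    change c • (a * b) = a * (c • b)
    induction a, b using induction_on₂ with
    | hp => exact isClosed_eq ((continuous_fst.mul continuous_snd).const_smul c)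
              (continuous_fst.mul (continuous_snd.const_smul c))
    | ih x y => rw [← ofFun_smul, ← ofFun_mul, ← ofFun_mul, ← ofFun_smul, mul_smul_comm]
  star_smul c a := by
    induction a using induction_on with
    | hp => exact isClosed_eq (continuous_id.const_smul c).star (continuous_star.const_smul (star c))
    | ih x => rw [← ofFun_smul, ← ofFun_star, ← ofFun_star, ← ofFun_smul, star_smul]

/-- The canonical `*`-homomorphism `X → CStarCompletion X`. -/
def of : X →⋆ₙₐ[ℂ] CStarCompletion X where
  toFun := ofFun
  map_smul' := ofFun_smul
  map_zero' := ofFun_zero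
  map_add' := ofFun_add
  map_mul' := ofFun_mul
  map_star' := ofFun_star

theorem continuous_of : Continuous (of (X := X)) := continuous_ofFun

theorem norm_of (x : X) : ‖of x‖ = ‖x‖ := norm_ofFun x

/-- The continuous extension of a map to the completions. -/
def mapFun (f : X → X) : CStarCompletion X → CStarCompletion X := UniformSpace.Completion.map f

theorem continuous_mapFun (f : X → X) : Continuous (mapFun f) :=
  UniformSpace.Completion.continuous_map

theorem mapFun_ofFun (f : X →ₗ[ℂ] X) (hf : ∀ x, ‖f x‖ ≤ ‖x‖) (x : X) :
    mapFun f (ofFun x) = ofFun (f x) :=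
  UniformSpace.Completion.map_coe
    (f.mkContinuous 1 (fun x => by simpa using hf x)).uniformContinuous x

/-- The continuous extension of a contractive linear map to the completions. -/
def mapL (f : X →ₗ[ℂ] X) (hf : ∀ x, ‖f x‖ ≤ ‖x‖) :
    CStarCompletion X →L[ℂ] CStarCompletion X where
  toFun := mapFun f
  map_add' a b := by
    have e := mapFun_ofFun f hf
    induction a, b using induction_on₂ with
    | hp => exact isClosed_eq ((continuous_mapFun f).comp continuous_add)
              (((continuous_mapFun f).comp continuous_fst).add
                ((continuous_mapFun f).comp continuous_snd))
    | ih x y => rw [← ofFun_add, e, e, e, map_add, ofFun_add]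
  map_smul' c a := by
    have e := mapFun_ofFun f hf
    induction a using induction_on with
    | hp => exact isClosed_eq ((continuous_mapFun f).comp (continuous_const_smul c))
              ((continuous_mapFun f).const_smul c)
    | ih x => rw [← ofFun_smul, e, e, map_smul, ofFun_smul, RingHom.id_apply]
  cont := continuous_mapFun f

theorem mapL_of (f : X →ₗ[ℂ] X) (hf : ∀ x, ‖f x‖ ≤ ‖x‖) (x : X) :
    mapL f hf (of x) = of (f x) :=
  mapFun_ofFun f hf x

/-- The continuous extension of a contractive `*`-endomorphism to the completion. -/
def mapHom (f : X →⋆ₙₐ[ℂ] X) (hf : ∀ x, ‖f x‖ ≤ ‖x‖) :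
    CStarCompletion X →⋆ₙₐ[ℂ] CStarCompletion X :=
  { (mapL (f : X →ₗ[ℂ] X) hf : CStarCompletion X →ₗ[ℂ] CStarCompletion X) with
    map_zero' := map_zero (mapL (f : X →ₗ[ℂ] X) hf)
    map_mul' := fun a b => by
      have e := mapFun_ofFun (f : X →ₗ[ℂ] X) hf
      change mapFun f (a * b) = mapFun f a * mapFun f b
      induction a, b using induction_on₂ with
      | hp => exact isClosed_eq ((continuous_mapFun f).comp continuous_mul)
                (((continuous_mapFun f).comp continuous_fst).mul
                ((continuous_mapFun f).comp continuous_snd))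
      | ih x y =>
        rw [← ofFun_mul]
        refine (e _).trans (.trans ?_ (congrArg₂ (· * ·) (e x) (e y)).symm)
        rw [← ofFun_mul]
        exact congrArg ofFun (map_mul f x y)
    map_star' := fun a => by
      have e := mapFun_ofFun (f : X →ₗ[ℂ] X) hf
      change mapFun f (star a) = star (mapFun f a)
      induction a using induction_on with
      | hp => exact isClosed_eq ((continuous_mapFun f).comp continuous_star)
                (continuous_mapFun f).star
      | ih x =>
        rw [← ofFun_star]
        refine (e _).trans (.trans ?_ (congrArg star (e x)).symm)
        rw [← ofFun_star]
        exact congrArg ofFun (map_star f x) }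

theorem mapHom_of (f : X →⋆ₙₐ[ℂ] X) (hf : ∀ x, ‖f x‖ ≤ ‖x‖) (x : X) :
    mapHom f hf (of x) = of (f x) :=
  mapFun_ofFun (f : X →ₗ[ℂ] X) hf x

theorem continuous_mapHom (f : X →⋆ₙₐ[ℂ] X) (hf : ∀ x, ‖f x‖ ≤ ‖x‖) :
    Continuous (mapHom f hf) :=
  continuous_mapFun f

theorem of_eq_of {x y : X} (h : ‖x - y‖ = 0) : of x = of y := by
  rw [← sub_eq_zero, ← map_sub, ← norm_eq_zero, norm_of]
  exact h

/-- The `*`-automorphism of the completion induced by two contractive `*`-endomorphisms that are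
inverse to each other up to vectors of seminorm zero. -/
def autOfInverse (f g : X →⋆ₙₐ[ℂ] X) (hf : ∀ x, ‖f x‖ ≤ ‖x‖) (hg : ∀ x, ‖g x‖ ≤ ‖x‖)
    (hgf : ∀ x, ‖g (f x) - x‖ = 0) (hfg : ∀ x, ‖f (g x) - x‖ = 0) :
    CStarCompletion X ≃⋆ₐ[ℂ] CStarCompletion X :=
  { mapHom f hf with
    invFun := mapHom g hg
    left_inv := fun a => by
      change mapHom g hg (mapHom f hf a) = a
      induction a using induction_on with
      | hp => exact isClosed_eq ((continuous_mapHom g hg).comp (continuous_mapHom f hf))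
                continuous_id
      | ih x =>
        exact (congrArg _ (mapHom_of f hf x)).trans ((mapHom_of g hg _).trans (of_eq_of (hgf x)))
    right_inv := fun a => by
      change mapHom f hf (mapHom g hg a) = a
      induction a using induction_on with
      | hp => exact isClosed_eq ((continuous_mapHom f hf).comp (continuous_mapHom g hg))
                continuous_id
      | ih x =>
        exact (congrArg _ (mapHom_of g hg x)).trans ((mapHom_of f hf _).trans (of_eq_of (hfg x))) }

end CStarCompletion

/-- A submultiplicative seminorm on a non-unital algebra, as a seminormed ring structure. -/
abbrev seminormedRing {X : Type u} [NonUnitalRing X] [Module ℂ X] (p : Seminorm ℂ X)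
    (hp : ∀ x y, p (x * y) ≤ p x * p y) : NonUnitalSeminormedRing X :=
  { p.toAddGroupSeminorm.toSeminormedAddCommGroup, (inferInstance : NonUnitalRing X) with
    norm_mul_le := hp }

end Completion


section DirectLimit

variable {A : Type u} [NonUnitalCStarAlgebra A] (φ : A →⋆ₙₐ[ℂ] A)

/-- The `*`-algebra of sequences `(x₀, x₁, …)` in `A` that eventually follow `φ`, i.e.
`xₙ₊₁ = φ xₙ` for all large `n`. -/
def orbitSeq : NonUnitalStarSubalgebra ℂ (ℕ → A) where
  carrier := {x | ∀ᶠ n in atTop, x (n + 1) = φ (x n)}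
  add_mem' hx hy := by
    filter_upwards [hx, hy] with n h1 h2
    simp only [Pi.add_apply, h1, h2, map_add]
  zero_mem' := by simp
  mul_mem' hx hy := by
    filter_upwards [hx, hy] with n h1 h2
    simp only [Pi.mul_apply, h1, h2, map_mul]
  smul_mem' c x hx := by
    filter_upwards [hx] with n h1
    simp only [Pi.smul_apply, h1, map_smul]
  star_mem' hx := by
    filter_upwards [hx] with n h1
    simp only [Pi.star_apply, h1, map_star]

/-- The algebraic stage of the direct limit of `A → A → ⋯` (all maps equal to `φ`): sequences
that eventually follow `φ`, with the seminorm `‖x‖ = limₙ ‖xₙ‖`. -/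
def PreLimit : Type u := orbitSeq φ

namespace PreLimit

instance : NonUnitalRing (PreLimit φ) := inferInstanceAs (NonUnitalRing (orbitSeq φ))
instance : StarRing (PreLimit φ) := inferInstanceAs (StarRing (orbitSeq φ))
instance : Module ℂ (PreLimit φ) := inferInstanceAs (Module ℂ (orbitSeq φ))
instance : IsScalarTower ℂ (PreLimit φ) (PreLimit φ) :=
  inferInstanceAs (IsScalarTower ℂ (orbitSeq φ) (orbitSeq φ))
instance : SMulCommClass ℂ (PreLimit φ) (PreLimit φ) :=
  inferInstanceAs (SMulCommClass ℂ (orbitSeq φ) (orbitSeq φ))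
instance : StarModule ℂ (PreLimit φ) := inferInstanceAs (StarModule ℂ (orbitSeq φ))

variable {φ}

/-- The underlying sequence. -/
def seq (x : PreLimit φ) : ℕ → A := x.1

theorem seq_prop (x : PreLimit φ) : ∀ᶠ n in atTop, x.seq (n + 1) = φ (x.seq n) := x.2

theorem seq_add (x y : PreLimit φ) (n : ℕ) : (x + y).seq n = x.seq n + y.seq n := rfl
theorem seq_sub (x y : PreLimit φ) (n : ℕ) : (x - y).seq n = x.seq n - y.seq n := rfl
theorem seq_mul (x y : PreLimit φ) (n : ℕ) : (x * y).seq n = x.seq n * y.seq n := rfl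
theorem seq_smul (c : ℂ) (x : PreLimit φ) (n : ℕ) : (c • x).seq n = c • x.seq n := rfl
theorem seq_star (x : PreLimit φ) (n : ℕ) : (star x).seq n = star (x.seq n) := rfl

/-- `limₙ ‖xₙ‖`. -/
def limNorm (x : PreLimit φ) : ℝ := limUnder atTop fun n => ‖x.seq n‖

theorem tendsto_limNorm (x : PreLimit φ) :
    Tendsto (fun n => ‖x.seq n‖) atTop (𝓝 x.limNorm) := by
  obtain ⟨N, hN⟩ := eventually_atTop.1 x.seq_prop
  have hanti : Antitone fun n => ‖x.seq (n + N)‖ := by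
    refine antitone_nat_of_succ_le fun n => ?_
    have h := hN (n + N) (Nat.le_add_left N n)
    have e : n + 1 + N = n + N + 1 := by omega
    rw [e, h]
    exact NonUnitalStarAlgHom.norm_apply_le φ _
  have hb : BddBelow (Set.range fun n => ‖x.seq (n + N)‖) :=
    ⟨0, by rintro _ ⟨n, rfl⟩; exact norm_nonneg _⟩
  have h := (tendsto_add_atTop_iff_nat (f := fun n => ‖x.seq n‖) N).1
    (tendsto_atTop_ciInf hanti hb)
  exact tendsto_nhds_limUnder ⟨_, h⟩

theorem limNorm_eq {x : PreLimit φ} {r : ℝ} (h : Tendsto (fun n => ‖x.seq n‖) atTop (𝓝 r)) :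
    x.limNorm = r :=
  tendsto_nhds_unique x.tendsto_limNorm h

/-- The seminorm `limₙ ‖xₙ‖`. -/
def limSeminorm : Seminorm ℂ (PreLimit φ) :=
  Seminorm.of limNorm
    (fun x y => le_of_tendsto_of_tendsto' (x + y).tendsto_limNorm
      (x.tendsto_limNorm.add y.tendsto_limNorm) fun n => norm_add_le _ _)
    (fun c x => limNorm_eq <| by
      simpa only [seq_smul, norm_smul] using x.tendsto_limNorm.const_mul ‖c‖)

instance : NonUnitalSeminormedRing (PreLimit φ) :=
  seminormedRing limSeminorm fun x y =>
    le_of_tendsto_of_tendsto' (x * y).tendsto_limNorm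
      (x.tendsto_limNorm.mul y.tendsto_limNorm) fun n => norm_mul_le _ _

theorem norm_def (x : PreLimit φ) : ‖x‖ = x.limNorm := rfl

instance : NormedSpace ℂ (PreLimit φ) where
  norm_smul_le c x := (map_smul_eq_mul limSeminorm c x).le

instance : IsPreCStar (PreLimit φ) where
  norm_star_mul x := by
    have h : Tendsto (fun n => ‖(star x * x).seq n‖) atTop (𝓝 (x.limNorm * x.limNorm)) := by
      simpa only [seq_mul, seq_star, CStarRing.norm_star_mul_self] using
        x.tendsto_limNorm.mul x.tendsto_limNorm
    exact limNorm_eq h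

/-- `(x₀, x₁, …) ↦ (φ x₀, φ x₁, …)`. -/
def push : PreLimit φ →⋆ₙₐ[ℂ] PreLimit φ where
  toFun x := ⟨fun n => φ (x.seq n), by
    filter_upwards [x.seq_prop] with n h
    exact congrArg φ h⟩
  map_smul' c x := Subtype.ext <| funext fun n => map_smul φ c (x.seq n)
  map_zero' := Subtype.ext <| funext fun _ => map_zero φ
  map_add' x y := Subtype.ext <| funext fun n => map_add φ (x.seq n) (y.seq n)
  map_mul' x y := Subtype.ext <| funext fun n => map_mul φ (x.seq n) (y.seq n)
  map_star' x := Subtype.ext <| funext fun n => map_star φ (x.seq n)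

/-- `(x₀, x₁, …) ↦ (0, x₀, x₁, …)`. -/
def delay : PreLimit φ →⋆ₙₐ[ℂ] PreLimit φ where
  toFun x := ⟨fun n => Nat.casesOn n 0 x.seq, by
    refine (eventually_atTop.2 ?_)
    obtain ⟨N, hN⟩ := eventually_atTop.1 x.seq_prop
    refine ⟨N + 1, fun n hn => ?_⟩
    obtain ⟨m, rfl⟩ : ∃ m, n = m + 1 := ⟨n - 1, by omega⟩
    exact hN m (by omega)⟩
  map_smul' c x := Subtype.ext <| funext fun n => by
    cases n
    · exact (smul_zero c).symm
    · rfl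
  map_zero' := Subtype.ext <| funext fun n => by cases n <;> rfl
  map_add' x y := Subtype.ext <| funext fun n => by
    cases n
    · exact (add_zero (0 : A)).symm
    · rfl
  map_mul' x y := Subtype.ext <| funext fun n => by
    cases n
    · exact (mul_zero (0 : A)).symm
    · rfl
  map_star' x := Subtype.ext <| funext fun n => by
    cases n
    · exact (star_zero A).symm
    · rfl

theorem seq_push (x : PreLimit φ) (n : ℕ) : (push x).seq n = φ (x.seq n) := rfl
theorem seq_delay_succ (x : PreLimit φ) (n : ℕ) : (delay x).seq (n + 1) = x.seq n := rfl

theorem norm_push_le (x : PreLimit φ) : ‖push x‖ ≤ ‖x‖ :=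
  le_of_tendsto_of_tendsto' (push x).tendsto_limNorm x.tendsto_limNorm
    fun n => NonUnitalStarAlgHom.norm_apply_le φ (x.seq n)

theorem norm_delay_le (x : PreLimit φ) : ‖delay x‖ ≤ ‖x‖ :=
  (limNorm_eq ((tendsto_add_atTop_iff_nat (f := fun n => ‖(delay x).seq n‖) 1).1
    x.tendsto_limNorm)).le

theorem norm_eq_zero_of_eventually {x : PreLimit φ} (h : ∀ᶠ n in atTop, x.seq n = 0) :
    ‖x‖ = 0 :=
  limNorm_eq <| tendsto_const_nhds.congr' <| h.mono fun _ hn => by simp [hn]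

theorem delay_push_sub (x : PreLimit φ) : ‖delay (push x) - x‖ = 0 := by
  refine norm_eq_zero_of_eventually (eventually_atTop.2 ?_)
  obtain ⟨N, hN⟩ := eventually_atTop.1 x.seq_prop
  refine ⟨N + 1, fun n hn => ?_⟩
  obtain ⟨m, rfl⟩ : ∃ m, n = m + 1 := ⟨n - 1, by omega⟩
  rw [seq_sub, seq_delay_succ, seq_push, hN m (by omega), sub_self]

theorem push_delay_sub (x : PreLimit φ) : ‖push (delay x) - x‖ = 0 := by
  refine norm_eq_zero_of_eventually (eventually_atTop.2 ?_)
  obtain ⟨N, hN⟩ := eventually_atTop.1 x.seq_prop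
  refine ⟨N + 1, fun n hn => ?_⟩
  obtain ⟨m, rfl⟩ : ∃ m, n = m + 1 := ⟨n - 1, by omega⟩
  rw [seq_sub, seq_push, seq_delay_succ, hN m (by omega), sub_self]

end PreLimit

/-- The direct limit `C*`-algebra `A_∞` of `A → A → A → ⋯`, all connecting maps equal to `φ`. -/
abbrev DirLim : Type u := CStarCompletion (PreLimit φ)

/-- The canonical map of the first copy of `A` into `A_∞`: `a ↦ [a, φ a, φ² a, …]`. -/
def DirLim.of : A →⋆ₙₐ[ℂ] DirLim φ :=
  CStarCompletion.of.comp
    { toFun := fun a => (⟨fun n => φ^[n] a, Eventually.of_forall fun n =>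
        Function.iterate_succ_apply' φ n a⟩ : PreLimit φ)
      map_smul' := fun c a => Subtype.ext <| funext fun n => by
        induction n with
        | zero => rfl
        | succ k ih =>
          refine (Function.iterate_succ_apply' φ k _).trans ((congrArg φ ih).trans ?_)
          exact (map_smul φ c _).trans (congrArg (c • ·) (Function.iterate_succ_apply' φ k a).symm)
      map_zero' := Subtype.ext <| funext fun n => iterate_map_zero φ n
      map_add' := fun a b => Subtype.ext <| funext fun n => iterate_map_add φ n a b
      map_mul' := fun a b => Subtype.ext <| funext fun n => iterate_map_mul φ n a b
      map_star' := fun a => Subtype.ext <| funext fun n => by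
        induction n with
        | zero => rfl
        | succ k ih =>
          refine (Function.iterate_succ_apply' φ k _).trans ((congrArg φ ih).trans ?_)
          exact (map_star φ _).trans (congrArg star (Function.iterate_succ_apply' φ k a).symm) }

/-- The `*`-automorphism `φ_∞` of `A_∞`, `[x₀, x₁, …] ↦ [φ x₀, φ x₁, …]`. -/
def limAut : DirLim φ ≃⋆ₐ[ℂ] DirLim φ :=
  CStarCompletion.autOfInverse PreLimit.push PreLimit.delay PreLimit.norm_push_le
    PreLimit.norm_delay_le PreLimit.delay_push_sub PreLimit.push_delay_sub

end DirectLimit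


section Tail

variable {C : Type u} [CStarAlgebra C] (α : C →⋆ₐ[ℂ] C)

/-- The ideal `ker α`, as a (non-unital) `C*`-algebra. -/
def kerAlg : NonUnitalStarSubalgebra ℂ C where
  carrier := {c | α c = 0}
  add_mem' {a b} ha hb := by
    change α a = 0 at ha; change α b = 0 at hb; change α (a + b) = 0
    rw [map_add, ha, hb, add_zero]
  zero_mem' := map_zero α
  mul_mem' {a b} ha hb := by
    change α a = 0 at ha; change α (a * b) = 0
    rw [map_mul, ha, zero_mul]
  smul_mem' c a ha := by
    change α a = 0 at ha; change α (c • a) = 0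
    rw [map_smul, ha, smul_zero]
  star_mem' {a} ha := by
    change α a = 0 at ha; change α (star a) = 0
    rw [map_star, ha, star_zero]

theorem continuous_starAlgHom {D : Type v} [CStarAlgebra D] (f : C →⋆ₐ[ℂ] D) : Continuous f :=
  AddMonoidHomClass.continuous_of_bound f 1 fun c => by
    simpa using NonUnitalStarAlgHom.norm_apply_le f c

instance isClosed_kerAlg : IsClosed (kerAlg α : Set C) :=
  isClosed_eq (continuous_starAlgHom α) continuous_const

theorem mul_mem_kerAlg (c : C) {k : C} (hk : k ∈ kerAlg α) : c * k ∈ kerAlg α := by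
  change α k = 0 at hk; change α (c * k) = 0
  rw [map_mul, hk, mul_zero]

theorem mem_kerAlg_mul (c : C) {k : C} (hk : k ∈ kerAlg α) : k * c ∈ kerAlg α := by
  change α k = 0 at hk; change α (k * c) = 0
  rw [map_mul, hk, zero_mul]

/-- The multiplier algebra `M(ker α)`. -/
abbrev KerMultiplier : Type u := 𝓜(ℂ, kerAlg α)

/-- The multiplier `θ c` of `ker α`: left and right multiplication by `c`. -/
def thetaFun (c : C) : KerMultiplier α where
  fst := LinearMap.mkContinuous
    { toFun := fun k => ⟨c * k, mul_mem_kerAlg α c k.2⟩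
      map_add' := fun x y => Subtype.ext (mul_add c (x : C) y)
      map_smul' := fun r x => Subtype.ext (mul_smul_comm r c (x : C)) } ‖c‖
    fun k => norm_mul_le c (k : C)
  snd := LinearMap.mkContinuous
    { toFun := fun k => ⟨k * c, mem_kerAlg_mul α c k.2⟩
      map_add' := fun x y => Subtype.ext (add_mul (x : C) y c)
      map_smul' := fun r x => Subtype.ext (smul_mul_assoc r (x : C) c) } ‖c‖
    fun k => (norm_mul_le (k : C) c).trans (mul_comm _ _).le
  central := fun x y => Subtype.ext (mul_assoc (x : C) c y)

theorem thetaFun_fst (c : C) (k : kerAlg α) : ((thetaFun α c).fst k : C) = c * k := rfl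
theorem thetaFun_snd (c : C) (k : kerAlg α) : ((thetaFun α c).snd k : C) = k * c := rfl

theorem multiplier_ext {a b : KerMultiplier α} (h1 : ∀ k, (a.fst k : C) = b.fst k)
    (h2 : ∀ k, (a.snd k : C) = b.snd k) : a = b :=
  DoubleCentralizer.ext _ _ _ _ <| Prod.ext
    (ContinuousLinearMap.ext fun k => Subtype.ext (h1 k))
    (ContinuousLinearMap.ext fun k => Subtype.ext (h2 k))

/-- The unital `*`-homomorphism `θ : C → M(ker α)` that extends the natural embedding
`ker α → M(ker α)`. -/
def theta : C →⋆ₐ[ℂ] KerMultiplier α where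
  toFun := thetaFun α
  map_one' := multiplier_ext α (fun k => one_mul (k : C)) (fun k => mul_one (k : C))
  map_mul' c d := multiplier_ext α (fun k => mul_assoc c d (k : C))
    (fun k => (mul_assoc (k : C) c d).symm)
  map_zero' := multiplier_ext α (fun k => zero_mul (k : C)) (fun k => mul_zero (k : C))
  map_add' c d := multiplier_ext α (fun k => add_mul c d (k : C)) (fun k => mul_add (k : C) c d)
  commutes' r := multiplier_ext α
    (fun k => by
      change algebraMap ℂ C r * (k : C) = r • (k : C)
      rw [Algebra.smul_def])
    (fun k => by
      change (k : C) * algebraMap ℂ C r = r • (k : C)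
      rw [Algebra.smul_def, Algebra.commutes])
  map_star' c := multiplier_ext α
    (fun k => by
      change star c * (k : C) = star (star (k : C) * c)
      rw [star_mul, star_star])
    (fun k => by
      change (k : C) * star c = star (c * star (k : C))
      rw [star_mul, star_star])

theorem theta_coe (k : kerAlg α) : theta α (k : C) = (k : KerMultiplier α) := rfl

/-- The image of a `*`-homomorphism of unital `C*`-algebras is closed. -/
theorem isClosed_range {D : Type v} [CStarAlgebra D] (f : C →⋆ₐ[ℂ] D) :
    IsClosed (f.range : Set D) := by
  -- self-adjoint elements lift without increasing the norm
  have sa : ∀ c : C, IsSelfAdjoint c → ∃ g : C, f g = f c ∧ ‖g‖ ≤ ‖f c‖ := by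
    intro c hc
    set r := ‖f c‖ with hr
    have hfc : IsSelfAdjoint (f c) := hc.map f
    have hcont : Continuous fun t : ℝ => max (-r) (min r t) := by fun_prop
    refine ⟨cfc (fun t : ℝ => max (-r) (min r t)) c, ?_, ?_⟩
    · have hmap := StarAlgHomClass.map_cfc (S := ℂ) f (fun t : ℝ => max (-r) (min r t)) c
        hcont.continuousOn (continuous_starAlgHom f) hc hfc
      rw [hmap]
      conv_rhs => rw [← cfc_id' ℝ (f c) hfc]
      refine cfc_congr fun t ht => ?_
      rcases subsingleton_or_nontrivial D with hD | hD
      · rw [spectrum.of_subsingleton] at ht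
        exact ht.elim
      have h := spectrum.norm_le_norm_of_mem ht
      rw [Real.norm_eq_abs, abs_le] at h
      simp only [hr]
      rw [min_eq_right h.2, max_eq_right h.1]
    · refine norm_cfc_le (norm_nonneg _) fun t _ => ?_
      rw [Real.norm_eq_abs, abs_le]
      have hr0 : 0 ≤ r := norm_nonneg _
      exact ⟨le_max_left _ _, max_le (by linarith) (min_le_left _ _)⟩
  have lift : ∀ d ∈ f.range, ∃ g : C, f g = d ∧ ‖g‖ ≤ 2 * ‖d‖ := by
    rintro _ ⟨c, rfl⟩
    obtain ⟨g, hg, hgn⟩ := sa (realPart c : C) (realPart c).2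
    obtain ⟨h, hh, hhn⟩ := sa (imaginaryPart c : C) (imaginaryPart c).2
    have hs : ∀ (t : ℝ) (x : C), f (t • x) = t • f x := fun t x => by
      rw [← Complex.coe_smul, map_smul, Complex.coe_smul]
    have e1 : f (realPart c : C) = (realPart (f c) : D) := by
      simp [realPart_apply_coe, hs]
      exact map_star f c
    have e2 : f (imaginaryPart c : C) = (imaginaryPart (f c) : D) := by
      simp [imaginaryPart_apply_coe, hs]
      exact map_star f c
    refine ⟨g + Complex.I • h, ?_, ?_⟩
    · rw [map_add, map_smul, hg, hh, ← map_smul, ← map_add, realPart_add_I_smul_imaginaryPart]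
      rfl
    · have n1 := realPart.norm_le (f c)
      have n2 := imaginaryPart.norm_le (f c)
      rw [e1] at hgn
      rw [e2] at hhn
      have n3 := norm_add_le g (Complex.I • h)
      rw [norm_smul, Complex.norm_I, one_mul] at n3
      calc ‖g + Complex.I • h‖ ≤ ‖g‖ + ‖h‖ := n3
        _ ≤ ‖f c‖ + ‖f c‖ := add_le_add (hgn.trans n1) (hhn.trans n2)
        _ = 2 * ‖f c‖ := by ring
  let F : NormedAddGroupHom C D :=
    (f : C →+ D).mkNormedAddGroupHom 1 fun c => by
      simpa using NonUnitalStarAlgHom.norm_apply_le f c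
  have hF : F.SurjectiveOnWith F.range.topologicalClosure (2 + 1) := by
    refine controlled_closure_of_complete two_pos one_pos ?_
    rintro _ ⟨c, rfl⟩
    exact lift (f c) ⟨c, rfl⟩
  refine isClosed_of_closure_subset fun d hd => ?_
  obtain ⟨g, hg, -⟩ := hF d hd
  exact ⟨g, hg⟩

instance isClosed_theta_range : IsClosed ((theta α).range : Set (KerMultiplier α)) :=
  isClosed_range (theta α)

/-- The tail `T = c₀(θ(C))`: sequences in `θ(C)` that tend to `0`. -/
abbrev Tail : Type u := C₀(ℕ, (theta α).range)

/-- The `C*`-algebra `B = C ⊕ T`. -/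
abbrev TailAlg : Type u := C × Tail α

/-- `(x₁, x₂, …) ↦ (d, x₁, x₂, …)`. -/
def tailCons (d : (theta α).range) (x : Tail α) : Tail α where
  toFun := fun n => Nat.casesOn n d x
  continuous_toFun := continuous_of_discreteTopology
  zero_at_infty' := by
    have h := x.zero_at_infty'
    rw [Filter.cocompact_eq_cofinite, Nat.cofinite_eq_atTop] at h ⊢
    exact (tendsto_add_atTop_iff_nat
      (f := fun n : ℕ => (Nat.casesOn n d x : (theta α).range)) 1).1 h

theorem tail_ext {x y : Tail α} (h0 : x 0 = y 0) (h : ∀ n, x (n + 1) = y (n + 1)) : x = y :=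
  ZeroAtInftyContinuousMap.ext fun n => by
    cases n
    · exact h0
    · exact h _

/-- The `*`-endomorphism `β` of `B`: `β(c, (x₁, x₂, …)) = (α c, (θ c, x₁, x₂, …))`. -/
def tailEnd : TailAlg α →⋆ₙₐ[ℂ] TailAlg α where
  toFun b := (α b.1, tailCons α ((theta α).rangeRestrict b.1) b.2)
  map_smul' r b := Prod.ext (map_smul α r b.1)
    (tail_ext α (map_smul (theta α).rangeRestrict r b.1) fun _ => rfl)
  map_zero' := Prod.ext (map_zero α) (tail_ext α (map_zero (theta α).rangeRestrict) fun _ => rfl)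
  map_add' a b := Prod.ext (map_add α a.1 b.1)
    (tail_ext α (map_add (theta α).rangeRestrict a.1 b.1) fun _ => rfl)
  map_mul' a b := Prod.ext (map_mul α a.1 b.1)
    (tail_ext α (map_mul (theta α).rangeRestrict a.1 b.1) fun _ => rfl)
  map_star' b := Prod.ext (map_star α b.1)
    (tail_ext α (map_star (theta α).rangeRestrict b.1) fun _ => rfl)

/-- The inclusion `C → B`, `c ↦ (c, 0)`. -/
def tailIncl : C →⋆ₙₐ[ℂ] TailAlg α := NonUnitalStarAlgHom.inl ℂ C (Tail α)


end Tail


section Semicrossed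

variable {C : Type u} [CStarAlgebra C] (α : C →⋆ₐ[ℂ] C)

/-- The space `ℓ¹(ℤ₊, C)`; the element `∑ₙ δₙ ⊗ cₙ` is the sequence `n ↦ cₙ`. It becomes the
Banach algebra `ℓ¹(ℤ₊, C, α)_l` with the product
`(δₙ ⊗ c) (δₘ ⊗ y) = δₙ₊ₘ ⊗ αᵐ(c) y`. -/
def Ell1 (_α : C →⋆ₐ[ℂ] C) : Type u := lp (fun _ : ℕ => C) 1

namespace Ell1

instance : AddCommGroup (Ell1 α) := inferInstanceAs (AddCommGroup (lp (fun _ : ℕ => C) 1))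
instance : Module ℂ (Ell1 α) := inferInstanceAs (Module ℂ (lp (fun _ : ℕ => C) 1))

variable {α}

/-- The coefficient sequence. -/
def coeff (F : Ell1 α) : ℕ → C := F.1

theorem ext {F G : Ell1 α} (h : ∀ n, F.coeff n = G.coeff n) : F = G :=
  Subtype.ext (funext h)

theorem coeff_add (F G : Ell1 α) (n : ℕ) : (F + G).coeff n = F.coeff n + G.coeff n := rfl
theorem coeff_smul (r : ℂ) (F : Ell1 α) (n : ℕ) : (r • F).coeff n = r • F.coeff n := rfl
theorem coeff_zero (n : ℕ) : (0 : Ell1 α).coeff n = 0 := rfl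

theorem memℓp_one_iff (f : ℕ → C) : Memℓp f 1 ↔ Summable fun n => ‖f n‖ := by
  rw [memℓp_gen_iff (by simp)]
  simp

theorem summable (F : Ell1 α) : Summable fun n => ‖F.coeff n‖ := (memℓp_one_iff _).1 F.2

/-- The element `∑ₙ δₙ ⊗ f n` for an absolutely summable `f`. -/
def mk (f : ℕ → C) (hf : Summable fun n => ‖f n‖) : Ell1 α := ⟨f, (memℓp_one_iff f).2 hf⟩

theorem coeff_mk (f : ℕ → C) (hf : Summable fun n => ‖f n‖) (n : ℕ) :
    (mk f hf : Ell1 α).coeff n = f n := rfl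

theorem norm_pow_apply_le (n : ℕ) (c : C) : ‖(α ^ n) c‖ ≤ ‖c‖ :=
  NonUnitalStarAlgHom.norm_apply_le (α ^ n) c

/-- The coefficients of a product. -/
def mulFun (F G : Ell1 α) (n : ℕ) : C :=
  ∑ p ∈ Finset.HasAntidiagonal.antidiagonal n, (α ^ p.2) (F.coeff p.1) * G.coeff p.2

theorem summable_mulFun (F G : Ell1 α) : Summable fun n => ‖mulFun F G n‖ := by
  have h := summable_norm_sum_mul_antidiagonal_of_summable_norm (R := ℝ)
    (f := fun n => ‖F.coeff n‖) (g := fun n => ‖G.coeff n‖)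
    (by simpa using F.summable) (by simpa using G.summable)
  refine Summable.of_nonneg_of_le (fun _ => norm_nonneg _) (fun n => ?_) h
  refine (norm_sum_le _ _).trans (le_trans ?_ (le_abs_self _))
  refine Finset.sum_le_sum fun p _ => (norm_mul_le _ _).trans ?_
  exact mul_le_mul_of_nonneg_right (norm_pow_apply_le _ _) (norm_nonneg _)

instance : Mul (Ell1 α) := ⟨fun F G => mk (mulFun F G) (summable_mulFun F G)⟩

theorem coeff_mul (F G : Ell1 α) (n : ℕ) : (F * G).coeff n =
    ∑ p ∈ Finset.HasAntidiagonal.antidiagonal n, (α ^ p.2) (F.coeff p.1) * G.coeff p.2 := rfl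

variable (α) in
/-- The element `δₙ ⊗ c`. -/
def delta (n : ℕ) (c : C) : Ell1 α := lp.single 1 n c

theorem coeff_delta (n : ℕ) (c : C) (m : ℕ) :
    (delta α n c).coeff m = if m = n then c else 0 := by
  change (lp.single 1 n c : lp (fun _ : ℕ => C) 1) m = _
  rw [lp.single_apply, Pi.single_apply]

instance : One (Ell1 α) := ⟨delta α 0 1⟩

theorem coeff_one (m : ℕ) : (1 : Ell1 α).coeff m = if m = 0 then 1 else 0 := coeff_delta 0 1 m

instance : Ring (Ell1 α) :=
  { (inferInstance : AddCommGroup (Ell1 α)), (inferInstance : Mul (Ell1 α)),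
    (inferInstance : One (Ell1 α)) with
    left_distrib := fun F G K => ext fun n => by
      simp only [coeff_mul, coeff_add, mul_add, Finset.sum_add_distrib]
    right_distrib := fun F G K => ext fun n => by
      simp only [coeff_mul, coeff_add, map_add, add_mul, Finset.sum_add_distrib]
    zero_mul := fun F => ext fun n => by simp [coeff_mul, coeff_zero]
    mul_zero := fun F => ext fun n => by simp [coeff_mul, coeff_zero]
    one_mul := fun F => ext fun n => by
      rw [coeff_mul, Finset.sum_eq_single (0, n)]
      · simp [coeff_one]
      · rintro ⟨i, j⟩ hp hne
        have hi : i ≠ 0 := by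
          rintro rfl
          exact hne (by simpa using hp)
        simp [coeff_one, hi]
      · intro h
        exact absurd (by simp) h
    mul_one := fun F => ext fun n => by
      rw [coeff_mul, Finset.sum_eq_single (n, 0)]
      · simp only [coeff_one, if_true, mul_one, pow_zero]
        rfl
      · rintro ⟨i, j⟩ hp hne
        have hj : j ≠ 0 := by
          rintro rfl
          exact hne (by simpa using hp)
        simp [coeff_one, hj]
      · intro h
        exact absurd (by simp) h
    mul_assoc := fun F G K => ext fun n => by
      simp only [coeff_mul, map_sum, map_mul, Finset.sum_mul, Finset.mul_sum, Finset.sum_sigma']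
      refine Finset.sum_nbij' (fun x => ⟨(x.2.1, x.2.2 + x.1.2), (x.2.2, x.1.2)⟩)
        (fun x => ⟨(x.1.1 + x.2.1, x.2.2), (x.1.1, x.2.1)⟩) ?_ ?_ ?_ ?_ ?_
      · rintro ⟨⟨i, j⟩, ⟨k, l⟩⟩ h
        simp only [Finset.mem_sigma, Finset.HasAntidiagonal.mem_antidiagonal] at h ⊢
        obtain ⟨h1, h2⟩ := h
        constructor <;> lia
      · rintro ⟨⟨i, j⟩, ⟨k, l⟩⟩ h
        simp only [Finset.mem_sigma, Finset.HasAntidiagonal.mem_antidiagonal] at h ⊢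
        obtain ⟨h1, h2⟩ := h
        constructor <;> lia
      · rintro ⟨⟨i, j⟩, ⟨k, l⟩⟩ h
        simp only [Finset.mem_sigma, Finset.HasAntidiagonal.mem_antidiagonal] at h
        obtain ⟨-, rfl⟩ := h
        rfl
      · rintro ⟨⟨i, j⟩, ⟨k, l⟩⟩ h
        simp only [Finset.mem_sigma, Finset.HasAntidiagonal.mem_antidiagonal] at h
        obtain ⟨-, rfl⟩ := h
        rfl
      · rintro ⟨⟨i, j⟩, ⟨k, l⟩⟩ h
        dsimp only
        rw [add_comm l j, pow_add, mul_assoc]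
        rfl }

instance : Algebra ℂ (Ell1 α) :=
  Algebra.ofModule
    (fun r F G => ext fun n => by
      simp only [coeff_mul, coeff_smul, map_smul, smul_mul_assoc, Finset.smul_sum])
    (fun r F G => ext fun n => by
      simp only [coeff_mul, coeff_smul, mul_smul_comm, Finset.smul_sum])

end Ell1

/-- The four kinds of covariant pairs. -/
inductive PairKind
  | contractive
  | isometric
  | coisometric
  | unitary

/-- The condition that a covariant pair of the given kind imposes on its operator. -/
def PairKind.Holds {H : Type u} [NormedAddCommGroup H] [InnerProductSpace ℂ H] [CompleteSpace H] :
    PairKind → (H →L[ℂ] H) → Prop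
  | contractive, V => ‖V‖ ≤ 1
  | isometric, V => star V * V = 1
  | coisometric, V => V * star V = 1
  | unitary, V => star V * V = 1 ∧ V * star V = 1

theorem PairKind.Holds.norm_le_one {H : Type u} [NormedAddCommGroup H] [InnerProductSpace ℂ H]
    [CompleteSpace H] {t : PairKind} {V : H →L[ℂ] H} (h : t.Holds V) : ‖V‖ ≤ 1 := by
  have h1 : ‖(1 : H →L[ℂ] H)‖ ≤ 1 := ContinuousLinearMap.norm_id_le
  have iso : ∀ W : H →L[ℂ] H, star W * W = 1 → ‖W‖ ≤ 1 := fun W hW => by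
    have e := CStarRing.norm_star_mul_self (x := W)
    rw [hW] at e
    nlinarith [norm_nonneg W]
  cases t with
  | contractive => exact h
  | isometric => exact iso V h
  | coisometric =>
    have := iso (star V) (by rw [star_star]; exact h)
    rwa [norm_star] at this
  | unitary => exact iso V h.1

/-- A left covariant pair `(π, V)` of the given kind for `(C, α)`: a (possibly degenerate)
`*`-representation `π` of `C` on a Hilbert space `H` and an operator `V` on `H` with
`π(c) V = V π(α(c))`. -/
structure LeftCovariantPair (t : PairKind) : Type (u + 1) where
  H : Type u
  [normedAddCommGroup : NormedAddCommGroup H]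
  [innerProductSpace : InnerProductSpace ℂ H]
  [completeSpace : CompleteSpace H]
  π : C →⋆ₙₐ[ℂ] (H →L[ℂ] H)
  V : H →L[ℂ] H
  kind : t.Holds V
  covariant : ∀ c, π c * V = V * π (α c)

attribute [instance] LeftCovariantPair.normedAddCommGroup LeftCovariantPair.innerProductSpace
  LeftCovariantPair.completeSpace

namespace LeftCovariantPair

variable {α} {t : PairKind} (p : LeftCovariantPair α t)

theorem norm_pow_mul_le (n : ℕ) (c : C) : ‖p.V ^ n * p.π c‖ ≤ ‖c‖ := by
  have hV : ‖p.V ^ n‖ ≤ 1 := by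
    induction n with
    | zero => rw [pow_zero]; exact ContinuousLinearMap.norm_id_le
    | succ k ih =>
      rw [pow_succ]
      exact (norm_mul_le _ _).trans (mul_le_one₀ ih (norm_nonneg _) p.kind.norm_le_one)
  calc ‖p.V ^ n * p.π c‖ ≤ ‖p.V ^ n‖ * ‖p.π c‖ := norm_mul_le _ _
    _ ≤ 1 * ‖c‖ := mul_le_mul hV (NonUnitalStarAlgHom.norm_apply_le p.π c) (norm_nonneg _)
        zero_le_one
    _ = ‖c‖ := one_mul _

theorem summable_norm (F : Ell1 α) : Summable fun n => ‖p.V ^ n * p.π (F.coeff n)‖ :=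
  Summable.of_nonneg_of_le (fun _ => norm_nonneg _) (fun n => p.norm_pow_mul_le n _) F.summable

theorem summable (F : Ell1 α) : Summable fun n => p.V ^ n * p.π (F.coeff n) :=
  (p.summable_norm F).of_norm

/-- The representation `V × π` of `ℓ¹(ℤ₊, C, α)_l`: `∑ₙ δₙ ⊗ cₙ ↦ ∑ₙ Vⁿ π(cₙ)`. -/
def integrated : Ell1 α →ₗ[ℂ] (p.H →L[ℂ] p.H) where
  toFun F := ∑' n, p.V ^ n * p.π (F.coeff n)
  map_add' F G := by
    rw [← (p.summable F).tsum_add (p.summable G)]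
    exact tsum_congr fun n => by rw [Ell1.coeff_add, map_add, mul_add]
  map_smul' r F := by
    rw [RingHom.id_apply, ← tsum_const_smul'' r]
    exact tsum_congr fun n => by rw [Ell1.coeff_smul, map_smul, mul_smul_comm]

theorem integrated_apply (F : Ell1 α) :
    p.integrated F = ∑' n, p.V ^ n * p.π (F.coeff n) := rfl

theorem norm_integrated_le (F : Ell1 α) : ‖p.integrated F‖ ≤ ∑' n, ‖F.coeff n‖ :=
  (norm_tsum_le_tsum_norm (p.summable_norm F)).trans
    ((p.summable_norm F).tsum_le_tsum (fun n => p.norm_pow_mul_le n _) F.summable)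

theorem pi_mul_pow (m : ℕ) : ∀ c, p.π c * p.V ^ m = p.V ^ m * p.π ((α ^ m) c) := by
  induction m with
  | zero => intro c; rw [pow_zero, pow_zero, mul_one, one_mul]; rfl
  | succ k ih =>
    intro c
    rw [pow_succ', ← mul_assoc, p.covariant, mul_assoc, ih, ← mul_assoc, pow_succ]
    rfl

theorem integrated_mul (F G : Ell1 α) :
    p.integrated (F * G) = p.integrated F * p.integrated G := by
  rw [integrated_apply, integrated_apply, integrated_apply,
    tsum_mul_tsum_eq_tsum_sum_antidiagonal_of_summable_norm (p.summable_norm F)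
      (p.summable_norm G)]
  refine tsum_congr fun n => ?_
  rw [Ell1.coeff_mul, map_sum, Finset.mul_sum]
  refine Finset.sum_congr rfl fun q hq => ?_
  rw [← Finset.HasAntidiagonal.mem_antidiagonal.1 hq, map_mul, pow_add, mul_assoc, ← mul_assoc (p.V ^ q.2),
    ← pi_mul_pow]
  simp only [mul_assoc]

end LeftCovariantPair

/-- `ℓ¹(ℤ₊, C, α)_l` with the seminorm `ω₁(F) = sup ‖(V × π)(F)‖`, the supremum over all left
covariant pairs of kind `t`. -/
def SemiEll1 (α : C →⋆ₐ[ℂ] C) (_t : PairKind) : Type u := Ell1 α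

namespace SemiEll1

variable {α} {t : PairKind}

instance : Ring (SemiEll1 α t) := inferInstanceAs (Ring (Ell1 α))
instance : Algebra ℂ (SemiEll1 α t) := inferInstanceAs (Algebra ℂ (Ell1 α))

/-- An element of `ℓ¹(ℤ₊, C, α)_l`, viewed in `SemiEll1 α t`. -/
def mk (F : Ell1 α) : SemiEll1 α t := F

/-- The representation `V × π`, viewed on `SemiEll1 α t`. -/
def rep (p : LeftCovariantPair α t) : SemiEll1 α t →ₗ[ℂ] (p.H →L[ℂ] p.H) := p.integrated

theorem rep_mk (p : LeftCovariantPair α t) (F : Ell1 α) : rep p (mk F) = p.integrated F := rfl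

theorem rep_mul (p : LeftCovariantPair α t) (F G : SemiEll1 α t) :
    rep p (F * G) = rep p F * rep p G := p.integrated_mul F G

theorem bddAbove (F : SemiEll1 α t) :
    BddAbove (Set.range fun p : LeftCovariantPair α t => ‖rep p F‖) :=
  ⟨∑' n, ‖Ell1.coeff F n‖, by rintro _ ⟨p, rfl⟩; exact p.norm_integrated_le F⟩

theorem iSup_nonneg (F : SemiEll1 α t) : 0 ≤ ⨆ p : LeftCovariantPair α t, ‖rep p F‖ :=
  Real.iSup_nonneg fun _ => norm_nonneg _

/-- The seminorm `ω₁`. -/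
def omega : Seminorm ℂ (SemiEll1 α t) :=
  Seminorm.of (fun F => ⨆ p : LeftCovariantPair α t, ‖rep p F‖)
    (fun F G => Real.iSup_le
      (fun p => by
        rw [map_add]
        exact (norm_add_le _ _).trans
          (add_le_add (le_ciSup (bddAbove F) p) (le_ciSup (bddAbove G) p)))
      (add_nonneg (iSup_nonneg F) (iSup_nonneg G)))
    (fun r F => by
      rw [Real.mul_iSup_of_nonneg (norm_nonneg r)]
      exact iSup_congr fun p => by rw [map_smul, norm_smul])

theorem omega_apply (F : SemiEll1 α t) :
    omega F = ⨆ p : LeftCovariantPair α t, ‖rep p F‖ := rfl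

theorem norm_rep_le_omega (p : LeftCovariantPair α t) (F : SemiEll1 α t) :
    ‖rep p F‖ ≤ omega F := le_ciSup (bddAbove F) p

theorem omega_mul_le (F G : SemiEll1 α t) : omega (F * G) ≤ omega F * omega G :=
  Real.iSup_le
    (fun p => by
      rw [rep_mul]
      exact (norm_mul_le _ _).trans
        (mul_le_mul (norm_rep_le_omega p F) (norm_rep_le_omega p G)
          (norm_nonneg _) (iSup_nonneg F)))
    (mul_nonneg (iSup_nonneg F) (iSup_nonneg G))

instance : SeminormedRing (SemiEll1 α t) :=
  { seminormedRing (omega (α := α) (t := t)) omega_mul_le,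
    (inferInstance : Ring (SemiEll1 α t)) with }

theorem norm_def (F : SemiEll1 α t) : ‖F‖ = omega F := rfl

instance : NormedAlgebra ℂ (SemiEll1 α t) where
  norm_smul_le r F := (map_smul_eq_mul (omega (α := α) (t := t)) r F).le

end SemiEll1

/-- The semicrossed product of `(C, α)` with respect to the left covariant pairs of kind `t`:
the enveloping operator algebra of `ℓ¹(ℤ₊, C, α)_l` with respect to the representations `V × π`,
that is, the completion of `ℓ¹(ℤ₊, C, α)_l / ker ω₁` in the norm `ω₁`. -/
abbrev Semicrossed (t : PairKind) : Type u := Completion (SemiEll1 α t)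

/-- The canonical map `ℓ¹(ℤ₊, C, α)_l → Semicrossed α t`. -/
def Semicrossed.of (t : PairKind) (F : Ell1 α) : Semicrossed α t :=
  ((SemiEll1.mk F : SemiEll1 α t) : Completion (SemiEll1 α t))

/-- The extension of `V × π` to the semicrossed product. -/
def LeftCovariantPair.extended {α : C →⋆ₐ[ℂ] C} {t : PairKind} (p : LeftCovariantPair α t) :
    Semicrossed α t → (p.H →L[ℂ] p.H) :=
  Completion.extension (SemiEll1.rep p)

theorem LeftCovariantPair.extended_of {α : C →⋆ₐ[ℂ] C} {t : PairKind}
    (p : LeftCovariantPair α t) (F : Ell1 α) :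
    p.extended (Semicrossed.of α t F) = p.integrated F :=
  Completion.extension_coe
    ((SemiEll1.rep p).mkContinuous 1 fun F => by
      rw [one_mul]; exact SemiEll1.norm_rep_le_omega p F).uniformContinuous (SemiEll1.mk F)

end Semicrossed


section Crossed

variable {A : Type u} [NonUnitalCStarAlgebra A] (γ : A ≃⋆ₐ[ℂ] A)

/-- The space `c₀₀(ℤ, A)` of finitely supported sequences, with the convolution product
`(δₖ ⊗ a) (δₘ ⊗ b) = δₖ₊ₘ ⊗ γᵐ(a) b` and the involution `(δₙ ⊗ a)* = δ₋ₙ ⊗ γ⁻ⁿ(a*)`. -/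
def FinConv (_γ : A ≃⋆ₐ[ℂ] A) : Type u := ℤ →₀ A

namespace FinConv

instance : AddCommGroup (FinConv γ) := inferInstanceAs (AddCommGroup (ℤ →₀ A))
instance : Module ℂ (FinConv γ) := inferInstanceAs (Module ℂ (ℤ →₀ A))

/-- The element `δₙ ⊗ a`. -/
def delta (n : ℤ) : A →ₗ[ℂ] FinConv γ := Finsupp.lsingle n

variable {γ}

theorem induction_linear {p : FinConv γ → Prop} (F : FinConv γ) (h0 : p 0)
    (hadd : ∀ F G, p F → p G → p (F + G)) (hdelta : ∀ n a, p (delta γ n a)) : p F :=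
  Finsupp.induction_linear (motive := p) F h0 (fun F G => hadd F G) hdelta

/-- The linear extension of a map given on the elements `δₙ ⊗ a`. -/
def lift {M : Type v} [AddCommGroup M] [Module ℂ M] (f : ℤ → A →ₗ[ℂ] M) : FinConv γ →ₗ[ℂ] M :=
  Finsupp.lsum ℂ f

theorem lift_delta {M : Type v} [AddCommGroup M] [Module ℂ M] (f : ℤ → A →ₗ[ℂ] M) (n : ℤ)
    (a : A) : lift f (delta γ n a) = f n a :=
  Finsupp.lsum_single ℂ f n a

/-- `γⁿ` as a linear map. -/
def powL (γ : A ≃⋆ₐ[ℂ] A) (n : ℤ) : A →ₗ[ℂ] A where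
  toFun := ⇑(γ ^ n)
  map_add' := map_add (γ ^ n)
  map_smul' := map_smul (γ ^ n)

/-- The convolution product. -/
def mulL : FinConv γ →ₗ[ℂ] FinConv γ →ₗ[ℂ] FinConv γ :=
  lift fun k => LinearMap.flip (lift fun m =>
    LinearMap.flip ((LinearMap.compr₂ (LinearMap.mul ℂ A) (delta γ (k + m))).comp (powL γ m)))

instance : Mul (FinConv γ) := ⟨fun F G => mulL F G⟩

theorem mul_def (F G : FinConv γ) : F * G = mulL F G := rfl

theorem delta_mul_delta (k m : ℤ) (a b : A) :
    delta γ k a * delta γ m b = delta γ (k + m) ((γ ^ m) a * b) := by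
  rw [mul_def, mulL, lift_delta, LinearMap.flip_apply, lift_delta]
  rfl

theorem zpow_add_apply (m n : ℤ) (a : A) : (γ ^ (m + n)) a = (γ ^ m) ((γ ^ n) a) := by
  rw [zpow_add]; rfl

theorem zpow_neg_apply_zpow (n : ℤ) (a : A) : (γ ^ (-n)) ((γ ^ n) a) = a := by
  rw [← zpow_add_apply, neg_add_cancel, zpow_zero]; rfl

protected theorem mul_add' (F G K : FinConv γ) : F * (G + K) = F * G + F * K :=
  map_add (mulL F) G K

protected theorem add_mul' (F G K : FinConv γ) : (F + G) * K = F * K + G * K := by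
  simp only [mul_def, map_add, LinearMap.add_apply]

protected theorem zero_mul' (F : FinConv γ) : 0 * F = 0 := by
  simp only [mul_def, map_zero, LinearMap.zero_apply]

protected theorem mul_zero' (F : FinConv γ) : F * 0 = 0 := map_zero (mulL F)

instance : NonUnitalRing (FinConv γ) :=
  { (inferInstance : AddCommGroup (FinConv γ)), (inferInstance : Mul (FinConv γ)) with
    left_distrib := FinConv.mul_add'
    right_distrib := FinConv.add_mul'
    zero_mul := FinConv.zero_mul'
    mul_zero := FinConv.mul_zero'
    mul_assoc := fun F G K => by
      induction F using induction_linear with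
      | h0 => simp only [FinConv.zero_mul']
      | hadd F F' h h' => simp only [FinConv.add_mul', h, h']
      | hdelta k a =>
      induction G using induction_linear with
      | h0 => simp only [FinConv.zero_mul', FinConv.mul_zero']
      | hadd F F' h h' => simp only [FinConv.add_mul', FinConv.mul_add', h, h']
      | hdelta m b =>
      induction K using induction_linear with
      | h0 => simp only [FinConv.mul_zero']
      | hadd F F' h h' => simp only [FinConv.mul_add', h, h']
      | hdelta n c =>
        rw [delta_mul_delta, delta_mul_delta, delta_mul_delta, delta_mul_delta, map_mul (γ ^ n),
          add_comm m n, zpow_add_apply, mul_assoc, add_comm n m, add_assoc] }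

instance : IsScalarTower ℂ (FinConv γ) (FinConv γ) where
  smul_assoc r F G := by
    simp only [smul_eq_mul, mul_def, map_smul, LinearMap.smul_apply]

instance : SMulCommClass ℂ (FinConv γ) (FinConv γ) where
  smul_comm r F G := (map_smul (mulL F) r G).symm

/-- The involution, as an additive map. -/
def starHom : FinConv γ →+ FinConv γ :=
  Finsupp.liftAddHom fun n : ℤ =>
    { toFun := fun a => delta γ (-n) ((γ ^ (-n)) (star a))
      map_zero' := by rw [star_zero, map_zero, map_zero]
      map_add' := fun a b => by rw [star_add, map_add, map_add] }

instance : Star (FinConv γ) := ⟨fun F => starHom F⟩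

theorem star_delta (n : ℤ) (a : A) :
    star (delta γ n a) = delta γ (-n) ((γ ^ (-n)) (star a)) :=
  Finsupp.liftAddHom_apply_single _ n a

protected theorem star_add' (F G : FinConv γ) : star (F + G) = star F + star G :=
  map_add starHom F G

protected theorem star_zero' : star (0 : FinConv γ) = 0 := map_zero starHom

instance : StarRing (FinConv γ) where
  star_involutive F := by
    induction F using induction_linear with
    | h0 => simp only [FinConv.star_zero']
    | hadd F F' h h' => simp only [FinConv.star_add', h, h']
    | hdelta k a =>
      rw [star_delta, star_delta, ← map_star, star_star, zpow_neg_apply_zpow, neg_neg]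
  star_mul F G := by
    induction F using induction_linear with
    | h0 => simp only [FinConv.star_zero', zero_mul, mul_zero]
    | hadd F F' h h' => simp only [FinConv.star_add', add_mul, mul_add, h, h']
    | hdelta k a =>
    induction G using induction_linear with
    | h0 => simp only [FinConv.star_zero', zero_mul, mul_zero]
    | hadd F F' h h' => simp only [FinConv.star_add', add_mul, mul_add, h, h']
    | hdelta m b =>
      rw [delta_mul_delta, star_delta, star_delta, star_delta, delta_mul_delta, star_mul, map_mul,
        ← map_star, ← zpow_add_apply, ← zpow_add_apply, neg_add, neg_add_cancel_right,
        add_comm (-k) (-m)]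
  star_add := FinConv.star_add'

instance : StarModule ℂ (FinConv γ) where
  star_smul r F := by
    induction F using induction_linear with
    | h0 => simp only [smul_zero, star_zero]
    | hadd F F' h h' => simp only [smul_add, star_add, h, h']
    | hdelta k a =>
      rw [← map_smul, star_delta, star_delta, star_smul, map_smul, map_smul]

end FinConv

/-- A covariant unitary pair `(π, U)` for `(A, γ)`: a `*`-representation `π` of `A` on a Hilbert
space `H` and a unitary `U` on `H` with `π(a) U = U π(γ(a))`. -/
structure UnitaryPair : Type (u + 1) where
  H : Type u
  [normedAddCommGroup : NormedAddCommGroup H]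
  [innerProductSpace : InnerProductSpace ℂ H]
  [completeSpace : CompleteSpace H]
  π : A →⋆ₙₐ[ℂ] (H →L[ℂ] H)
  U : unitary (H →L[ℂ] H)
  covariant : ∀ a, π a * U = U * π (γ a)

attribute [instance] UnitaryPair.normedAddCommGroup UnitaryPair.innerProductSpace
  UnitaryPair.completeSpace

namespace UnitaryPair

variable {γ} (p : UnitaryPair γ)

/-- `Uⁿ` for an integer `n`. -/
def pow (n : ℤ) : p.H →L[ℂ] p.H := ((p.U ^ n : unitary (p.H →L[ℂ] p.H)) : p.H →L[ℂ] p.H)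

theorem pow_add (m n : ℤ) : p.pow (m + n) = p.pow m * p.pow n := by
  rw [pow, zpow_add]; rfl

theorem star_pow (n : ℤ) : star (p.pow n) = p.pow (-n) := by
  rw [pow, pow, zpow_neg]; rfl

theorem pow_zero : p.pow 0 = 1 := by rw [pow, zpow_zero]; rfl

theorem pow_one : p.pow 1 = p.U := by rw [pow, zpow_one]

theorem pow_neg_mul (n : ℤ) : p.pow (-n) * p.pow n = 1 := by
  rw [← pow_add, neg_add_cancel, pow_zero]

theorem pow_mul_neg (n : ℤ) : p.pow n * p.pow (-n) = 1 := by
  rw [← pow_add, add_neg_cancel, pow_zero]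

theorem norm_pow_le (n : ℤ) : ‖p.pow n‖ ≤ 1 := by
  have e := CStarRing.norm_star_mul_self (x := p.pow n)
  rw [star_pow, pow_neg_mul] at e
  have h1 : ‖(1 : p.H →L[ℂ] p.H)‖ ≤ 1 := ContinuousLinearMap.norm_id_le
  nlinarith [norm_nonneg (p.pow n)]

theorem pi_mul_pow (n : ℤ) : ∀ a, p.π a * p.pow n = p.pow n * p.π ((γ ^ n) a) := by
  have hpos : ∀ (n : ℕ) (a : A), p.π a * p.pow n = p.pow n * p.π ((γ ^ (n : ℤ)) a) := by
    intro n
    induction n with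
    | zero => intro a; rw [Nat.cast_zero, pow_zero, zpow_zero, mul_one, one_mul]; rfl
    | succ k ih =>
      intro a
      rw [Nat.cast_succ, pow_add, pow_one, ← mul_assoc, ih, mul_assoc, p.covariant, mul_assoc,
        add_comm, FinConv.zpow_add_apply, zpow_one]
  intro a
  obtain ⟨m, rfl | rfl⟩ := n.eq_nat_or_neg
  · exact hpos m a
  · have h := hpos m ((γ ^ (-(m : ℤ))) a)
    rw [← FinConv.zpow_add_apply, add_neg_cancel, zpow_zero] at h
    calc p.π a * p.pow (-m)
        = p.pow (-m) * (p.pow m * p.π ((1 : A ≃⋆ₐ[ℂ] A) a)) * p.pow (-m) := by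
          rw [← mul_assoc (p.pow (-m)), pow_neg_mul, one_mul]; rfl
      _ = p.pow (-m) * p.π ((γ ^ (-(m : ℤ))) a) := by
          rw [← h, mul_assoc, mul_assoc, pow_mul_neg, mul_one]

/-- The integrated form `δₙ ⊗ a ↦ Uⁿ π(a)`. -/
def rep : FinConv γ →ₗ[ℂ] (p.H →L[ℂ] p.H) :=
  FinConv.lift fun n => (LinearMap.mulLeft ℂ (p.pow n)).comp
    (p.π : A →ₗ[ℂ] (p.H →L[ℂ] p.H))

theorem rep_delta (n : ℤ) (a : A) : p.rep (FinConv.delta γ n a) = p.pow n * p.π a :=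
  FinConv.lift_delta _ n a

theorem rep_mul (F G : FinConv γ) : p.rep (F * G) = p.rep F * p.rep G := by
  induction F using FinConv.induction_linear with
  | h0 => simp only [zero_mul, map_zero]
  | hadd F F' h h' => simp only [add_mul, map_add, h, h']
  | hdelta k a =>
  induction G using FinConv.induction_linear with
  | h0 => simp only [mul_zero, map_zero]
  | hadd F F' h h' => simp only [mul_add, map_add, h, h']
  | hdelta m b =>
    rw [FinConv.delta_mul_delta, rep_delta, rep_delta, rep_delta, map_mul, pow_add, mul_assoc,
      ← mul_assoc (p.pow m), ← pi_mul_pow]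
    simp only [mul_assoc]

theorem rep_star (F : FinConv γ) : p.rep (star F) = star (p.rep F) := by
  induction F using FinConv.induction_linear with
  | h0 => simp only [star_zero, map_zero]
  | hadd F F' h h' => simp only [star_add, map_add, h, h']
  | hdelta k a =>
    rw [FinConv.star_delta, rep_delta, rep_delta, star_mul, star_pow, ← map_star, ← pi_mul_pow]

/-- The unitary `z • 1`. -/
def scalar (H : Type u) [NormedAddCommGroup H] [InnerProductSpace ℂ H] [CompleteSpace H] :
    Circle →* unitary (H →L[ℂ] H) where
  toFun z := ⟨(z : ℂ) • 1, by
    have hz : (starRingEnd ℂ) (z : ℂ) * z = 1 := by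
      rw [← Complex.normSq_eq_conj_mul_self, Circle.normSq_coe]; rfl
    have hz' : (z : ℂ) * (starRingEnd ℂ) (z : ℂ) = 1 := by rw [mul_comm]; exact hz
    constructor
    · rw [star_smul, star_one, smul_mul_smul_comm, mul_one]
      exact (congrArg (· • (1 : H →L[ℂ] H)) hz).trans (one_smul _ _)
    · rw [star_smul, star_one, smul_mul_smul_comm, mul_one]
      exact (congrArg (· • (1 : H →L[ℂ] H)) hz').trans (one_smul _ _)⟩
  map_one' := Subtype.ext (one_smul ℂ _)
  map_mul' z w := Subtype.ext <| by
    change ((z * w : Circle) : ℂ) • (1 : H →L[ℂ] H) = ((z : ℂ) • 1) * ((w : ℂ) • 1)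
    rw [smul_mul_smul_comm, mul_one, Circle.coe_mul]

theorem scalar_commute (H : Type u) [NormedAddCommGroup H] [InnerProductSpace ℂ H]
    [CompleteSpace H] (z : Circle) (W : unitary (H →L[ℂ] H)) : Commute (scalar H z) W :=
  Subtype.ext <| by
    change ((z : ℂ) • (1 : H →L[ℂ] H)) * (W : H →L[ℂ] H) = W * ((z : ℂ) • 1)
    rw [smul_mul_assoc, mul_smul_comm, one_mul, mul_one]

/-- The covariant pair `(π, z U)`. -/
def rotate (z : Circle) : UnitaryPair γ where
  H := p.H
  π := p.π
  U := scalar p.H z * p.U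
  covariant a := by
    change p.π a * (((z : ℂ) • (1 : p.H →L[ℂ] p.H)) * p.U) =
      (((z : ℂ) • (1 : p.H →L[ℂ] p.H)) * p.U) * p.π (γ a)
    simp only [smul_mul_assoc, mul_smul_comm, one_mul, p.covariant]

theorem rotate_pow (z : Circle) (n : ℤ) :
    (p.rotate z).pow n = ((z ^ n : Circle) : ℂ) • p.pow n := by
  have h : (scalar p.H z * p.U) ^ n = scalar p.H (z ^ n) * p.U ^ n := by
    rw [(scalar_commute p.H z p.U).mul_zpow, map_zpow]
  have h' := congrArg (fun W : unitary (p.H →L[ℂ] p.H) => (W : p.H →L[ℂ] p.H)) h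
  refine h'.trans ?_
  change (((z ^ n : Circle) : ℂ) • (1 : p.H →L[ℂ] p.H)) * p.pow n = _
  rw [smul_mul_assoc, one_mul]

end UnitaryPair

namespace FinConv

variable {γ}

theorem bddAbove (F : FinConv γ) :
    BddAbove (Set.range fun p : UnitaryPair γ => ‖p.rep F‖) := by
  have : ∃ M : ℝ, ∀ p : UnitaryPair γ, ‖p.rep F‖ ≤ M := by
    induction F using induction_linear with
    | h0 => exact ⟨0, fun p => by rw [map_zero, norm_zero]⟩
    | hadd F G hF hG =>
      obtain ⟨M, hM⟩ := hF
      obtain ⟨N, hN⟩ := hG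
      exact ⟨M + N, fun p => by
        rw [map_add]; exact (norm_add_le _ _).trans (add_le_add (hM p) (hN p))⟩
    | hdelta n a =>
      refine ⟨‖a‖, fun p => ?_⟩
      rw [p.rep_delta]
      calc ‖p.pow n * p.π a‖ ≤ ‖p.pow n‖ * ‖p.π a‖ := norm_mul_le _ _
        _ ≤ 1 * ‖a‖ := mul_le_mul (p.norm_pow_le n) (NonUnitalStarAlgHom.norm_apply_le p.π a)
            (norm_nonneg _) zero_le_one
        _ = ‖a‖ := one_mul _
  obtain ⟨M, hM⟩ := this
  exact ⟨M, by rintro _ ⟨p, rfl⟩; exact hM p⟩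

theorem iSup_nonneg (F : FinConv γ) : 0 ≤ ⨆ p : UnitaryPair γ, ‖p.rep F‖ :=
  Real.iSup_nonneg fun _ => norm_nonneg _

/-- The universal seminorm: the supremum of `‖(U × π)(F)‖` over all covariant unitary pairs. -/
def univSeminorm : Seminorm ℂ (FinConv γ) :=
  Seminorm.of (fun F => ⨆ p : UnitaryPair γ, ‖p.rep F‖)
    (fun F G => Real.iSup_le
      (fun p => by
        rw [map_add]
        exact (norm_add_le _ _).trans
          (add_le_add (le_ciSup (bddAbove F) p) (le_ciSup (bddAbove G) p)))
      (add_nonneg (iSup_nonneg F) (iSup_nonneg G)))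
    (fun r F => by
      rw [Real.mul_iSup_of_nonneg (norm_nonneg r)]
      exact iSup_congr fun p => by rw [map_smul, norm_smul])

theorem norm_rep_le_univ (p : UnitaryPair γ) (F : FinConv γ) : ‖p.rep F‖ ≤ univSeminorm F :=
  le_ciSup (bddAbove F) p

theorem univSeminorm_mul_le (F G : FinConv γ) :
    univSeminorm (F * G) ≤ univSeminorm F * univSeminorm G :=
  Real.iSup_le
    (fun p => by
      rw [p.rep_mul]
      exact (norm_mul_le _ _).trans
        (mul_le_mul (norm_rep_le_univ p F) (norm_rep_le_univ p G)
          (norm_nonneg _) (iSup_nonneg F)))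
    (mul_nonneg (iSup_nonneg F) (iSup_nonneg G))

instance : NonUnitalSeminormedRing (FinConv γ) := seminormedRing univSeminorm univSeminorm_mul_le

theorem norm_def (F : FinConv γ) : ‖F‖ = ⨆ p : UnitaryPair γ, ‖p.rep F‖ := rfl

theorem norm_rep_le (p : UnitaryPair γ) (F : FinConv γ) : ‖p.rep F‖ ≤ ‖F‖ :=
  norm_rep_le_univ p F

instance : NormedSpace ℂ (FinConv γ) where
  norm_smul_le r F := (map_smul_eq_mul (univSeminorm (γ := γ)) r F).le

instance : IsPreCStar (FinConv γ) where
  norm_star_mul F := by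
    have e : ∀ p : UnitaryPair γ, ‖p.rep (star F * F)‖ = ‖p.rep F‖ * ‖p.rep F‖ := fun p => by
      rw [p.rep_mul, p.rep_star, CStarRing.norm_star_mul_self]
    apply le_antisymm
    · refine Real.iSup_le (fun p => ?_) (mul_nonneg (norm_nonneg F) (norm_nonneg F))
      rw [e]
      exact mul_self_le_mul_self (norm_nonneg _) (norm_rep_le p F)
    · have h : ‖F‖ ≤ Real.sqrt ‖star F * F‖ := by
        refine Real.iSup_le (fun p => ?_) (Real.sqrt_nonneg _)
        refine Real.le_sqrt_of_sq_le ?_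
        rw [sq, ← e]
        exact norm_rep_le p _
      calc ‖F‖ * ‖F‖ ≤ Real.sqrt ‖star F * F‖ * Real.sqrt ‖star F * F‖ :=
            mul_self_le_mul_self (norm_nonneg F) h
        _ = ‖star F * F‖ := Real.mul_self_sqrt (norm_nonneg _)

/-- `δₙ ⊗ a ↦ δₙ ⊗ zⁿ a`. -/
def gaugePre (z : Circle) : FinConv γ →ₗ[ℂ] FinConv γ :=
  lift fun n => ((z ^ n : Circle) : ℂ) • delta γ n

theorem gaugePre_delta (z : Circle) (n : ℤ) (a : A) :
    gaugePre z (delta γ n a) = ((z ^ n : Circle) : ℂ) • delta γ n a := lift_delta _ n a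

theorem norm_gaugePre_le (z : Circle) (F : FinConv γ) : ‖gaugePre z F‖ ≤ ‖F‖ := by
  refine Real.iSup_le (fun p => ?_) (norm_nonneg F)
  have h : p.rep (gaugePre z F) = (p.rotate z).rep F := by
    induction F using induction_linear with
    | h0 => rw [map_zero, map_zero, map_zero]; rfl
    | hadd F G hF hG => rw [map_add, map_add, hF, hG, map_add]; rfl
    | hdelta n a =>
      rw [gaugePre_delta, map_smul, p.rep_delta, (p.rotate z).rep_delta, p.rotate_pow]
      exact (smul_mul_assoc _ _ _).symm
  rw [h]
  exact norm_rep_le (p.rotate z) F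

/-- `δₙ ⊗ a ↦ δₖ₊ₙ ⊗ a`, i.e. left multiplication by `Uᵏ`. -/
def shiftPre (k : ℤ) : FinConv γ →ₗ[ℂ] FinConv γ := lift fun n => delta γ (k + n)

theorem shiftPre_delta (k n : ℤ) (a : A) : shiftPre k (delta γ n a) = delta γ (k + n) a :=
  lift_delta _ n a

theorem norm_shiftPre_le (k : ℤ) (F : FinConv γ) : ‖shiftPre k F‖ ≤ ‖F‖ := by
  refine Real.iSup_le (fun p => ?_) (norm_nonneg F)
  have h : p.rep (shiftPre k F) = p.pow k * p.rep F := by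
    induction F using induction_linear with
    | h0 => rw [map_zero, map_zero, mul_zero]
    | hadd F G hF hG => rw [map_add, map_add, hF, hG, map_add, mul_add]
    | hdelta n a => rw [shiftPre_delta, p.rep_delta, p.rep_delta, p.pow_add, mul_assoc]
  rw [h]
  calc ‖p.pow k * p.rep F‖ ≤ ‖p.pow k‖ * ‖p.rep F‖ := norm_mul_le _ _
    _ ≤ 1 * ‖F‖ := mul_le_mul (p.norm_pow_le k) (norm_rep_le p F) (norm_nonneg _) zero_le_one
    _ = ‖F‖ := one_mul _

end FinConv

/-- The crossed product `A ⋊_γ ℤ`: the completion of `c₀₀(ℤ, A)` in the universal norm. -/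
abbrev Crossed : Type u := CStarCompletion (FinConv γ)

/-- The element `Uⁿ a` of the crossed product. -/
def Crossed.delta (n : ℤ) (a : A) : Crossed γ := CStarCompletion.of (FinConv.delta γ n a)

/-- The gauge action: `Uⁿ a ↦ zⁿ Uⁿ a`, `z ∈ 𝕋`. -/
def Crossed.gauge (z : Circle) : Crossed γ →L[ℂ] Crossed γ :=
  CStarCompletion.mapL (FinConv.gaugePre z) (FinConv.norm_gaugePre_le z)

/-- Left multiplication by the (multiplier) unitary `Uᵏ`. -/
def Crossed.shift (k : ℤ) : Crossed γ →L[ℂ] Crossed γ :=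
  CStarCompletion.mapL (FinConv.shiftPre k) (FinConv.norm_shiftPre_le k)

/-- The conditional expectation `E(F) = ∫_𝕋 β_z(F) dz`, where `β` is the gauge action and `dz` is
normalized Haar measure (`z = exp(2πit)`, `0 ≤ t ≤ 1`). Its range is the copy of `A`. -/
def Crossed.expectation (F : Crossed γ) : Crossed γ :=
  ∫ t in (0 : ℝ)..1, Crossed.gauge γ (Circle.exp (2 * Real.pi * t)) F

/-- The Fourier coefficient `Eₙ(F) = E(U⁻ⁿ F)`. -/
def Crossed.fourierCoeff (n : ℤ) (F : Crossed γ) : Crossed γ :=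
  Crossed.expectation γ (Crossed.shift γ (-n) F)

end Crossed


section MatrixNorms

/-- A family of matrix norms on `A`: one function on `M_ν(A)` for every `ν`. -/
abbrev MatrixNorms (A : Type u) : Type u := ∀ ν : ℕ, Matrix (Fin ν) (Fin ν) A → ℝ

/-- The canonical matrix norms of a `C*`-algebra `D`: the unique `C*`-norm on `M_ν(D)`. -/
def cstarNorms (D : Type u) [NonUnitalCStarAlgebra D] : MatrixNorms D := fun _ M =>
  letI := CStarAlgebra.spectralOrder D
  letI := CStarAlgebra.spectralOrderedRing D
  ‖CStarMatrix.ofMatrix M‖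

/-- The matrix norms of the semicrossed product: `‖[aᵢⱼ]‖ = sup ‖[(V × π)(aᵢⱼ)]‖`, the supremum
over all left covariant pairs of kind `t`, with `[(V × π)(aᵢⱼ)] ∈ M_ν(B(H))`. -/
def Semicrossed.norms {C : Type u} [CStarAlgebra C] (α : C →⋆ₐ[ℂ] C) (t : PairKind) :
    MatrixNorms (Semicrossed α t) := fun ν M =>
  ⨆ p : LeftCovariantPair α t, cstarNorms (p.H →L[ℂ] p.H) ν (M.map p.extended)

/-- A map is completely isometric if it preserves all matrix norms. -/
def IsCompletelyIsometric {A : Type u} {B : Type v} (nA : MatrixNorms A) (nB : MatrixNorms B)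
    (f : A → B) : Prop :=
  ∀ (ν : ℕ) (M : Matrix (Fin ν) (Fin ν) A), nB ν (M.map f) = nA ν M

/-- `(D, j)` is a `C*`-cover of the operator algebra `A` with matrix norms `nA`: `j` is a
completely isometric homomorphism and `j(A)` generates the `C*`-algebra `D`. -/
structure IsCStarCover {A : Type u} [Ring A] [Algebra ℂ A] (nA : MatrixNorms A)
    {D : Type v} [NonUnitalCStarAlgebra D] (j : A →ₙₐ[ℂ] D) : Prop where
  completelyIsometric : IsCompletelyIsometric nA (cstarNorms D) j
  generates : (NonUnitalStarAlgebra.adjoin ℂ (Set.range j)).topologicalClosure = ⊤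

/-- `(D, j)` is the `C*`-envelope of `A`: it is a `C*`-cover, and every `C*`-cover `(D', j')`
admits a `*`-epimorphism `Φ : D' → D` with `Φ ∘ j' = j`. -/
structure IsCStarEnvelope {A : Type u} [Ring A] [Algebra ℂ A] (nA : MatrixNorms A)
    {D : Type u} [NonUnitalCStarAlgebra D] (j : A →ₙₐ[ℂ] D) : Prop where
  isCover : IsCStarCover nA j
  universal : ∀ (D' : Type v) [NonUnitalCStarAlgebra D'] (j' : A →ₙₐ[ℂ] D'),
    IsCStarCover nA j' → ∃ Φ : D' →⋆ₙₐ[ℂ] D, Function.Surjective Φ ∧ ∀ a, Φ (j' a) = j a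

end MatrixNorms

section Minimality

variable {A : Type u} [NonUnitalCStarAlgebra A]

/-- `(A, φ)` is minimal: the only closed two-sided ideals `J` of `A` with `φ(J) ⊆ J` are `0`
and `A`. -/
def IsMinimal (φ : A →⋆ₙₐ[ℂ] A) : Prop :=
  ∀ J : TwoSidedIdeal A, IsClosed (J : Set A) → (∀ x ∈ J, φ x ∈ J) → J = ⊥ ∨ J = ⊤

/-- `(A, γ)` is bi-minimal: the only closed two-sided ideals `J` of `A` with `γ(J) = J` are `0`
and `A`. -/
def IsBiMinimal (γ : A ≃⋆ₐ[ℂ] A) : Prop :=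
  ∀ J : TwoSidedIdeal A, IsClosed (J : Set A) → γ '' (J : Set A) = J → J = ⊥ ∨ J = ⊤

/-- `A ⋊_γ ℤ` has no non-trivial Fourier-invariant closed two-sided ideals `I`, i.e. ideals with
`Eₙ(I) ⊆ I` for all `n ∈ ℤ`. -/
def NoFourierInvariantIdeals (γ : A ≃⋆ₐ[ℂ] A) : Prop :=
  ∀ I : TwoSidedIdeal (Crossed γ), IsClosed (I : Set (Crossed γ)) →
    (∀ (n : ℤ), ∀ F ∈ I, Crossed.fourierCoeff γ n F ∈ I) → I = ⊥ ∨ I = ⊤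

end Minimality

end CStarDyn

end

/-! The equivalences run 1 → 2 → 3 → 1 and 3 ↔ 4. The kernel of `α` is an invariant ideal, so
minimality makes `α` injective; then `M(ker α)` is zero, the tail disappears and `B` is `C`. For 2 →
3, an ideal of the direct limit that is invariant under the automorphism is tested on the translates
of the image of the algebra, whose union is dense: a closed ideal whose preimage under each of these
maps is zero is zero (`eq_bot_of_disjoint_dense`), and one that contains all of them is everything.
For 3 → 1, an invariant ideal `J` of `C` gives the invariant ideal `J ⊕ T` of `B` and a limit ideal
of `B_∞`. The limit remembers `J` because `β` is injective, which is what the tail is for, and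
because `1` has distance at least one from a proper ideal. For 3 ↔ 4, an invariant ideal `J`
corresponds to the elements of the crossed product with all Fourier coefficients in `J`; an element
whose coefficients all vanish is zero (`Crossed.eq_zero_of_coeff_eq_zero`).

The statements on semicrossed products use minimality only through the injectivity of `α`, which
makes `C → C_∞` injective. All four families of matrix norms equal those of the crossed product. A
faithful representation of the crossed product yields a unitary pair, which is a pair of every kind;
this is one inequality. The other is a Poisson kernel argument
(`LeftCovariantPair.norm_map_integrated_le`): if `‖V‖ < 1`, the operators `Vⁱ (1 - V V*)^(1/2)` form
a contractive row that compresses the Toeplitz matrix with entries `αʲ(c_{i-j})` to an approximation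
of `(V × π)(F)`. Toeplitz matrices are themselves compressions of the regular representation of the
crossed product, and a general `V` is the limit of `rV` as `r → 1`.

For the envelope, let `i` be a `C*`-cover in `D` and `j` the embedding in the crossed product. It
suffices that `‖y.1‖ ≤ ‖y.2‖` on the `*`-algebra generated by the pairs `(j a, i a)`; its closure is
then the graph of the required map (`exists_hom_of_graph`). In the crossed product, a word in the
generators and their adjoints, multiplied by a high power of `U`, lies in the range of `j`, since
adjoints only lower the degree. In `D` the image of `U` is only known to be a contraction. However,
equality of the norms of columns forces it to be isometric where this matters:
`IsColumnPair.exists_good` provides a positive functional that sees the full norm of `i a` and for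
which finitely many prescribed elements `Uˡ c` have the same length as `c`. Where a contraction `v`
preserves length, `v* v` acts as the identity, so this functional sees the word reduced in `D`
exactly as in the crossed product. -/

noncomputable section

namespace CStarDyn

set_option linter.unusedSectionVars false

/-! ### Norming positive functionals. -/

section States

open scoped ComplexOrder

/-- A contractive unital functional is positive. -/
theorem nonneg_of_contractive_unital {B : Type u} [CStarAlgebra B] [PartialOrder B]
    [StarOrderedRing B] (g : B →ₗ[ℂ] ℂ) (hg : ∀ x, ‖g x‖ ≤ ‖x‖) (h1 : g 1 = 1)
    {a : B} (ha : 0 ≤ a) : 0 ≤ g a := by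
  have hsa : IsSelfAdjoint a := IsSelfAdjoint.of_nonneg ha
  have hnt : Nontrivial B := by
    refine ⟨⟨1, 0, fun h => ?_⟩⟩
    rw [h, map_zero] at h1
    exact zero_ne_one h1
  have him : (g a).im = 0 := by
    -- Compare `|g(a + it)|² ≥ (Im g(a) + t)²` with `‖a + it‖² ≤ ‖a‖² + t²`. After cancelling `t²` a
    -- function affine in `t` is bounded above, so its slope `2 Im g(a)` vanishes.
    have key : ∀ t : ℝ, ((g a).im) ^ 2 + 2 * (g a).im * t ≤ ‖a‖ ^ 2 := by
      intro t
      set x : B := a + (Complex.I * t) • (1 : B) with hx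
      have hgx : g x = g a + Complex.I * t := by
        rw [hx, map_add, map_smul, h1, smul_eq_mul, mul_one]
      have e1 : star x * x = a * a + ((t : ℂ) ^ 2) • (1 : B) := by
        have hc : star (Complex.I * (t : ℂ)) = -(Complex.I * t) := by
          simp
        rw [hx, star_add, star_smul, star_one, hc, hsa.star_eq, add_mul, mul_add, mul_add]
        simp only [mul_smul_comm, smul_mul_assoc, mul_one, one_mul, smul_smul]
        have : (Complex.I * (t : ℂ)) * -(Complex.I * t) = (t : ℂ) ^ 2 := by
          linear_combination (-(t : ℂ) ^ 2) * Complex.I_sq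
        rw [this]
        module
      have e2 : ‖x‖ ^ 2 ≤ ‖a‖ ^ 2 + t ^ 2 := by
        rw [sq ‖x‖, ← CStarRing.norm_star_mul_self, e1]
        refine (norm_add_le _ _).trans (add_le_add ?_ ?_)
        · rw [sq]; exact norm_mul_le _ _
        · rw [norm_smul, norm_one, mul_one, norm_pow, Complex.norm_real, Real.norm_eq_abs, sq_abs]
      have e3 : ‖g x‖ ^ 2 ≤ ‖a‖ ^ 2 + t ^ 2 :=
        (pow_le_pow_left₀ (norm_nonneg _) (hg x) 2).trans e2
      rw [hgx, Complex.sq_norm, Complex.normSq_apply] at e3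
      simp only [Complex.add_re, Complex.add_im, Complex.mul_re, Complex.mul_im, Complex.I_re,
        Complex.I_im, Complex.ofReal_re, Complex.ofReal_im] at e3
      nlinarith [sq_nonneg (g a).re]
    by_contra hne
    have h := key ((‖a‖ ^ 2 + 1) / (2 * (g a).im))
    have h' : 2 * (g a).im * ((‖a‖ ^ 2 + 1) / (2 * (g a).im)) = ‖a‖ ^ 2 + 1 := by
      field_simp
    nlinarith [sq_nonneg (g a).im]
  have hre : 0 ≤ (g a).re := by
    have hle : a ≤ algebraMap ℝ B ‖a‖ := hsa.le_algebraMap_norm_self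
    -- This places `g a` in the disc of radius `‖a‖` about `‖a‖`, hence in the right half plane.
    have hn : ‖algebraMap ℝ B ‖a‖ - a‖ ≤ ‖a‖ := by
      have h := CStarAlgebra.norm_le_norm_of_nonneg_of_le (sub_nonneg.2 hle)
        (sub_le_self (algebraMap ℝ B ‖a‖) ha)
      rwa [norm_algebraMap', norm_norm] at h
    have h := (Complex.abs_re_le_norm _).trans ((hg _).trans hn)
    have e : algebraMap ℝ B ‖a‖ = ((‖a‖ : ℝ) : ℂ) • (1 : B) := by
      rw [Algebra.algebraMap_eq_smul_one, Complex.coe_smul]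
    rw [e, map_sub, map_smul, h1, smul_eq_mul, mul_one, Complex.sub_re, Complex.ofReal_re,
      abs_le] at h
    linarith [h.2]
  rw [Complex.nonneg_iff]
  exact ⟨hre, him.symm⟩

/-- The norm of `b ≥ 0` lies in the spectrum, so some character of the commutative algebra generated
by `b` takes the value `‖b‖` at `b`. A Hahn-Banach extension of it is contractive and unital, hence
positive. -/
theorem exists_state_unital {B : Type u} [CStarAlgebra B] [PartialOrder B] [StarOrderedRing B]
    (b : B) (hb : 0 ≤ b) : ∃ f : B →ₚ[ℂ] ℂ, (∀ x, ‖f x‖ ≤ ‖x‖) ∧ f b = ‖b‖ := by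
  rcases subsingleton_or_nontrivial B with hB | hB
  · refine ⟨0, fun x => ?_, ?_⟩
    · change ‖(0 : ℂ)‖ ≤ ‖x‖
      rw [norm_zero]; exact norm_nonneg _
    · change (0 : ℂ) = ‖b‖
      rw [Subsingleton.elim b 0, norm_zero]; rfl
  have hsa : IsSelfAdjoint b := IsSelfAdjoint.of_nonneg hb
  have : IsStarNormal b := hsa.isStarNormal
  let S := StarAlgebra.elemental ℂ b
  let b' : S := ⟨b, StarAlgebra.elemental.self_mem ℂ b⟩
  have hspec : ((‖b‖ : ℝ) : ℂ) ∈ spectrum ℂ b :=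
    spectrum.algebraMap_mem ℂ (CStarAlgebra.norm_mem_spectrum_of_nonneg hb)
  have hspec' : ((‖b‖ : ℝ) : ℂ) ∈ spectrum ℂ b' := by
    rw [StarSubalgebra.spectrum_eq (hS := StarAlgebra.elemental.isClosed ℂ b)]
    exact hspec
  obtain ⟨χ, hχ⟩ := WeakDual.CharacterSpace.mem_spectrum_iff_exists.1 hspec'
  let p : Subspace ℂ B := (StarSubalgebra.toSubalgebra S).toSubmodule
  let χ' : StrongDual ℂ p := LinearMap.mkContinuous
    { toFun := fun x => χ (⟨x.1, x.2⟩ : S)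
      map_add' := fun x y => map_add χ (⟨x.1, x.2⟩ : S) ⟨y.1, y.2⟩
      map_smul' := fun c x => map_smul χ c (⟨x.1, x.2⟩ : S) } 1 fun x => by
        rw [one_mul]
        exact AlgHom.norm_apply_le_self χ (⟨x.1, x.2⟩ : S)
  obtain ⟨g, hg, hgn⟩ := exists_extension_norm_eq p χ'
  have hgle : ∀ x, ‖g x‖ ≤ ‖x‖ := fun x => by
    have h1 : ‖g‖ ≤ 1 := hgn.trans_le (LinearMap.mkContinuous_norm_le _ zero_le_one _)
    exact (g.le_of_opNorm_le h1 x).trans_eq (one_mul _)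
  have hg1 : g 1 = 1 := (hg ⟨1, one_mem S⟩).trans (map_one χ)
  have hgb : g b = ‖b‖ := (hg ⟨b, b'.2⟩).trans hχ
  exact ⟨PositiveLinearMap.mk₀ (g : B →ₗ[ℂ] ℂ)
    fun x hx => nonneg_of_contractive_unital (g : B →ₗ[ℂ] ℂ) hgle hg1 hx, hgle, hgb⟩

/-- Every positive element attains its norm at a contractive positive functional. -/
theorem exists_state {A : Type u} [NonUnitalCStarAlgebra A] [PartialOrder A] [StarOrderedRing A]
    (b : A) (hb : 0 ≤ b) : ∃ f : A →ₚ[ℂ] ℂ, (∀ x, ‖f x‖ ≤ ‖x‖) ∧ f b = ‖b‖ := by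
  let _ := CStarAlgebra.spectralOrder (Unitization ℂ A)
  let _ := CStarAlgebra.spectralOrderedRing (Unitization ℂ A)
  -- In both algebras the positive elements are generated by the squares `x* x`, which the inclusion
  -- preserves.
  have hpos : ∀ x : A, 0 ≤ x → 0 ≤ (x : Unitization ℂ A) := fun x hx => by
    rw [StarOrderedRing.nonneg_iff] at hx ⊢
    have := AddSubmonoid.mem_map_of_mem
      (Unitization.inrNonUnitalStarAlgHom ℂ A : A →+ Unitization ℂ A) hx
    rw [AddMonoidHom.map_mclosure] at this
    refine AddSubmonoid.closure_mono ?_ this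
    rintro _ ⟨_, ⟨y, rfl⟩, rfl⟩
    exact ⟨(y : Unitization ℂ A), by
      change star (y : Unitization ℂ A) * y = ((star y * y : A) : Unitization ℂ A)
      rw [Unitization.inr_mul, Unitization.inr_star]⟩
  obtain ⟨f, hf, hfb⟩ := exists_state_unital (b : Unitization ℂ A) (hpos b hb)
  refine ⟨PositiveLinearMap.mk₀ (f.toLinearMap.comp
      (Unitization.inrNonUnitalStarAlgHom ℂ A : A →ₗ[ℂ] Unitization ℂ A))
    fun x hx => f.map_nonneg (hpos x hx), fun x => ?_, ?_⟩
  · exact (hf _).trans_eq (Unitization.norm_inr ..)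
  · exact hfb.trans (by rw [Unitization.norm_inr])

end States

/-! ### Direct sums of representations. -/

section DiagonalRepresentation

variable {ι : Type v} {G : ι → Type u} [∀ i, NormedAddCommGroup (G i)]
  [∀ i, InnerProductSpace ℂ (G i)] [∀ i, CompleteSpace (G i)]
  {A : Type u} [NonUnitalCStarAlgebra A]

/-- The direct sum of a family of representations. -/
def diagRep (ρ : ∀ i, A →⋆ₙₐ[ℂ] (G i →L[ℂ] G i)) : A →⋆ₙₐ[ℂ] (lp G 2 →L[ℂ] lp G 2) where
  toFun a := lp.mapCLM 2 (fun i => ρ i a) (norm_nonneg a)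
    fun i => NonUnitalStarAlgHom.norm_apply_le (ρ i) a
  map_smul' c a := by ext x i; simp
  map_zero' := by ext x i; simp
  map_add' a b := by ext x i; simp
  map_mul' a b := by ext x i; simp
  map_star' a := by
    refine (ContinuousLinearMap.eq_adjoint_iff _ _).2 fun x y => ?_
    rw [lp.inner_eq_tsum, lp.inner_eq_tsum]
    refine tsum_congr fun i => ?_
    change inner ℂ (ρ i (star a) (x i)) (y i) = inner ℂ (x i) (ρ i a (y i))
    rw [map_star, ContinuousLinearMap.star_eq_adjoint, ContinuousLinearMap.adjoint_inner_left]

theorem diagRep_apply (ρ : ∀ i, A →⋆ₙₐ[ℂ] (G i →L[ℂ] G i)) (a : A) (x : lp G 2) (i : ι) :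
    diagRep ρ a x i = ρ i a (x i) := rfl

theorem diagRep_single [DecidableEq ι] (ρ : ∀ i, A →⋆ₙₐ[ℂ] (G i →L[ℂ] G i)) (a : A) (i : ι)
    (x : G i) : diagRep ρ a (lp.single 2 i x) = lp.single 2 i (ρ i a x) := by
  ext j
  rw [diagRep_apply]
  by_cases h : j = i
  · subst h; rw [lp.single_apply_self, lp.single_apply_self]
  · rw [lp.single_apply_ne _ _ _ h, lp.single_apply_ne _ _ _ h, map_zero]

theorem diagRep_eq_zero {ρ : ∀ i, A →⋆ₙₐ[ℂ] (G i →L[ℂ] G i)} {a : A} (h : diagRep ρ a = 0)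
    (i : ι) : ρ i a = 0 := by
  classical
  ext x
  have := congrArg (fun T : lp G 2 →L[ℂ] lp G 2 => T (lp.single 2 i x) i) h
  simpa [diagRep_apply] using this

end DiagonalRepresentation

/-! ### The Gelfand-Naimark representation. -/

open scoped ComplexOrder in
/-- Every `C*`-algebra has a faithful representation on a Hilbert space. -/
theorem exists_faithful_rep (A : Type u) [NonUnitalCStarAlgebra A] :
    ∃ (H : Type u) (_ : NormedAddCommGroup H) (_ : InnerProductSpace ℂ H) (_ : CompleteSpace H)
      (π : A →⋆ₙₐ[ℂ] (H →L[ℂ] H)), Function.Injective π := by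
  let _ := CStarAlgebra.spectralOrder A
  let _ := CStarAlgebra.spectralOrderedRing A
  refine ⟨lp (fun f : A →ₚ[ℂ] ℂ => f.GNS) 2, inferInstance, inferInstance, inferInstance,
    diagRep fun f => f.gnsNonUnitalStarAlgHom, ?_⟩
  rw [injective_iff_map_eq_zero]
  intro a ha
  -- There may be no unit to serve as a vector, so `a` is applied to the vector `a*`. The result `a
  -- a*` has squared GNS norm `f((a a*)* (a a*))`, which is `‖a‖⁴` for a norming `f`.
  obtain ⟨f, -, hf⟩ := exists_state (star (a * star a) * (a * star a)) (star_mul_self_nonneg _)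
  have h := congrArg (fun T : f.GNS →L[ℂ] f.GNS => ‖T (f.toPreGNS (star a))‖ ^ 2)
    (diagRep_eq_zero ha f)
  simp only [PositiveLinearMap.gnsNonUnitalStarAlgHom_apply_coe, UniformSpace.Completion.norm_coe,
    zero_apply, norm_zero] at h
  have h2 := f.preGNS_norm_sq (f.leftMulMapPreGNS a (f.toPreGNS (star a)))
  rw [PositiveLinearMap.leftMulMapPreGNS_apply] at h h2
  have h3 := h2.symm.trans (by rw [← Complex.ofReal_pow, h])
  have h4 : ((‖star (a * star a) * (a * star a)‖ : ℝ) : ℂ) = 0 := hf.symm.trans (h3.trans (by simp))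
  rw [Complex.ofReal_eq_zero, CStarRing.norm_star_mul_self, CStarRing.norm_self_mul_star] at h4
  simpa using h4

/-! ### The regular covariant pair on `ℓ²(ℤ, H)`. -/

section Regular

variable {H : Type u} [NormedAddCommGroup H] [InnerProductSpace ℂ H] [CompleteSpace H]

/-- The Hilbert space `ℓ²(ℤ, H)`. -/
abbrev EllTwo (H : Type u) [NormedAddCommGroup H] [InnerProductSpace ℂ H] : Type u :=
  lp (fun _ : ℤ => H) 2

/-- The bilateral shift by `k` on `ℓ²(ℤ, H)`. -/
def bishift (k : ℤ) : EllTwo H →L[ℂ] EllTwo H :=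
  LinearMap.mkContinuous
    { toFun := fun x => ⟨fun j => x (j - k), by
        refine (memℓp_gen_iff (by simp)).2 ?_
        exact ((memℓp_gen_iff (by simp)).1 (lp.memℓp x)).comp_injective (sub_left_injective)⟩
      map_add' := fun x y => rfl
      map_smul' := fun c x => rfl } 1 fun x => by
        rw [one_mul]
        refine lp.norm_le_of_tsum_le (by simp) (norm_nonneg _) ?_
        rw [lp.norm_rpow_eq_tsum (by simp)]
        exact ((Equiv.subRight k).tsum_eq fun j => ‖x j‖ ^ _).le

theorem bishift_apply (k : ℤ) (x : EllTwo H) (j : ℤ) : bishift k x j = x (j - k) := rfl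

theorem bishift_mul (k l : ℤ) : (bishift k * bishift l : EllTwo H →L[ℂ] EllTwo H) =
    bishift (k + l) := by
  ext x j
  change x (j - k - l) = x (j - (k + l))
  rw [sub_sub]

theorem bishift_zero : (bishift 0 : EllTwo H →L[ℂ] EllTwo H) = 1 := by
  ext x j
  change x (j - 0) = x j
  rw [sub_zero]

theorem star_bishift (k : ℤ) : star (bishift k : EllTwo H →L[ℂ] EllTwo H) = bishift (-k) := by
  symm
  rw [ContinuousLinearMap.star_eq_adjoint, ContinuousLinearMap.eq_adjoint_iff]
  intro x y
  rw [lp.inner_eq_tsum, lp.inner_eq_tsum, ← (Equiv.subRight k).tsum_eq]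
  refine tsum_congr fun j => ?_
  change inner ℂ (x (j - k - -k)) (y (j - k)) = inner ℂ (x j) (y (j - k))
  rw [sub_neg_eq_add, sub_add_cancel]

/-- The bilateral shifts as a one-parameter group of unitaries. -/
def bishiftUnitary (H : Type u) [NormedAddCommGroup H] [InnerProductSpace ℂ H] [CompleteSpace H] :
    Multiplicative ℤ →* unitary (EllTwo H →L[ℂ] EllTwo H) where
  toFun k := ⟨bishift k.toAdd, by
    constructor
    · rw [star_bishift, bishift_mul, neg_add_cancel, bishift_zero]
    · rw [star_bishift, bishift_mul, add_neg_cancel, bishift_zero]⟩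
  map_one' := Subtype.ext bishift_zero
  map_mul' k l := Subtype.ext (bishift_mul k.toAdd l.toAdd).symm

theorem bishiftUnitary_zpow (n : ℤ) :
    ((bishiftUnitary H (Multiplicative.ofAdd 1) ^ n : unitary (EllTwo H →L[ℂ] EllTwo H)) :
      EllTwo H →L[ℂ] EllTwo H) = bishift n := by
  rw [← map_zpow, ← ofAdd_zsmul, smul_eq_mul, mul_one]
  rfl

/-- The projection of `ℓ²(ℤ, H)` onto the coordinate `0`. -/
def projZero (H : Type u) [NormedAddCommGroup H] [InnerProductSpace ℂ H] :
    EllTwo H →L[ℂ] EllTwo H :=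
  (lp.singleContinuousLinearMap ℂ (fun _ : ℤ => H) 2 0).comp
    (lp.evalCLM ℂ (fun _ : ℤ => H) 2 0)

theorem projZero_apply (x : EllTwo H) : projZero H x = lp.single 2 0 (x 0) := rfl

variable {A : Type u} [NonUnitalCStarAlgebra A] (γ : A ≃⋆ₐ[ℂ] A)

/-- Powers of an automorphism as `*`-homomorphisms. -/
def zpowHom (n : ℤ) : A →⋆ₙₐ[ℂ] A where
  toFun := ⇑(γ ^ n)
  map_smul' := map_smul (γ ^ n)
  map_zero' := map_zero (γ ^ n)
  map_add' := map_add (γ ^ n)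
  map_mul' := map_mul (γ ^ n)
  map_star' := map_star (γ ^ n)

theorem star_projZero : star (projZero H) = projZero H := by
  symm
  rw [ContinuousLinearMap.star_eq_adjoint, ContinuousLinearMap.eq_adjoint_iff]
  intro x y
  rw [projZero_apply, projZero_apply, lp.inner_single_left, lp.inner_single_right]

theorem projZero_mul_self : projZero H * projZero H = projZero H := by
  refine ContinuousLinearMap.ext fun x => ?_
  change projZero H (projZero H x) = projZero H x
  rw [projZero_apply, projZero_apply, lp.single_apply_self]

/-- A nontrivial shift moves the coordinate `0` elsewhere. This orthogonality isolates single
Fourier coefficients and single Toeplitz entries. -/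
theorem projZero_bishift {n : ℤ} (hn : n ≠ 0) : projZero H * bishift n * projZero H = 0 := by
  refine ContinuousLinearMap.ext fun x => ?_
  change projZero H (bishift n (projZero H x)) = 0
  rw [projZero_apply, bishift_apply, projZero_apply, lp.single_apply_ne _ _ _ (by omega),
    lp.single_zero]

theorem projZero_mul_diagRep (ρ : ℤ → A →⋆ₙₐ[ℂ] (H →L[ℂ] H)) (a : A) :
    projZero H * diagRep ρ a = diagRep ρ a * projZero H := by
  refine ContinuousLinearMap.ext fun x => ?_
  change projZero H (diagRep ρ a x) = diagRep ρ a (projZero H x)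
  rw [projZero_apply, projZero_apply, diagRep_apply, diagRep_single]

theorem apply_eq_zero_of_projZero_mul_diagRep {ρ : ℤ → A →⋆ₙₐ[ℂ] (H →L[ℂ] H)} {a : A}
    (h : projZero H * diagRep ρ a = 0) : ρ 0 a = 0 := by
  ext x
  have h' := congrArg (fun T : EllTwo H →L[ℂ] EllTwo H => T (lp.single 2 0 x) 0) h
  change (projZero H (diagRep ρ a (lp.single 2 0 x))) 0 = 0 at h'
  rwa [projZero_apply, diagRep_single, lp.single_apply_self, lp.single_apply_self] at h'

/-- The regular covariant pair induced by a representation of `A`. -/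
def regularPair (π : A →⋆ₙₐ[ℂ] (H →L[ℂ] H)) : UnitaryPair γ where
  H := EllTwo H
  π := diagRep fun j : ℤ => π.comp (zpowHom γ j)
  U := bishiftUnitary H (Multiplicative.ofAdd 1)
  covariant a := by
    have h : ∀ j : ℤ, (γ ^ j) a = (γ ^ (j - 1)) (γ a) := fun j => by
      exact (congrArg (fun k => (γ ^ k) a) (sub_add_cancel j 1).symm).trans
        ((FinConv.zpow_add_apply _ _ _).trans (by rw [zpow_one]))
    ext x j
    change π ((γ ^ j) a) (x (j - 1)) = π ((γ ^ (j - 1)) (γ a)) (x (j - 1))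
    rw [h]

/-- Every automorphism of a `C*`-algebra has a covariant pair with a projection `p` that commutes
with the algebra, is orthogonal to its translates and separates the algebra. -/
theorem exists_regular_pair : ∃ (q : UnitaryPair γ) (p : q.H →L[ℂ] q.H),
    star p = p ∧ p * p = p ∧ (∀ a, p * q.π a = q.π a * p) ∧
    (∀ n : ℤ, n ≠ 0 → p * q.pow n * p = 0) ∧ (∀ a, p * q.π a = 0 → a = 0) := by
  obtain ⟨H, _, _, _, π, hπ⟩ := exists_faithful_rep A
  refine ⟨regularPair γ π, projZero H, star_projZero, projZero_mul_self,
    fun a => projZero_mul_diagRep _ a, fun n hn => ?_, fun a ha => hπ ?_⟩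
  · exact (congrArg (fun T => projZero H * T * projZero H) (bishiftUnitary_zpow n)).trans
      (projZero_bishift hn)
  · exact (apply_eq_zero_of_projZero_mul_diagRep ha).trans (map_zero π).symm

end Regular

/-! ### Extension of maps to completions. -/

section Extension

variable {X : Type u} [NonUnitalSeminormedRing X] [StarRing X] [NormedSpace ℂ X]
  [IsScalarTower ℂ X X] [SMulCommClass ℂ X X] [StarModule ℂ X] [IsPreCStar X]

namespace CStarCompletion

/-- The continuous extension of a contractive linear map to the completion. -/
def extendL {E : Type v} [NormedAddCommGroup E] [NormedSpace ℂ E] [CompleteSpace E]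
    (f : X →ₗ[ℂ] E) (hf : ∀ x, ‖f x‖ ≤ ‖x‖) : CStarCompletion X →L[ℂ] E :=
  have hc : UniformContinuous f :=
    (f.mkContinuous 1 fun x => by simpa using hf x).uniformContinuous
  have e : ∀ x : X, UniformSpace.Completion.extension f x = f x :=
    UniformSpace.Completion.extension_coe hc
  have hcont : Continuous (UniformSpace.Completion.extension f : CStarCompletion X → E) :=
    UniformSpace.Completion.continuous_extension
  { toFun := (UniformSpace.Completion.extension f : CStarCompletion X → E)
    map_add' := fun a b => by
      induction a, b using induction_on₂ with
      | hp => exact isClosed_eq (hcont.comp (continuous_add (M := CStarCompletion X)))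
                ((hcont.comp continuous_fst).add (hcont.comp continuous_snd))
      | ih x y => rw [← ofFun_add]; exact (e _).trans ((map_add f x y).trans
                    (congrArg₂ _ (e x).symm (e y).symm))
    map_smul' := fun c a => by
      induction a using induction_on with
      | hp => exact isClosed_eq (hcont.comp (continuous_const_smul c)) (hcont.const_smul c)
      | ih x => rw [← ofFun_smul]; exact (e _).trans ((map_smul f c x).trans
                  (congrArg _ (e x).symm))
    cont := hcont }

theorem extendL_of {E : Type v} [NormedAddCommGroup E] [NormedSpace ℂ E] [CompleteSpace E]
    (f : X →ₗ[ℂ] E) (hf : ∀ x, ‖f x‖ ≤ ‖x‖) (x : X) : extendL f hf (of x) = f x :=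
  UniformSpace.Completion.extension_coe
    (f.mkContinuous 1 fun x => by simpa using hf x).uniformContinuous x

/-- The continuous extension of a contractive `*`-homomorphism to the completion. -/
def extendHom {D : Type v} [NonUnitalCStarAlgebra D] (f : X →⋆ₙₐ[ℂ] D) (hf : ∀ x, ‖f x‖ ≤ ‖x‖) :
    CStarCompletion X →⋆ₙₐ[ℂ] D :=
  { (extendL (f : X →ₗ[ℂ] D) hf : CStarCompletion X →ₗ[ℂ] D) with
    map_zero' := map_zero (extendL (f : X →ₗ[ℂ] D) hf)
    map_mul' := fun a b => by
      have e := extendL_of (f : X →ₗ[ℂ] D) hf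
      change extendL (f : X →ₗ[ℂ] D) hf (a * b) =
        extendL (f : X →ₗ[ℂ] D) hf a * extendL (f : X →ₗ[ℂ] D) hf b
      induction a, b using induction_on₂ with
      | hp => exact isClosed_eq (by fun_prop) (by fun_prop)
      | ih x y =>
        rw [← ofFun_mul]
        exact (e _).trans ((map_mul f x y).trans (congrArg₂ _ (e x).symm (e y).symm))
    map_star' := fun a => by
      have e := extendL_of (f : X →ₗ[ℂ] D) hf
      change extendL (f : X →ₗ[ℂ] D) hf (star a) = star (extendL (f : X →ₗ[ℂ] D) hf a)
      induction a using induction_on with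
      | hp => exact isClosed_eq (by fun_prop) (by fun_prop)
      | ih x =>
        rw [← ofFun_star]
        exact (e _).trans ((map_star f x).trans (congrArg star (e x).symm)) }

theorem extendHom_of {D : Type v} [NonUnitalCStarAlgebra D] (f : X →⋆ₙₐ[ℂ] D)
    (hf : ∀ x, ‖f x‖ ≤ ‖x‖) (x : X) : extendHom f hf (of x) = f x :=
  extendL_of (f : X →ₗ[ℂ] D) hf x

theorem continuous_hom {D : Type u} {D' : Type v} [NonUnitalCStarAlgebra D]
    [NonUnitalCStarAlgebra D'] (f : D →⋆ₙₐ[ℂ] D') : Continuous f :=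
  AddMonoidHomClass.continuous_of_bound f 1 fun x => by
    rw [one_mul]; exact NonUnitalStarAlgHom.norm_apply_le f x

end CStarCompletion

end Extension

/-! ### Coefficients of elements of a crossed product. -/

section CrossedBasics

variable {A : Type u} [NonUnitalCStarAlgebra A] (γ : A ≃⋆ₐ[ℂ] A)

namespace Crossed

/-- The integrated form of a covariant pair on the crossed product. -/
def repHom (p : UnitaryPair γ) : Crossed γ →⋆ₙₐ[ℂ] (p.H →L[ℂ] p.H) :=
  CStarCompletion.extendHom
    { p.rep with
      map_smul' := map_smul p.rep
      map_zero' := map_zero p.rep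
      map_mul' := p.rep_mul
      map_star' := p.rep_star } (FinConv.norm_rep_le p)

variable {γ}

theorem repHom_delta (p : UnitaryPair γ) (n : ℤ) (a : A) :
    repHom γ p (delta γ n a) = p.pow n * p.π a :=
  (CStarCompletion.extendHom_of _ _ _).trans (p.rep_delta n a)

theorem delta_add (n : ℤ) (a b : A) : delta γ n (a + b) = delta γ n a + delta γ n b :=
  (congrArg CStarCompletion.of (map_add (FinConv.delta γ n) a b)).trans
    (map_add CStarCompletion.of _ _)

theorem delta_smul (n : ℤ) (c : ℂ) (a : A) : delta γ n (c • a) = c • delta γ n a :=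
  (congrArg CStarCompletion.of (map_smul (FinConv.delta γ n) c a)).trans
    (map_smul CStarCompletion.of _ _)

theorem delta_mul_delta (k m : ℤ) (a b : A) :
    delta γ k a * delta γ m b = delta γ (k + m) ((γ ^ m) a * b) :=
  (map_mul CStarCompletion.of _ _).symm.trans
    (congrArg CStarCompletion.of (FinConv.delta_mul_delta k m a b))

theorem star_delta (n : ℤ) (a : A) : star (delta γ n a) = delta γ (-n) ((γ ^ (-n)) (star a)) :=
  (map_star CStarCompletion.of _).symm.trans
    (congrArg CStarCompletion.of (FinConv.star_delta n a))

/-- An induction principle: a closed additive property of all `δₙ ⊗ a` holds everywhere. -/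
theorem induction {P : Crossed γ → Prop} (F : Crossed γ) (hc : IsClosed {F | P F})
    (h0 : P 0) (hadd : ∀ F G, P F → P G → P (F + G)) (hdelta : ∀ n a, P (delta γ n a)) : P F := by
  refine CStarCompletion.induction_on F hc fun x => ?_
  induction x using FinConv.induction_linear with
  | h0 => rwa [CStarCompletion.ofFun_zero]
  | hadd F G hF hG => rw [CStarCompletion.ofFun_add]; exact hadd _ _ hF hG
  | hdelta n a => exact hdelta n a

/-- The Fourier coefficients, as finitely supported functions. -/
def coeffPre (n : ℤ) : FinConv γ →ₗ[ℂ] A := Finsupp.lapply n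

theorem coeffPre_delta (n m : ℤ) (a : A) :
    coeffPre n (FinConv.delta γ m a) = if m = n then a else 0 := by
  classical
  exact Finsupp.single_apply

/-- In a regular pair, the compression `p U⁻ⁿ F p` kills all terms of `F` except the one of degree
`n` and leaves `p π(cₙ)`. The map `a ↦ p π(a)` is an injective `*`-homomorphism, hence isometric,
and compression does not increase norms. -/
theorem norm_coeffPre_le (n : ℤ) (F : FinConv γ) : ‖coeffPre n F‖ ≤ ‖F‖ := by
  obtain ⟨q, p, hp, hpp, hcomm, horth, hsep⟩ := exists_regular_pair γ
  have hmul : ∀ a, p * q.π a * p = p * q.π a := fun a => by rw [hcomm, mul_assoc, hpp]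
  let κ : A →⋆ₙₐ[ℂ] (q.H →L[ℂ] q.H) :=
    { toFun := fun a => p * q.π a
      map_smul' := fun c a => by rw [map_smul, mul_smul_comm]; rfl
      map_zero' := by rw [map_zero, mul_zero]
      map_add' := fun a b => by rw [map_add, mul_add]
      map_mul' := fun a b => by rw [map_mul, ← mul_assoc, ← mul_assoc, hmul]
      map_star' := fun a => by rw [star_mul, hp, ← map_star, hcomm] }
  have hκ : Function.Injective κ := by
    rw [injective_iff_map_eq_zero]
    exact hsep
  have key : κ (coeffPre n F) = p * (q.pow (-n) * q.rep F) * p := by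
    induction F using FinConv.induction_linear with
    | h0 => simp only [map_zero, mul_zero, zero_mul]
    | hadd F G hF hG => simp only [map_add, mul_add, add_mul, hF, hG]
    | hdelta m a =>
      rw [coeffPre_delta, q.rep_delta, ← mul_assoc (q.pow (-n)), ← q.pow_add, mul_assoc, mul_assoc,
        ← hcomm,
        ← mul_assoc, ← mul_assoc]
      by_cases h : m = n
      · rw [if_pos h, h, neg_add_cancel, q.pow_zero, mul_one, hpp]; rfl
      · rw [if_neg h, map_zero, horth _ (by omega), zero_mul]
  have hpn : ‖p‖ ≤ 1 := by
    have e := CStarRing.norm_star_mul_self (x := p)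
    rw [hp, hpp] at e
    nlinarith [norm_nonneg p]
  rw [← NonUnitalStarAlgHom.norm_map κ hκ, key]
  calc ‖p * (q.pow (-n) * q.rep F) * p‖ ≤ ‖p‖ * (‖q.pow (-n)‖ * ‖q.rep F‖) * ‖p‖ :=
        (norm_mul_le _ _).trans (mul_le_mul_of_nonneg_right ((norm_mul_le _ _).trans
          (mul_le_mul_of_nonneg_left (norm_mul_le _ _) (norm_nonneg _))) (norm_nonneg _))
    _ ≤ 1 * (1 * ‖F‖) * 1 := by
        gcongr
        · exact q.norm_pow_le _
        · exact FinConv.norm_rep_le q F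
    _ = ‖F‖ := by ring

/-- The `A`-valued Fourier coefficients of an element of the crossed product. -/
def coeff (n : ℤ) : Crossed γ →L[ℂ] A :=
  CStarCompletion.extendL (coeffPre n) (norm_coeffPre_le n)

theorem coeff_delta (n m : ℤ) (a : A) : coeff n (delta γ m a) = if m = n then a else 0 :=
  (CStarCompletion.extendL_of _ _ _).trans (coeffPre_delta n m a)

theorem delta_injective (n : ℤ) : Function.Injective (delta γ n) := fun a b h => by
  have := congrArg (coeff n) h
  rwa [coeff_delta, coeff_delta, if_pos rfl, if_pos rfl] at this

variable (γ) in
/-- The copy of `A` in the crossed product. -/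
def inclHom : A →⋆ₙₐ[ℂ] Crossed γ where
  toFun := delta γ 0
  map_smul' c a := delta_smul 0 c a
  map_zero' := by simpa using delta_smul (γ := γ) 0 0 0
  map_add' := delta_add 0
  map_mul' a b := by rw [delta_mul_delta, zpow_zero, add_zero]; rfl
  map_star' a := by rw [star_delta, neg_zero, zpow_zero]; rfl

theorem inclHom_apply (a : A) : inclHom γ a = delta γ 0 a := rfl

theorem delta_zero (n : ℤ) : delta γ n 0 = 0 := by simpa using delta_smul (γ := γ) n 0 0

theorem norm_delta_zero (a : A) : ‖delta γ 0 a‖ = ‖a‖ :=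
  NonUnitalStarAlgHom.norm_map (inclHom γ) (delta_injective 0) a

theorem shift_delta (k n : ℤ) (a : A) : shift γ k (delta γ n a) = delta γ (k + n) a :=
  (CStarCompletion.mapL_of _ _ _).trans (congrArg _ (FinConv.shiftPre_delta k n a))

theorem gauge_delta (z : Circle) (n : ℤ) (a : A) :
    gauge γ z (delta γ n a) = ((z ^ n : Circle) : ℂ) • delta γ n a :=
  (CStarCompletion.mapL_of _ _ _).trans
    ((congrArg _ (FinConv.gaugePre_delta z n a)).trans (map_smul _ _ _))

theorem norm_shift_le (k : ℤ) (F : Crossed γ) : ‖shift γ k F‖ ≤ ‖F‖ := by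
  refine CStarCompletion.induction_on F
    (isClosed_le (shift γ k).continuous.norm continuous_norm) fun x => ?_
  rw [CStarCompletion.norm_ofFun]
  refine (congrArg norm (CStarCompletion.mapL_of _ (FinConv.norm_shiftPre_le k) x)).trans_le ?_
  rw [CStarCompletion.norm_of]
  exact FinConv.norm_shiftPre_le k x

theorem norm_gauge_le (z : Circle) (F : Crossed γ) : ‖gauge γ z F‖ ≤ ‖F‖ := by
  refine CStarCompletion.induction_on F
    (isClosed_le (gauge γ z).continuous.norm continuous_norm) fun x => ?_
  rw [CStarCompletion.norm_ofFun]
  refine (congrArg norm (CStarCompletion.mapL_of _ (FinConv.norm_gaugePre_le z) x)).trans_le ?_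
  rw [CStarCompletion.norm_of]
  exact FinConv.norm_gaugePre_le z x

end Crossed

end CrossedBasics

/-! ### The gauge action and Fourier series. -/

namespace Crossed

variable {A : Type u} [NonUnitalCStarAlgebra A] {γ : A ≃⋆ₐ[ℂ] A}

theorem continuous_circle_coe : Continuous fun z : Circle => (z : ℂ) := continuous_induced_dom

/-- Each gauge map is contractive, so `F` can be approximated uniformly in `z` by finite sums, for
which the continuity is explicit. -/
theorem continuous_gauge (F : Crossed γ) : Continuous fun z : Circle => gauge γ z F := by
  refine continuous_of_uniform_approx_of_continuous fun s hs => ?_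
  obtain ⟨ε, hε, hs⟩ := Metric.mem_uniformity_dist.1 hs
  obtain ⟨_, ⟨x, rfl⟩, hx⟩ := Metric.mem_closure_iff.1
    (CStarCompletion.denseRange_ofFun (X := FinConv γ) F) ε hε
  refine ⟨fun z => gauge γ z (CStarCompletion.of x), ?_, fun z => hs ?_⟩
  · clear hx
    induction x using FinConv.induction_linear with
    | h0 => simpa only [map_zero] using continuous_const
    | hadd F G hF hG => simp only [map_add]; exact hF.add hG
    | hdelta n a =>
      have h : ∀ z : Circle, gauge γ z (CStarCompletion.of (FinConv.delta γ n a)) =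
          ((z ^ n : Circle) : ℂ) • delta γ n a := fun z => gauge_delta z n a
      simp only [h]
      exact (continuous_circle_coe.comp (continuous_zpow (G := Circle) n)).smul continuous_const
  · rw [dist_eq_norm, ← map_sub]
    refine (norm_gauge_le z _).trans_lt ?_
    rwa [dist_eq_norm] at hx

theorem continuous_gauge_exp (F : Crossed γ) :
    Continuous fun t : ℝ => gauge γ (Circle.exp (2 * Real.pi * t)) F :=
  (continuous_gauge F).comp (Circle.exp.continuous.comp (by fun_prop))

theorem expectation_add (F G : Crossed γ) :
    expectation γ (F + G) = expectation γ F + expectation γ G := by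
  simp only [expectation, map_add]
  exact intervalIntegral.integral_add ((continuous_gauge_exp F).intervalIntegrable _ _)
    ((continuous_gauge_exp G).intervalIntegrable _ _)

theorem norm_expectation_le (F : Crossed γ) : ‖expectation γ F‖ ≤ ‖F‖ := by
  have h := intervalIntegral.norm_integral_le_of_norm_le_const (a := 0) (b := 1)
    (f := fun t : ℝ => gauge γ (Circle.exp (2 * Real.pi * t)) F) (C := ‖F‖)
    fun t _ => norm_gauge_le _ F
  rw [sub_zero, abs_one, mul_one] at h
  exact h

variable (γ) in
theorem continuous_expectation : Continuous (expectation γ) := by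
  let f : Crossed γ →+ Crossed γ := AddMonoidHom.mk' (expectation γ) expectation_add
  exact AddMonoidHomClass.continuous_of_bound f 1 fun F => by
    rw [one_mul]; exact norm_expectation_le F

theorem integral_exp_zpow (n : ℤ) :
    ∫ t in (0 : ℝ)..1, ((Circle.exp (2 * Real.pi * t) ^ n : Circle) : ℂ) =
      if n = 0 then 1 else 0 := by
  by_cases hn : n = 0
  · subst hn; simp
  rw [if_neg hn]
  set c : ℂ := n * (2 * Real.pi * Complex.I) with hc
  have hc0 : c ≠ 0 := by
    rw [hc]
    exact mul_ne_zero (Int.cast_ne_zero.2 hn) Complex.two_pi_I_ne_zero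
  have h : ∀ t : ℝ, ((Circle.exp (2 * Real.pi * t) ^ n : Circle) : ℂ) = Complex.exp (c * t) := by
    intro t
    rw [Circle.coe_zpow, Circle.coe_exp, ← Complex.exp_int_mul, hc]
    congr 1
    push_cast
    ring
  simp only [h]
  rw [integral_exp_mul_complex hc0, hc]
  simp [Complex.exp_int_mul_two_pi_mul_I]

/-- This links the integral to the algebraic coefficient. Both sides are additive and continuous,
and on `Uⁿ a` they agree because `zⁿ` has integral zero for `n ≠ 0`. -/
theorem expectation_eq (F : Crossed γ) : expectation γ F = delta γ 0 (coeff 0 F) := by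
  refine induction (P := fun F => expectation γ F = delta γ 0 (coeff 0 F)) F
    (isClosed_eq (continuous_expectation γ)
    ((CStarCompletion.continuous_hom (inclHom γ)).comp (coeff 0).continuous)) ?_ ?_ ?_
  · rw [map_zero, delta_zero]
    simp [expectation]
  · intro F G hF hG
    rw [expectation_add, map_add, delta_add, hF, hG]
  · intro n a
    simp only [expectation, gauge_delta]
    rw [intervalIntegral.integral_smul_const, integral_exp_zpow, coeff_delta]
    by_cases hn : n = 0
    · subst hn; simp
    · simp [hn, delta_zero]

theorem coeff_shift (n k : ℤ) (F : Crossed γ) : coeff n (shift γ k F) = coeff (n - k) F := by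
  refine induction (P := fun F => coeff n (shift γ k F) = coeff (n - k) F) F
    (isClosed_eq ((coeff n).continuous.comp (shift γ k).continuous)
    (coeff (n - k)).continuous) ?_ ?_ ?_
  · simp only [map_zero]
  · intro F G hF hG; simp only [map_add, hF, hG]
  · intro m a
    rw [shift_delta, coeff_delta, coeff_delta]
    exact if_congr (by omega) rfl rfl

theorem fourierCoeff_eq (n : ℤ) (F : Crossed γ) :
    fourierCoeff γ n F = delta γ 0 (coeff n F) := by
  rw [fourierCoeff, expectation_eq, coeff_shift, zero_sub, neg_neg]

theorem shift_gauge_shift (z : Circle) (n : ℤ) (F : Crossed γ) :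
    shift γ n (gauge γ z (shift γ (-n) F)) = ((z ^ (-n) : Circle) : ℂ) • gauge γ z F := by
  refine induction (P := fun F => shift γ n (gauge γ z (shift γ (-n) F)) =
      ((z ^ (-n) : Circle) : ℂ) • gauge γ z F) F
    (isClosed_eq ((shift γ n).continuous.comp
      ((gauge γ z).continuous.comp (shift γ (-n)).continuous))
    ((gauge γ z).continuous.const_smul ((z ^ (-n) : Circle) : ℂ))) ?_ ?_ ?_
  · simp only [map_zero, smul_zero]
  · intro F G hF hG; simp only [map_add, smul_add, hF, hG]
  · intro m a
    rw [shift_delta, gauge_delta, map_smul, shift_delta, gauge_delta, smul_smul, ← Circle.coe_mul,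
      ← zpow_add]
    congr 2
    omega

/-- The `n`-th Fourier coefficient of the orbit `z ↦ β_z(F)` is `Uⁿ Eₙ(F)`, so orbits have vanishing
Fourier coefficients as soon as `F` does. -/
theorem integral_zpow_gauge (n : ℤ) (F : Crossed γ) :
    ∫ t in (0 : ℝ)..1, ((Circle.exp (2 * Real.pi * t) ^ (-n) : Circle) : ℂ) •
      gauge γ (Circle.exp (2 * Real.pi * t)) F = shift γ n (fourierCoeff γ n F) := by
  simp only [← shift_gauge_shift]
  exact (shift γ n).intervalIntegral_comp_comm
    ((continuous_gauge_exp (shift γ (-n) F)).intervalIntegrable 0 1)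

/-- An element of the crossed product is determined by its Fourier coefficients. -/
theorem eq_zero_of_coeff_eq_zero {F : Crossed γ} (h : ∀ n, coeff n F = 0) : F = 0 := by
  by_contra hF
  -- A norming functional turns the orbit of `F` into a continuous scalar function on the circle
  -- whose value at `z = 1` is `‖F‖`.
  obtain ⟨ℓ, -, hℓ⟩ := exists_dual_vector ℂ F (norm_ne_zero_iff.2 hF)
  have : Fact ((0 : ℝ) < 1) := ⟨one_pos⟩
  let f : C(AddCircle (1 : ℝ), ℂ) :=
    ⟨fun t => ℓ (gauge γ (AddCircle.toCircle t) F),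
      ℓ.continuous.comp ((continuous_gauge F).comp AddCircle.continuous_toCircle)⟩
  have hc : ∀ n, _root_.fourierCoeff f n = 0 := by
    intro n
    rw [fourierCoeff_eq_intervalIntegral f n 0]
    have e : ∀ t : ℝ, (fourier (-n) (t : AddCircle (1 : ℝ)) : ℂ) • f t =
        ℓ (((Circle.exp (2 * Real.pi * t) ^ (-n) : Circle) : ℂ) •
          gauge γ (Circle.exp (2 * Real.pi * t)) F) := by
      intro t
      have et : AddCircle.toCircle (t : AddCircle (1 : ℝ)) = Circle.exp (2 * Real.pi * t) := by
        rw [AddCircle.toCircle_apply_mk, div_one]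
      rw [map_smul, fourier_apply, AddCircle.toCircle_zsmul, et]
      change _ • ℓ (gauge γ (AddCircle.toCircle (t : AddCircle (1 : ℝ))) F) = _
      rw [et]
    simp only [e, zero_add, one_div, inv_one, one_smul]
    have hint : Continuous fun t : ℝ => ((Circle.exp (2 * Real.pi * t) ^ (-n) : Circle) : ℂ) •
        gauge γ (Circle.exp (2 * Real.pi * t)) F := by
      refine Continuous.smul (f := fun t : ℝ =>
        ((Circle.exp (2 * Real.pi * t) ^ (-n) : Circle) : ℂ)) ?_ (continuous_gauge_exp F)
      exact continuous_circle_coe.comp ((continuous_zpow (G := Circle) (-n)).comp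
        (Circle.exp.continuous.comp (by fun_prop)))
    rw [ℓ.intervalIntegral_comp_comm (hint.intervalIntegrable 0 1), integral_zpow_gauge,
      fourierCoeff_eq, h, delta_zero, map_zero, map_zero]
  -- A Fourier series with zero coefficients is summable, so it converges to the function, which is
  -- therefore zero.
  have hs := hasSum_fourier_series_of_summable (f := f) (by
    have : _root_.fourierCoeff f = 0 := funext hc
    rw [this]; exact summable_zero)
  simp only [hc, zero_smul] at hs
  have h0 := congrArg (fun g : C(AddCircle (1 : ℝ), ℂ) => g 0) (hs.unique hasSum_zero)
  change ℓ (gauge γ (AddCircle.toCircle 0) F) = 0 at h0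
  have hg1 : gauge γ 1 F = F := by
    refine induction (P := fun F => gauge γ 1 F = F) F
      (isClosed_eq (gauge γ 1).continuous continuous_id) ?_ ?_ ?_
    · simp only [map_zero]
    · intro F G hF hG; simp only [map_add, hF, hG]
    · intro m a; rw [gauge_delta, one_zpow, Circle.coe_one, one_smul]
  rw [AddCircle.toCircle_zero, hg1, hℓ] at h0
  exact hF (norm_eq_zero.1 (Complex.ofReal_eq_zero.1 h0))

/-- The coefficients of a product with `δₖ ⊗ a` on the left. -/
theorem coeff_delta_mul (n k : ℤ) (a : A) (F : Crossed γ) :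
    coeff n (delta γ k a * F) = (γ ^ (n - k)) a * coeff (n - k) F := by
  refine induction
    (P := fun F => coeff n (delta γ k a * F) = (γ ^ (n - k)) a * coeff (n - k) F) F
    (isClosed_eq ((coeff n).continuous.comp (continuous_const_mul _))
    (continuous_const.mul (coeff (n - k)).continuous)) ?_ ?_ ?_
  · simp only [map_zero, mul_zero]
  · intro F G hF hG; simp only [map_add, mul_add, hF, hG]
  · intro m b
    rw [delta_mul_delta, coeff_delta, coeff_delta]
    by_cases h : k + m = n
    · rw [if_pos h, if_pos (by omega), ← h]
      congr 3
      omega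
    · rw [if_neg h, if_neg (by omega), mul_zero]

/-- The coefficients of a product with `δₖ ⊗ a` on the right. -/
theorem coeff_mul_delta (n k : ℤ) (a : A) (F : Crossed γ) :
    coeff n (F * delta γ k a) = (γ ^ k) (coeff (n - k) F) * a := by
  refine induction
    (P := fun F => coeff n (F * delta γ k a) = (γ ^ k) (coeff (n - k) F) * a) F
    (isClosed_eq ((coeff n).continuous.comp (continuous_mul_const _))
    (((CStarCompletion.continuous_hom (zpowHom γ k)).comp
      (coeff (n - k)).continuous).mul continuous_const)) ?_ ?_ ?_
  · simp only [map_zero, zero_mul]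
  · intro F G hF hG; simp only [map_add, add_mul, hF, hG]
  · intro m b
    rw [delta_mul_delta, coeff_delta, coeff_delta]
    by_cases h : m + k = n
    · rw [if_pos h, if_pos (by omega)]
    · rw [if_neg h, if_neg (by omega), map_zero, zero_mul]

end Crossed

/-! ### Fourier-invariant ideals and invariant ideals. -/

section ClosedIdeals

variable {A : Type u} [NonUnitalCStarAlgebra A]

/-- An approximate unit stands in for `1` on either side of `b`, and `J` is closed. -/
theorem mem_of_forall_mul_mul_mem {J : TwoSidedIdeal A} (hJ : IsClosed (J : Set A)) {b : A}
    (h : ∀ x y, x * b * y ∈ J) : b ∈ J := by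
  let _ := CStarAlgebra.spectralOrder A
  let _ := CStarAlgebra.spectralOrderedRing A
  have hu := CStarAlgebra.increasingApproximateUnit A
  have h1 : ∀ x, x * b ∈ J := fun x =>
    hJ.mem_of_tendsto (hu.tendsto_mul_left (x * b)) (Eventually.of_forall fun y => h x y)
  exact hJ.mem_of_tendsto (hu.tendsto_mul_right b) (Eventually.of_forall h1)

theorem mem_of_forall_mul_mem {J : Set A} (hJ : IsClosed J) {b : A}
    (h : ∀ y, b * y ∈ J) : b ∈ J := by
  let _ := CStarAlgebra.spectralOrder A
  let _ := CStarAlgebra.spectralOrderedRing A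
  exact hJ.mem_of_tendsto ((CStarAlgebra.increasingApproximateUnit A).tendsto_mul_left b)
    (Eventually.of_forall h)

/-- The elements with all coefficients in `J` form a closed Fourier-invariant ideal, whose
intersection with the copy of `A` is `J`. So this ideal is trivial only if `J` is. -/
theorem Crossed.isBiMinimal_of_noFourierInvariantIdeals {γ : A ≃⋆ₐ[ℂ] A}
    (h : NoFourierInvariantIdeals γ) : IsBiMinimal γ := by
  intro J hJ hγ
  have hpow : ∀ (n : ℤ) (a : A), a ∈ J → (γ ^ n) a ∈ J := by
    have h1 : ∀ a ∈ J, γ a ∈ J := fun a ha => by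
      have : γ a ∈ γ '' (J : Set A) := ⟨a, ha, rfl⟩
      rw [hγ] at this; exact this
    have h2 : ∀ a ∈ J, γ.symm a ∈ J := fun a ha => by
      have h' : a ∈ γ '' (J : Set A) := by rw [hγ]; exact ha
      obtain ⟨b, hb, rfl⟩ := h'
      rw [StarAlgEquiv.symm_apply_apply]; exact hb
    intro n
    induction n with
    | zero => intro a ha; exact ha
    | succ n ih => 
      intro a ha
      rw [FinConv.zpow_add_apply, zpow_one]; exact ih _ (h1 a ha)
    | pred n ih =>
      intro a ha
      rw [sub_eq_add_neg, FinConv.zpow_add_apply]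
      exact ih _ (h2 a ha)
  let I : TwoSidedIdeal (Crossed γ) := TwoSidedIdeal.mk' {F | ∀ n, coeff n F ∈ J}
    (fun n => by rw [map_zero]; exact J.zero_mem)
    (fun hx hy n => by rw [map_add]; exact J.add_mem (hx n) (hy n))
    (fun hx n => by rw [map_neg]; exact J.neg_mem (hx n))
    (fun {x y} hy => by
      refine induction (P := fun x => ∀ n, coeff n (x * y) ∈ J) x ?_ ?_ ?_ ?_
      · simp only [Set.ofPred_forall]
        exact isClosed_iInter fun n =>
          hJ.preimage ((coeff n).continuous.comp (continuous_mul_const y))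
      · intro n; rw [zero_mul, map_zero]; exact J.zero_mem
      · intro F G hF hG n
        rw [add_mul, map_add]; exact J.add_mem (hF n) (hG n)
      · intro k a n
        rw [coeff_delta_mul]; exact J.mul_mem_left _ _ (hy _))
    (fun {y x} hy => by
      refine induction (P := fun x => ∀ n, coeff n (y * x) ∈ J) x ?_ ?_ ?_ ?_
      · simp only [Set.ofPred_forall]
        exact isClosed_iInter fun n =>
          hJ.preimage ((coeff n).continuous.comp (continuous_const_mul y))
      · intro n; rw [mul_zero, map_zero]; exact J.zero_mem
      · intro F G hF hG n
        rw [mul_add, map_add]; exact J.add_mem (hF n) (hG n)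
      · intro k a n
        -- Right multiplication twists the coefficients by `γᵏ`; this is where the invariance of `J`
        -- enters.
        rw [coeff_mul_delta]; exact J.mul_mem_right _ _ (hpow k _ (hy _)))
  have hI : ∀ F, F ∈ I ↔ ∀ n, coeff n F ∈ J := fun F => TwoSidedIdeal.mem_mk' ..
  have hIc : IsClosed (I : Set (Crossed γ)) := by
    have : (I : Set (Crossed γ)) = ⋂ n, coeff n ⁻¹' J := by
      ext F; simp only [Set.mem_iInter]; exact hI F
    rw [this]
    exact isClosed_iInter fun n => hJ.preimage (coeff n).continuous
  have hdelta : ∀ a, delta γ 0 a ∈ I ↔ a ∈ J := fun a => by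
    rw [hI]
    refine ⟨fun h => by simpa [coeff_delta] using h 0, fun h n => ?_⟩
    rw [coeff_delta]
    split_ifs
    · exact h
    · exact J.zero_mem
  rcases h I hIc (fun n F hF => by rw [fourierCoeff_eq, hdelta]; exact (hI F).1 hF n) with h | h
  · left
    rw [eq_bot_iff]
    intro a ha
    have := (hdelta a).2 ha
    rw [h, TwoSidedIdeal.mem_bot] at this
    rw [TwoSidedIdeal.mem_bot]
    exact delta_injective 0 (this.trans (delta_zero 0).symm)
  · right
    rw [eq_top_iff]
    intro a _
    rw [← hdelta, h]
    trivial

/-- Let `J` be the intersection of `I` with the copy of `A`. Fourier invariance puts the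
coefficients of elements of `I` into `J`, so `J = 0` gives `I = 0` by uniqueness of Fourier
coefficients; `J = A` puts every `Uⁿ a` into `I`. -/
theorem Crossed.noFourierInvariantIdeals_of_isBiMinimal {γ : A ≃⋆ₐ[ℂ] A}
    (h : IsBiMinimal γ) : NoFourierInvariantIdeals γ := by
  intro I hI hinv
  let J : TwoSidedIdeal A := I.comap (inclHom γ)
  have hmem : ∀ a, a ∈ J ↔ delta γ 0 a ∈ I := fun a => TwoSidedIdeal.mem_comap _
  have hJ : IsClosed (J : Set A) := by
    have e : (J : Set A) = inclHom γ ⁻¹' I := Set.ext hmem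
    rw [e]
    exact hI.preimage (CStarCompletion.continuous_hom (inclHom γ))
  have hpow : ∀ (k : ℤ) (a : A), a ∈ J → (γ ^ k) a ∈ J := by
    intro k a ha
    refine mem_of_forall_mul_mul_mem hJ fun x y => ?_
    rw [hmem] at ha ⊢
    -- For a non-unital `A` the unitary `U` is only a multiplier. The conjugate `U⁻ᵏ a Uᵏ` is
    -- therefore formed with factors `x` and `y` inserted, which an approximate unit removes.
    have e : delta γ (-k) ((γ ^ (-k)) x) * delta γ 0 a * delta γ k y =
        delta γ 0 (x * (γ ^ k) a * y) := by
      rw [delta_mul_delta, delta_mul_delta, add_zero, neg_add_cancel, map_mul, zpow_zero]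
      congr 3
      exact (FinConv.zpow_add_apply _ _ _).symm.trans (by rw [add_neg_cancel, zpow_zero]; rfl)
    rw [← e]
    exact I.mul_mem_right _ _ (I.mul_mem_left _ _ ha)
  rcases h J hJ (by
    refine Set.Subset.antisymm ?_ fun a ha => ⟨(γ ^ (-1 : ℤ)) a, hpow (-1) a ha, ?_⟩
    · rintro _ ⟨a, ha, rfl⟩
      exact hpow 1 a ha
    · exact γ.apply_symm_apply a) with h | h
  · left
    rw [eq_bot_iff]
    intro F hF
    rw [TwoSidedIdeal.mem_bot]
    refine eq_zero_of_coeff_eq_zero fun n => ?_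
    have := hinv n F hF
    rw [fourierCoeff_eq, ← hmem, h, TwoSidedIdeal.mem_bot] at this
    exact this
  · right
    rw [eq_top_iff]
    intro F _
    refine induction F hI I.zero_mem (fun F G hF hG => I.add_mem hF hG) fun n a => ?_
    let f : A →+ Crossed γ := AddMonoidHom.mk' (delta γ n) (delta_add n)
    have hf : Continuous (delta γ n) := by
      have e : delta γ n = fun a => shift γ n (inclHom γ a) := by
        funext a; rw [inclHom_apply, shift_delta, add_zero]
      rw [e]
      exact (shift γ n).continuous.comp (CStarCompletion.continuous_hom (inclHom γ))
    -- It is enough to reach `δₙ ⊗ ay`, which factors through an element of the copy of `A`.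
    refine mem_of_forall_mul_mem (J := delta γ n ⁻¹' I) (hI.preimage hf) fun y => ?_
    change delta γ n (a * y) ∈ I
    have e : delta γ n a * delta γ 0 y = delta γ n (a * y) := by
      rw [delta_mul_delta, add_zero, zpow_zero]; rfl
    rw [← e]
    refine I.mul_mem_left _ _ ((hmem y).1 ?_)
    rw [h]; trivial

end ClosedIdeals

/-! ### Closed ideals with trivial intersections. -/

section IdealIntersection

variable {B : Type u} [NonUnitalCStarAlgebra B] {E : Type v} [NonUnitalCStarAlgebra E]

/-- A `*`-homomorphism whose image meets a closed ideal `J` trivially is bounded below modulo `J`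
on self-adjoint elements. -/
theorem norm_le_of_disjoint_ideal {J : TwoSidedIdeal E} (hJ : IsClosed (J : Set E))
    (ψ : B →⋆ₙₐ[ℂ] E) (hψ : ∀ b, ψ b ∈ J → b = 0) {b : B} (hb : IsSelfAdjoint b) {x : E}
    (hx : x ∈ J) {ε : ℝ} (hε : 0 < ε) (hbx : ‖ψ b - x‖ ≤ ε) : ‖b‖ ≤ 2 * ε := by
  -- Here `k` truncates at `±2ε`, `f` is the excess over the truncation, and `g` is a continuous
  -- function equal to `1/t` where `f` is nonzero and bounded by `1/(2ε)`. The goal is `f(b) = 0`,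
  -- which says `b = k(b)`.
  let k : ℝ → ℝ := fun t => max (-(2 * ε)) (min (2 * ε) t)
  let f : ℝ → ℝ := fun t => t - k t
  let g : ℝ → ℝ := fun t => t / (max |t| (2 * ε)) ^ 2
  have hpos : ∀ t : ℝ, 0 < max |t| (2 * ε) := fun t => lt_max_of_lt_right (by linarith)
  have hk : Continuous k := by fun_prop
  have hf : Continuous f := by fun_prop
  have hg : Continuous g := by
    refine continuous_id.div (by fun_prop) fun t => (pow_pos (hpos t) 2).ne'
  have hk0 : k 0 = 0 := by
    simp only [k]
    rw [min_eq_right (by linarith), max_eq_right (by linarith)]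
  have hf0 : f 0 = 0 := by simp only [f, hk0, sub_zero]
  have hg0 : g 0 = 0 := by simp only [g, zero_div]
  have hfac : ∀ t, t * (g t * f t) = f t := by
    intro t
    by_cases ht : |t| ≤ 2 * ε
    · have hft : f t = 0 := by
        rw [abs_le] at ht
        simp only [f, k]
        rw [min_eq_right ht.2, max_eq_right ht.1, sub_self]
      rw [hft, mul_zero, mul_zero]
    · have ht' : 2 * ε < |t| := not_le.1 ht
      have ht0 : t ≠ 0 := by
        rintro rfl
        rw [abs_zero] at ht'
        linarith
      have hgt : t * g t = 1 := by
        simp only [g]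
        rw [max_eq_left ht'.le, sq_abs]
        field_simp
      rw [← mul_assoc, hgt, one_mul]
  have hgn : ∀ t, ‖g t‖ ≤ 1 / (2 * ε) := by
    intro t
    simp only [g]
    rw [norm_div, norm_pow, Real.norm_eq_abs, Real.norm_eq_abs, abs_of_pos (hpos t),
      div_le_div_iff₀ (pow_pos (hpos t) 2) (by linarith), one_mul, sq]
    exact mul_le_mul (le_max_left _ _) (le_max_right _ _) (by linarith) (hpos t).le
  have hb1 : b * (cfcₙ g b * cfcₙ f b) = cfcₙ f b := by
    rw [← cfcₙ_mul g f b hg.continuousOn hg0 hf.continuousOn hf0]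
    nth_rw 1 [← cfcₙ_id' ℝ b hb]
    rw [← cfcₙ_mul (fun t => t) (fun t => g t * f t) b continuousOn_id rfl
      (hg.mul hf).continuousOn (by simp [hf0])]
    simp only [hfac]
  set c := ψ b
  set y := ψ (cfcₙ f b)
  set z := ψ (cfcₙ g b)
  have hy : c * (z * y) = y := by rw [← map_mul, ← map_mul, hb1]
  have hz : ‖z‖ ≤ 1 / (2 * ε) :=
    (NonUnitalStarAlgHom.norm_apply_le ψ _).trans (norm_cfcₙ_le fun t _ => hgn t)
  -- Modulo `J` the norm of `c` is at most `ε` and that of `z` at most `1/(2ε)`, so `y = c z y` has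
  -- at most half its own norm and must lie in `J`. The distance to `J` plays the role of the
  -- quotient norm, and `x z y + (c - x) z j` is the element of `J` that realizes the halving.
  have hhalf : ∀ j ∈ J, Metric.infDist y J ≤ 1 / 2 * dist y j := by
    intro j hj
    have hmem : x * (z * y) + (c - x) * (z * j) ∈ J :=
      J.add_mem (J.mul_mem_right _ _ hx) (J.mul_mem_left _ _ (J.mul_mem_left _ _ hj))
    refine (Metric.infDist_le_dist_of_mem (s := (J : Set E)) hmem).trans ?_
    have e : y - (x * (z * y) + (c - x) * (z * j)) = (c - x) * (z * (y - j)) := by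
      nth_rw 1 [← hy]
      noncomm_ring
    rw [dist_eq_norm, e, dist_eq_norm]
    calc ‖(c - x) * (z * (y - j))‖ ≤ ‖c - x‖ * (‖z‖ * ‖y - j‖) :=
          (norm_mul_le _ _).trans (mul_le_mul_of_nonneg_left (norm_mul_le _ _) (norm_nonneg _))
      _ ≤ ε * (1 / (2 * ε) * ‖y - j‖) := by gcongr
      _ = 1 / 2 * ‖y - j‖ := by field_simp
  have hne : (J : Set E).Nonempty := ⟨0, J.zero_mem⟩
  have hzero : Metric.infDist y J = 0 := by
    by_contra hne0
    have hp : 0 < Metric.infDist y J := lt_of_le_of_ne Metric.infDist_nonneg (Ne.symm hne0)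
    obtain ⟨j, hj, hlt⟩ := (Metric.infDist_lt_iff hne).1 (show Metric.infDist y J <
      2 * Metric.infDist y J by linarith)
    have := hhalf j hj
    linarith
  have hfb : cfcₙ f b = 0 := hψ _ ((hJ.mem_iff_infDist_zero hne).2 hzero)
  have hbk : b = cfcₙ k b := by
    have h := cfcₙ_sub (fun t : ℝ => t) k b continuousOn_id rfl hk.continuousOn hk0
    rw [cfcₙ_id' ℝ b hb] at h
    exact sub_eq_zero.1 (h.symm.trans hfb)
  rw [hbk]
  refine norm_cfcₙ_le fun t _ => ?_
  rw [Real.norm_eq_abs, abs_le]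
  exact ⟨le_max_left _ _, max_le (by linarith) (min_le_left _ _)⟩

/-- A closed ideal that meets a dense union of subalgebras trivially is zero. -/
theorem eq_bot_of_disjoint_dense {ι : Type*} {J : TwoSidedIdeal E} (hJ : IsClosed (J : Set E))
    (ψ : ι → B →⋆ₙₐ[ℂ] E) (hψ : ∀ i b, ψ i b ∈ J → b = 0)
    (hd : ∀ (x : E) (ε : ℝ), 0 < ε → ∃ i b, ‖ψ i b - x‖ < ε) : J = ⊥ := by
  rw [eq_bot_iff]
  intro x hx
  rw [TwoSidedIdeal.mem_bot, ← CStarRing.star_mul_self_eq_zero_iff]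
  set y := star x * x with hy
  have hyJ : y ∈ J := J.mul_mem_left _ _ hx
  have hys : IsSelfAdjoint y := .star_mul_self x
  refine norm_le_zero_iff.1 (le_of_forall_pos_le_add fun δ hδ => ?_)
  rw [zero_add]
  -- With accuracy `δ/3` the symmetrized approximant has norm at most `2δ/3`, and so `y` has norm at
  -- most `δ`.
  obtain ⟨i, b, hb⟩ := hd y (δ / 3) (by linarith)
  let b' : B := (2 : ℂ)⁻¹ • (b + star b)
  have hb's : IsSelfAdjoint b' := by
    change star b' = b'
    simp only [b', star_smul, star_add, star_star, star_inv₀, star_ofNat, add_comm]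
  have hb' : ‖ψ i b' - y‖ ≤ δ / 3 := by
    have e : ψ i b' - y = (2 : ℂ)⁻¹ • ((ψ i b - y) + star (ψ i b - y)) := by
      rw [star_sub, hys.star_eq, ← map_star]
      simp only [b', map_smul, map_add]
      module
    rw [e, norm_smul]
    have h2 : ‖(2 : ℂ)⁻¹‖ = 1 / 2 := by simp
    have h3 := norm_add_le (ψ i b - y) (star (ψ i b - y))
    rw [norm_star] at h3
    rw [h2]
    linarith
  have h1 := norm_le_of_disjoint_ideal hJ (ψ i) (hψ i) hb's hyJ (by linarith) hb'
  have h2 := NonUnitalStarAlgHom.norm_apply_le (ψ i) b'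
  have h3 := norm_sub_rev (ψ i b') y
  have h4 := norm_sub_norm_le y (ψ i b')
  linarith

end IdealIntersection

/-! ### Invariant ideals of the direct limit. -/

section DirectLimitIdeals

variable {A : Type u} [NonUnitalCStarAlgebra A] {φ : A →⋆ₙₐ[ℂ] A}

namespace DirLim

theorem limAut_of (y : PreLimit φ) :
    limAut φ (CStarCompletion.of y) = CStarCompletion.of (PreLimit.push y) :=
  CStarCompletion.mapHom_of _ PreLimit.norm_push_le y

theorem limAut_symm_of (y : PreLimit φ) :
    (limAut φ).symm (CStarCompletion.of y) = CStarCompletion.of (PreLimit.delay y) :=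
  CStarCompletion.mapHom_of _ PreLimit.norm_delay_le y

theorem continuous_limAut : Continuous (limAut φ) :=
  CStarCompletion.continuous_mapHom _ PreLimit.norm_push_le

theorem continuous_limAut_symm : Continuous (limAut φ).symm :=
  CStarCompletion.continuous_mapHom _ PreLimit.norm_delay_le

/-- The orbit `(a, φ a, φ² a, …)`. -/
def orbit (a : A) : PreLimit φ :=
  ⟨fun n => φ^[n] a, Eventually.of_forall fun n => Function.iterate_succ_apply' φ n a⟩

theorem of_eq_of_orbit (a : A) : DirLim.of φ a = CStarCompletion.of (orbit a) := rfl

theorem limAut_dirLimOf (a : A) : limAut φ (DirLim.of φ a) = DirLim.of φ (φ a) := by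
  rw [of_eq_of_orbit, limAut_of, of_eq_of_orbit]
  congr 1
  refine Subtype.ext (funext fun n => ?_)
  exact (Function.iterate_succ_apply' φ n a).symm

theorem limAut_pow_of (N : ℕ) (y : PreLimit φ) :
    ∃ z : PreLimit φ, (∀ n, z.seq n = φ^[N] (y.seq n)) ∧
      (limAut φ ^ (N : ℤ)) (CStarCompletion.of y) = CStarCompletion.of z := by
  induction N with
  | zero => exact ⟨y, fun n => rfl, rfl⟩
  | succ N ih =>
    obtain ⟨z, hz, e⟩ := ih
    refine ⟨PreLimit.push z, fun n => ?_, ?_⟩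
    · rw [PreLimit.seq_push, hz, Function.iterate_succ_apply']
    · rw [Nat.cast_succ, add_comm, FinConv.zpow_add_apply, e, zpow_one, limAut_of]

/-- If a sequence follows `φ` from index `N` on, then `N` applications of the automorphism turn it
into the orbit of its `N`-th entry, up to finitely many entries, which the limit norm ignores. -/
theorem exists_of_eq (y : PreLimit φ) : ∃ (N : ℕ) (a : A),
    CStarCompletion.of y = (limAut φ ^ (-(N : ℤ))) (DirLim.of φ a) := by
  obtain ⟨N, hN⟩ := eventually_atTop.1 y.seq_prop
  obtain ⟨z, hz, e⟩ := limAut_pow_of N y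
  refine ⟨N, y.seq N, ?_⟩
  have h : ∀ m, y.seq (N + m) = φ^[m] (y.seq N) := by
    intro m
    induction m with
    | zero => rfl
    | succ m ih =>
      rw [← add_assoc, hN _ (Nat.le_add_right N m), ih, Function.iterate_succ_apply']
  have hzo : CStarCompletion.of z = DirLim.of φ (y.seq N) := by
    refine CStarCompletion.of_eq_of (PreLimit.norm_eq_zero_of_eventually
      (eventually_atTop.2 ⟨N, fun n hn => ?_⟩))
    obtain ⟨m, rfl⟩ := Nat.exists_eq_add_of_le hn
    rw [PreLimit.seq_sub, hz, h, sub_eq_zero]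
    exact (Function.iterate_add_apply φ N m _).symm
  rw [← hzo, ← e, ← FinConv.zpow_add_apply, neg_add_cancel, zpow_zero]
  rfl

theorem exists_approx (x : DirLim φ) {ε : ℝ} (hε : 0 < ε) : ∃ (N : ℕ) (a : A),
    ‖(limAut φ ^ (-(N : ℤ))) (DirLim.of φ a) - x‖ < ε := by
  obtain ⟨_, ⟨y, rfl⟩, hy⟩ := Metric.mem_closure_iff.1
    (CStarCompletion.denseRange_ofFun (X := PreLimit φ) x) ε hε
  obtain ⟨N, a, h⟩ := exists_of_eq y
  refine ⟨N, a, ?_⟩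
  rw [← h, ← dist_eq_norm, dist_comm]
  exact hy

theorem norm_of (hφ : Function.Injective φ) (a : A) : ‖DirLim.of φ a‖ = ‖a‖ := by
  rw [of_eq_of_orbit, CStarCompletion.norm_of]
  have h : ∀ n, ‖φ^[n] a‖ = ‖a‖ := by
    intro n
    induction n with
    | zero => rfl
    | succ n ih => rw [Function.iterate_succ_apply', NonUnitalStarAlgHom.norm_map φ hφ, ih]
  exact PreLimit.limNorm_eq (tendsto_const_nhds.congr fun n => (h n).symm)

theorem of_injective (hφ : Function.Injective φ) : Function.Injective (DirLim.of φ) := by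
  rw [injective_iff_map_eq_zero]
  intro a ha
  rw [← norm_eq_zero, ← norm_of hφ, ha, norm_zero]

/-- The preimage of `J` in the first copy of `A` is invariant under `φ`. If it is zero, invariance
of `J` shows that every translate of that copy meets `J` trivially; if it is `A`, then `J` contains
all these translates. Their union is dense. -/
theorem isBiMinimal_limAut (h : IsMinimal φ) :
    IsBiMinimal (limAut φ) := by
  intro J hJ hγ
  have hfwd : ∀ x ∈ J, limAut φ x ∈ J := fun x hx => by
    have : limAut φ x ∈ limAut φ '' (J : Set _) := ⟨x, hx, rfl⟩
    rw [hγ] at this; exact this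
  have hbwd : ∀ x, limAut φ x ∈ J → x ∈ J := fun x hx => by
    have : limAut φ x ∈ limAut φ '' (J : Set _) := by rw [hγ]; exact hx
    obtain ⟨y, hy, e⟩ := this
    rwa [← (limAut φ).injective e]
  have hpow : ∀ (N : ℕ) x, (limAut φ ^ (-(N : ℤ))) x ∈ J ↔ x ∈ J := by
    intro N
    induction N with
    | zero => intro x; rfl
    | succ N ih =>
      intro x
      rw [Nat.cast_succ, neg_add, FinConv.zpow_add_apply, ih]
      have e : limAut φ ((limAut φ ^ (-1 : ℤ)) x) = x := (limAut φ).apply_symm_apply x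
      exact ⟨fun hx => by rw [← e]; exact hfwd _ hx, fun hx => hbwd _ (by rwa [e])⟩
  let J₀ : TwoSidedIdeal A := J.comap (DirLim.of φ)
  have hmem : ∀ a, a ∈ J₀ ↔ DirLim.of φ a ∈ J := fun a => TwoSidedIdeal.mem_comap _
  have hJ₀ : IsClosed (J₀ : Set A) := by
    have e : (J₀ : Set A) = DirLim.of φ ⁻¹' J := Set.ext hmem
    rw [e]
    exact hJ.preimage (CStarCompletion.continuous_hom (DirLim.of φ))
  rcases h J₀ hJ₀ (fun a ha => by
    rw [hmem, ← limAut_dirLimOf]; exact hfwd _ ((hmem a).1 ha)) with h0 | h0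
  · left
    refine eq_bot_of_disjoint_dense hJ
      (fun N : ℕ => (zpowHom (limAut φ) (-(N : ℤ))).comp (DirLim.of φ)) (fun N a ha => ?_)
      fun x ε hε => exists_approx x hε
    have ha' : a ∈ J₀ := (hmem a).2 ((hpow N _).1 ha)
    rwa [h0, TwoSidedIdeal.mem_bot] at ha'
  · right
    rw [eq_top_iff]
    intro x _
    have hx : x ∈ closure (J : Set (DirLim φ)) := by
      rw [Metric.mem_closure_iff]
      intro ε hε
      obtain ⟨N, a, hN⟩ := exists_approx x hε
      refine ⟨_, (hpow N _).2 ((hmem a).1 (by rw [h0]; trivial)), ?_⟩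
      rwa [dist_comm, dist_eq_norm]
    rwa [hJ.closure_eq] at hx

/-- The closed ideal of the direct limit generated by the sequences that eventually lie in `J`. -/
def limIdeal (φ : A →⋆ₙₐ[ℂ] A) (J : TwoSidedIdeal A) : TwoSidedIdeal (DirLim φ) :=
  TwoSidedIdeal.mk' (closure (CStarCompletion.of '' {y : PreLimit φ | ∀ᶠ n in atTop, y.seq n ∈ J}))
    (subset_closure ⟨0, Eventually.of_forall fun _ => J.zero_mem, map_zero _⟩)
    (fun hx hy => map_mem_closure₂ continuous_add hx hy (by
      rintro _ ⟨x, hx, rfl⟩ _ ⟨y, hy, rfl⟩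
      exact ⟨x + y, by filter_upwards [hx, hy] with n h1 h2 using J.add_mem h1 h2, map_add _ _ _⟩))
    (fun hx => map_mem_closure continuous_neg hx (by
      rintro _ ⟨x, hx, rfl⟩
      exact ⟨-x, by filter_upwards [hx] with n h1 using J.neg_mem h1, map_neg _ _⟩))
    (fun {x y} hy => map_mem_closure₂ continuous_mul
      (CStarCompletion.denseRange_ofFun (X := PreLimit φ) x) hy (by
      rintro _ ⟨x, rfl⟩ _ ⟨y, hy, rfl⟩
      exact ⟨x * y, by filter_upwards [hy] with n h1 using J.mul_mem_left _ _ h1, map_mul _ _ _⟩))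
    (fun {y x} hy => map_mem_closure₂ continuous_mul hy
      (CStarCompletion.denseRange_ofFun (X := PreLimit φ) x) (by
      rintro _ ⟨y, hy, rfl⟩ _ ⟨x, rfl⟩
      exact ⟨y * x, by filter_upwards [hy] with n h1 using J.mul_mem_right _ _ h1, map_mul _ _ _⟩))

theorem mem_limIdeal {J : TwoSidedIdeal A} {x : DirLim φ} : x ∈ limIdeal φ J ↔
    x ∈ closure (CStarCompletion.of '' {y : PreLimit φ | ∀ᶠ n in atTop, y.seq n ∈ J}) :=
  TwoSidedIdeal.mem_mk' ..

theorem isClosed_limIdeal (J : TwoSidedIdeal A) : IsClosed (limIdeal φ J : Set (DirLim φ)) := by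
  have e : (limIdeal φ J : Set (DirLim φ)) = closure (CStarCompletion.of ''
    {y : PreLimit φ | ∀ᶠ n in atTop, y.seq n ∈ J}) := Set.ext fun _ => mem_limIdeal
  rw [e]
  exact isClosed_closure

theorem limAut_image_limIdeal {J : TwoSidedIdeal A} (hJ : ∀ a ∈ J, φ a ∈ J) :
    limAut φ '' (limIdeal φ J : Set (DirLim φ)) = limIdeal φ J := by
  have h1 : ∀ x ∈ limIdeal φ J, limAut φ x ∈ limIdeal φ J := fun x hx =>
    mem_limIdeal.2 (map_mem_closure continuous_limAut (mem_limIdeal.1 hx) (by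
      rintro _ ⟨y, hy, rfl⟩
      exact ⟨PreLimit.push y, by filter_upwards [hy] with n h using hJ _ h, (limAut_of y).symm⟩))
  have h2 : ∀ x ∈ limIdeal φ J, (limAut φ).symm x ∈ limIdeal φ J := fun x hx =>
    mem_limIdeal.2 (map_mem_closure continuous_limAut_symm (mem_limIdeal.1 hx) (by
      rintro _ ⟨y, hy, rfl⟩
      refine ⟨PreLimit.delay y, ?_, (limAut_symm_of y).symm⟩
      -- Entry `n + 1` of the delayed sequence is entry `n` of `y`, so the eventual membership is
      -- the same statement shifted by one index.
      exact (eventually_map (f := atTop) (m := fun n : ℕ => n + 1)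
        (P := fun n => (PreLimit.delay y).seq n ∈ J)).2 hy |>.filter_mono
          (map_add_atTop_eq_nat 1).ge))
  refine Set.Subset.antisymm ?_ fun x hx => ⟨_, h2 x hx, (limAut φ).apply_symm_apply x⟩
  rintro _ ⟨x, hx, rfl⟩
  exact h1 x hx

theorem of_mem_limIdeal {J : TwoSidedIdeal A} (hJ : ∀ a ∈ J, φ a ∈ J) {a : A} (ha : a ∈ J) :
    DirLim.of φ a ∈ limIdeal φ J := by
  refine mem_limIdeal.2 (subset_closure ⟨orbit a, Eventually.of_forall fun n => ?_, rfl⟩)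
  change φ^[n] a ∈ J
  induction n with
  | zero => exact ha
  | succ n ih => rw [Function.iterate_succ_apply']; exact hJ _ ih

/-- The norm in the limit is the limit of the norms of the entries, so an approximation in the limit
is already one at some finite stage, where moreover the approximating entry lies in `J`. -/
theorem exists_near_of_limIdeal_eq_top {J : TwoSidedIdeal A} (h : limIdeal φ J = ⊤) (a : A)
    {ε : ℝ} (hε : 0 < ε) : ∃ (n : ℕ) (b : A), b ∈ J ∧ ‖φ^[n] a - b‖ < ε := by
  have ha : DirLim.of φ a ∈ limIdeal φ J := by rw [h]; trivial
  obtain ⟨_, ⟨y, hy, rfl⟩, hd⟩ := Metric.mem_closure_iff.1 (mem_limIdeal.1 ha) ε hε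
  rw [dist_eq_norm, of_eq_of_orbit, ← map_sub, CStarCompletion.norm_of] at hd
  obtain ⟨n, h1, h2⟩ :=
    (((orbit a - y).tendsto_limNorm.eventually (gt_mem_nhds hd)).and hy).exists
  exact ⟨n, y.seq n, h2, h1⟩

end DirLim

end DirectLimitIdeals

/-! ### The tail and the equivalence of the minimality conditions. -/

section TailMinimality

variable {C : Type u} [CStarAlgebra C] {α : C →⋆ₐ[ℂ] C}

/-- The kernel of `α` is a closed invariant ideal. As `α` is unital, it can be all of `C` only if `1
= 0`, and then there is nothing to prove. -/
theorem IsMinimal.injective (h : IsMinimal (α : C →⋆ₙₐ[ℂ] C)) : Function.Injective α := by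
  let J : TwoSidedIdeal C := TwoSidedIdeal.ker α
  have hmem : ∀ c, c ∈ J ↔ α c = 0 := fun c => TwoSidedIdeal.mem_ker α
  have hJ : IsClosed (J : Set C) := by
    have e : (J : Set C) = α ⁻¹' {0} := Set.ext hmem
    rw [e]
    exact isClosed_singleton.preimage (continuous_starAlgHom α)
  rw [injective_iff_map_eq_zero]
  intro c hc
  rcases h J hJ (fun x hx => (hmem _).2 (by
      have hx' : α x = 0 := (hmem x).1 hx
      change α (α x) = 0
      rw [hx', map_zero])) with h0 | h0
  · have := (hmem c).2 hc
    rwa [h0, TwoSidedIdeal.mem_bot] at this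
  · have h1 : (1 : C) ∈ J := by rw [h0]; trivial
    rw [hmem, map_one] at h1
    rw [← mul_one c, h1, mul_zero]

theorem subsingleton_tail (h : Function.Injective α) : Subsingleton (Tail α) := by
  have hk : ∀ k : kerAlg α, (k : C) = 0 := fun k =>
    h ((show α k = 0 from k.2).trans (map_zero α).symm)
  have hM : ∀ a b : KerMultiplier α, a = b := fun a b =>
    multiplier_ext α (fun k => (hk _).trans (hk _).symm) fun k => (hk _).trans (hk _).symm
  exact ⟨fun x y => ZeroAtInftyContinuousMap.ext fun n => Subtype.ext (hM _ _)⟩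

/-- The tail records what `α` forgets: if `α(c) = 0`, then `c*` lies in `ker α`, and the multiplier
`θ(c)` maps it to `c c*`. -/
theorem tailEnd_injective : Function.Injective (tailEnd α) := by
  rw [injective_iff_map_eq_zero]
  rintro ⟨c, x⟩ h
  have h1 : α c = 0 := congrArg Prod.fst h
  have h2 : tailCons α ((theta α).rangeRestrict c) x = 0 := congrArg Prod.snd h
  have h3 : (theta α).rangeRestrict c = 0 := congrArg (fun y : Tail α => y 0) h2
  have h4 : theta α c = 0 := congrArg Subtype.val h3
  have hk : star c ∈ kerAlg α := by
    change α (star c) = 0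
    rw [map_star, h1, star_zero]
  have h5 : c * star c = 0 := by
    have := congrArg (fun m : KerMultiplier α => ((m.fst ⟨star c, hk⟩ : kerAlg α) : C)) h4
    exact this
  refine Prod.ext ((CStarRing.mul_star_self_eq_zero_iff c).1 h5)
    (ZeroAtInftyContinuousMap.ext fun n => ?_)
  exact congrArg (fun y : Tail α => y (n + 1)) h2

theorem tailEnd_tailIncl (h : Function.Injective α) (c : C) :
    tailEnd α (tailIncl α c) = tailIncl α (α c) :=
  have := subsingleton_tail h
  Prod.ext rfl (Subsingleton.elim _ _)

theorem tailIncl_bijective (h : Function.Injective α) : Function.Bijective (tailIncl α) :=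
  have := subsingleton_tail h
  ⟨fun _ _ e => congrArg Prod.fst e, fun b => ⟨b.1, Prod.ext rfl (Subsingleton.elim _ _)⟩⟩

theorem isMinimal_tailEnd (h : IsMinimal (α : C →⋆ₙₐ[ℂ] C)) : IsMinimal (tailEnd α) := by
  intro J hJ hinv
  have hα := h.injective
  let J₀ : TwoSidedIdeal C := J.comap (tailIncl α)
  have hmem : ∀ c, c ∈ J₀ ↔ tailIncl α c ∈ J := fun c => TwoSidedIdeal.mem_comap _
  have hJ₀ : IsClosed (J₀ : Set C) := by
    have e : (J₀ : Set C) = tailIncl α ⁻¹' J := Set.ext hmem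
    rw [e]
    exact hJ.preimage (CStarCompletion.continuous_hom (tailIncl α))
  rcases h J₀ hJ₀ (fun c hc => (hmem _).2 (by
      have := hinv _ ((hmem c).1 hc)
      rwa [tailEnd_tailIncl hα] at this)) with h0 | h0
  · left
    rw [eq_bot_iff]
    intro b hb
    obtain ⟨c, rfl⟩ := (tailIncl_bijective hα).2 b
    have hc := (hmem c).2 hb
    rw [h0, TwoSidedIdeal.mem_bot] at hc
    rw [hc, map_zero]
    exact TwoSidedIdeal.zero_mem _
  · right
    rw [eq_top_iff]
    intro b _
    obtain ⟨c, rfl⟩ := (tailIncl_bijective hα).2 b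
    refine (hmem c).1 ?_
    rw [h0]; trivial

/-- The limit of `K = J ⊕ T` is an invariant ideal of `B_∞`. If it is zero, then `J = 0` because `B`
embeds in `B_∞`. If it is everything, some `βⁿ(1, 0)`, whose first component is still `1`, is at
distance less than one from `K`; so `J` contains an invertible element. -/
theorem isMinimal_of_isBiMinimal (h : IsBiMinimal (limAut (tailEnd α))) :
    IsMinimal (α : C →⋆ₙₐ[ℂ] C) := by
  intro J hJ hinv
  let K : TwoSidedIdeal (TailAlg α) := TwoSidedIdeal.mk' {b | b.1 ∈ J} J.zero_mem
    (fun hx hy => J.add_mem hx hy) (fun hx => J.neg_mem hx) (fun hy => J.mul_mem_left _ _ hy)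
    (fun hx => J.mul_mem_right _ _ hx)
  have hmem : ∀ b, b ∈ K ↔ b.1 ∈ J := fun b => TwoSidedIdeal.mem_mk' ..
  have hK : ∀ b ∈ K, tailEnd α b ∈ K := fun b hb => (hmem _).2 (hinv _ ((hmem b).1 hb))
  rcases h (DirLim.limIdeal (tailEnd α) K) (DirLim.isClosed_limIdeal K)
    (DirLim.limAut_image_limIdeal hK) with h0 | h0
  · left
    rw [eq_bot_iff]
    intro c hc
    have hc' := DirLim.of_mem_limIdeal hK (a := ((c, 0) : TailAlg α)) ((hmem _).2 hc)
    rw [h0, TwoSidedIdeal.mem_bot] at hc'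
    have hz := DirLim.of_injective (φ := tailEnd α) tailEnd_injective (hc'.trans (map_zero _).symm)
    rw [TwoSidedIdeal.mem_bot]
    exact congrArg Prod.fst hz
  · right
    obtain ⟨n, b, hb, hd⟩ := DirLim.exists_near_of_limIdeal_eq_top h0 ((1, 0) : TailAlg α) one_pos
    have e : ((tailEnd α)^[n] ((1, 0) : TailAlg α)).1 = 1 := by
      clear hd
      induction n with
      | zero => rfl
      | succ n ih =>
        rw [Function.iterate_succ_apply']
        exact (congrArg α ih).trans (map_one α)
    have hn : ‖(1 : C) - b.1‖ < 1 := by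
      refine lt_of_le_of_lt ?_ hd
      refine (congrArg (fun c => ‖c - b.1‖) e.symm).trans_le ?_
      exact norm_fst_le ((tailEnd α)^[n] ((1, 0) : TailAlg α) - b)
    have hu : IsUnit b.1 := by
      have := isUnit_one_sub_of_norm_lt_one hn
      rwa [sub_sub_cancel] at this
    obtain ⟨w, hw⟩ := hu
    have h1 : (1 : C) ∈ J := by
      rw [← w.inv_mul, hw]
      exact J.mul_mem_left _ _ ((hmem b).1 hb)
    rw [eq_top_iff]
    intro c _
    rw [← mul_one c]
    exact J.mul_mem_left _ _ h1

theorem minimality_tfae (α : C →⋆ₐ[ℂ] C) : List.TFAE [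
    IsMinimal (α : C →⋆ₙₐ[ℂ] C),
    IsMinimal (tailEnd α),
    IsBiMinimal (limAut (tailEnd α)),
    NoFourierInvariantIdeals (limAut (tailEnd α))] := by
  tfae_have 1 → 2 := isMinimal_tailEnd
  tfae_have 2 → 3 := DirLim.isBiMinimal_limAut
  tfae_have 3 → 1 := isMinimal_of_isBiMinimal
  tfae_have 3 → 4 := Crossed.noFourierInvariantIdeals_of_isBiMinimal
  tfae_have 4 → 3 := Crossed.isBiMinimal_of_noFourierInvariantIdeals
  tfae_finish

end TailMinimality

/-! ### Matrix norms and compressions. -/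

section MatrixAlgebra

/-- The `C*`-algebra of square matrices over a `C*`-algebra. -/
def CMat (n : Type v) [Fintype n] (D : Type u) [NonUnitalCStarAlgebra D] : Type (max u v) :=
  CStarMatrix n n D

namespace CMat

variable {n : Type v} [Fintype n] {D : Type u} [NonUnitalCStarAlgebra D]

instance : NonUnitalCStarAlgebra (CMat n D) :=
  letI := CStarAlgebra.spectralOrder D
  letI := CStarAlgebra.spectralOrderedRing D
  inferInstanceAs (NonUnitalCStarAlgebra (CStarMatrix n n D))

/-- A matrix as an element of the `C*`-algebra of matrices. -/
def mk (M : Matrix n n D) : CMat n D := CStarMatrix.ofMatrix M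

/-- The entries of an element of the `C*`-algebra of matrices. -/
def entries (M : CMat n D) : Matrix n n D := CStarMatrix.ofMatrix.symm M

theorem cstarNorms_eq {ν : ℕ} (M : Matrix (Fin ν) (Fin ν) D) : cstarNorms D ν M = ‖mk M‖ := rfl

theorem mk_mul (M N : Matrix n n D) : mk (M * N) = mk M * mk N := rfl
theorem mk_conjTranspose (M : Matrix n n D) : mk M.conjTranspose = star (mk M) := rfl

theorem continuous_mk : Continuous (mk : Matrix n n D → CMat n D) :=
  let _ := CStarAlgebra.spectralOrder D
  have := CStarAlgebra.spectralOrderedRing D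
  (CStarMatrix.ofMatrixL (m := n) (n := n) (A := D)).continuous

/-- A `*`-homomorphism of matrix algebras, given on entries. -/
def homOf {m : Type*} [Fintype m] {D' : Type*} [NonUnitalCStarAlgebra D']
    (f : Matrix n n D →ₗ[ℂ] Matrix m m D') (hmul : ∀ M N, f (M * N) = f M * f N)
    (hstar : ∀ M, f M.conjTranspose = (f M).conjTranspose) : CMat n D →⋆ₙₐ[ℂ] CMat m D' where
  toFun M := mk (f M.entries)
  map_smul' c M := congrArg mk (map_smul f c M.entries)
  map_zero' := congrArg mk (map_zero f)
  map_add' M N := congrArg mk (map_add f M.entries N.entries)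
  map_mul' M N := congrArg mk (hmul M.entries N.entries)
  map_star' M := congrArg mk (hstar M.entries)

/-- A `*`-homomorphism applied to all entries of a matrix. -/
def mapHom {D' : Type*} [NonUnitalCStarAlgebra D'] (f : D →⋆ₙₐ[ℂ] D') :
    CMat n D →⋆ₙₐ[ℂ] CMat n D' :=
  homOf
    { toFun := fun M => M.map f
      map_add' := fun M N => Matrix.ext fun i j => map_add f _ _
      map_smul' := fun c M => Matrix.ext fun i j => map_smul f c _ }
    (fun M N => Matrix.ext fun i j => by
      simp [Matrix.mul_apply, map_sum, map_mul])
    (fun M => Matrix.ext fun i j => map_star f _)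

theorem norm_map_le {D' : Type*} [NonUnitalCStarAlgebra D'] (f : D →⋆ₙₐ[ℂ] D')
    (M : Matrix n n D) : ‖mk (M.map f)‖ ≤ ‖mk M‖ :=
  NonUnitalStarAlgHom.norm_apply_le (mapHom f) (mk M)

theorem norm_map {D' : Type*} [NonUnitalCStarAlgebra D'] (f : D →⋆ₙₐ[ℂ] D')
    (hf : Function.Injective f) (M : Matrix n n D) : ‖mk (M.map f)‖ = ‖mk M‖ :=
  NonUnitalStarAlgHom.norm_map (A := CMat n D) (B := CMat n D') (mapHom f)
    (fun _ _ h => Matrix.map_injective hf h) (mk M)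

/-- The scalar matrices with entries in `D`. -/
def diagHom (n : Type v) [Fintype n] [DecidableEq n] (D : Type u) [NonUnitalCStarAlgebra D] :
    D →⋆ₙₐ[ℂ] CMat n D where
  toFun d := mk (Matrix.diagonal fun _ => d)
  map_smul' c d := congrArg mk (show Matrix.diagonal (fun _ => c • d) =
    c • Matrix.diagonal fun _ : n => d by ext i j; by_cases h : i = j <;> simp [h])
  map_zero' := congrArg mk Matrix.diagonal_zero
  map_add' d e := congrArg mk (Matrix.diagonal_add _ _).symm
  map_mul' d e := congrArg mk (Matrix.diagonal_mul_diagonal _ _).symm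
  map_star' d := congrArg mk (Matrix.diagonal_conjTranspose _).symm

theorem diagHom_apply [DecidableEq n] (d : D) :
    diagHom n D d = mk (Matrix.diagonal fun _ : n => d) := rfl

theorem norm_diagonal_le [DecidableEq n] (d : D) :
    ‖mk (Matrix.diagonal fun _ : n => d)‖ ≤ ‖d‖ := by
  rw [← diagHom_apply]
  exact NonUnitalStarAlgHom.norm_apply_le (A := D) (B := CMat n D) (diagHom n D) d

variable {k : Type*} [Fintype k] [DecidableEq k]

/-- The embedding of `M_n(D)` as a corner of `M_{n × k}(D)`. -/
def cornerHom (k₀ : k) : CMat n D →⋆ₙₐ[ℂ] CMat (n × k) D :=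
  homOf
    { toFun := fun M => Matrix.of fun x y => if x.2 = k₀ ∧ y.2 = k₀ then M x.1 y.1 else 0
      map_add' := fun M N => Matrix.ext fun x y => by
        simp only [Matrix.of_apply, Matrix.add_apply]; split_ifs <;> simp
      map_smul' := fun c M => Matrix.ext fun x y => by
        simp only [Matrix.of_apply, Matrix.smul_apply]; split_ifs <;> simp }
    (fun M N => Matrix.ext fun x y => by
      simp only [LinearMap.coe_mk, AddHom.coe_mk, Matrix.mul_apply, Matrix.of_apply,
        Fintype.sum_prod_type]
      by_cases hx : x.2 = k₀ <;> by_cases hy : y.2 = k₀ <;> simp [hx, hy])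
    (fun M => Matrix.ext fun x y => by
      simp only [LinearMap.coe_mk, AddHom.coe_mk, Matrix.conjTranspose_apply, Matrix.of_apply]
      by_cases hx : x.2 = k₀ <;> by_cases hy : y.2 = k₀ <;> simp [hx, hy])

/-- The corner embedding is an injective `*`-homomorphism. It allows compressions by rows and
columns to be written as conjugations by square matrices. -/
theorem norm_corner (k₀ : k) (M : Matrix n n D) :
    ‖mk (Matrix.of fun x y : n × k => if x.2 = k₀ ∧ y.2 = k₀ then M x.1 y.1 else 0)‖ = ‖mk M‖ :=
  NonUnitalStarAlgHom.norm_map (A := CMat n D) (B := CMat (n × k) D) (cornerHom k₀)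
    (fun M N h => Matrix.ext fun i j => by
      have h' : (if k₀ = k₀ ∧ k₀ = k₀ then M.entries i j else 0) =
          if k₀ = k₀ ∧ k₀ = k₀ then N.entries i j else 0 :=
        congrArg (fun L : CMat (n × k) D => L.entries (i, k₀) (j, k₀)) h
      have h'' : M.entries i j = N.entries i j := by simpa using h'
      exact h'') (mk M)

theorem norm_conj_le (X M : Matrix n n D) (hX : ‖mk X‖ ≤ 1) :
    ‖mk (X * M * X.conjTranspose)‖ ≤ ‖mk M‖ := by
  rw [mk_mul, mk_mul, mk_conjTranspose]
  have h : ‖star (mk X)‖ ≤ 1 := by rwa [norm_star]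
  calc ‖mk X * mk M * star (mk X)‖ ≤ ‖mk X‖ * ‖mk M‖ * ‖star (mk X)‖ :=
        (norm_mul_le _ _).trans (mul_le_mul_of_nonneg_right (norm_mul_le _ _) (norm_nonneg _))
    _ ≤ 1 * ‖mk M‖ * 1 := by gcongr
    _ = ‖mk M‖ := by ring

/-- Compression by a column of operators with orthogonal ranges. -/
theorem norm_column_conj_le [DecidableEq n] [Nonempty k] {p : D} (hp : star p = p)
    (hpp : p * p = p) (x : k → D) (hx : ∀ i j, x i * star (x j) = if i = j then p else 0)
    (S : Matrix n n D) :
    ‖mk (Matrix.of fun s t : n × k => x s.2 * S s.1 t.1 * star (x t.2))‖ ≤ ‖mk S‖ := by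
  obtain ⟨k₀⟩ := ‹Nonempty k›
  -- `Y` holds the column `x` in position `k₀` of each block. As `Y Y*` is diagonal with entries
  -- `p`, it is a contraction, and it conjugates the corner copy of `S` to the given matrix.
  let Y : Matrix (n × k) (n × k) D :=
    Matrix.of fun s t => if s.1 = t.1 ∧ t.2 = k₀ then x s.2 else 0
  have hYY : Y * Y.conjTranspose = Matrix.diagonal fun _ => p := by
    ext s t
    rw [Matrix.mul_apply, Fintype.sum_prod_type, Matrix.diagonal_apply]
    by_cases hst : s.1 = t.1
    · simp [Y, hst, ite_and, Finset.sum_ite_eq, hx, Prod.ext_iff]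
    · have hst' : t.1 ≠ s.1 := fun h => hst h.symm
      simp [Y, hst, hst', ite_and, Finset.sum_ite_eq, Prod.ext_iff]
  have hpn : ‖p‖ ≤ 1 := by
    have e := CStarRing.norm_star_mul_self (x := p)
    rw [hp, hpp] at e
    nlinarith [norm_nonneg p]
  have hY : ‖mk Y‖ ≤ 1 := by
    have e := CStarRing.norm_self_mul_star (x := mk Y)
    rw [← mk_conjTranspose, ← mk_mul, hYY] at e
    have e' := (norm_diagonal_le (n := n × k) p).trans hpn
    nlinarith [norm_nonneg (mk Y)]
  rw [← norm_corner k₀ S]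
  refine le_trans (le_of_eq ?_) (norm_conj_le Y _ hY)
  congr 2
  ext s t
  simp [Y, Matrix.mul_apply, Fintype.sum_prod_type, ite_and, Finset.sum_ite_eq,
    apply_ite (star : D → D), mul_ite]

/-- Compression by a contractive row of operators. -/
theorem norm_row_conj_le [DecidableEq n] [Nonempty k] (x : k → D)
    (hx : ‖∑ i, x i * star (x i)‖ ≤ 1) (T : Matrix (n × k) (n × k) D) :
    ‖mk (Matrix.of fun a b : n => ∑ i, ∑ j, x i * T (a, i) (b, j) * star (x j))‖ ≤ ‖mk T‖ := by
  obtain ⟨k₀⟩ := ‹Nonempty k›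
  -- The transposed arrangement: `Z` holds the row `x` in row `k₀` of each block, and `Z Z*` is the
  -- corner copy of a diagonal matrix with entries `∑ xᵢ xᵢ*`.
  let Z : Matrix (n × k) (n × k) D :=
    Matrix.of fun s t => if s.1 = t.1 ∧ s.2 = k₀ then x t.2 else 0
  have hZZ : Z * Z.conjTranspose = (Matrix.of fun s t : n × k => if s.2 = k₀ ∧ t.2 = k₀ then
      (Matrix.diagonal (fun _ : n => ∑ i, x i * star (x i)) : Matrix n n D) s.1 t.1 else 0) := by
    ext s t
    rw [Matrix.mul_apply, Fintype.sum_prod_type, Matrix.of_apply, Matrix.diagonal_apply]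
    by_cases hs : s.2 = k₀ <;> by_cases ht : t.2 = k₀ <;> by_cases hst : s.1 = t.1
    all_goals first
      | (have hst' : t.1 ≠ s.1 := fun h => hst h.symm
         simp [Z, hs, ht, hst, hst', ite_and])
      | simp [Z, hs, ht, hst, ite_and]
  have hZ : ‖mk Z‖ ≤ 1 := by
    have e := CStarRing.norm_self_mul_star (x := mk Z)
    rw [← mk_conjTranspose, ← mk_mul, hZZ, norm_corner] at e
    have e' := (norm_diagonal_le (n := n) (∑ i, x i * star (x i))).trans hx
    rw [e] at e'
    nlinarith [norm_nonneg (mk Z)]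
  rw [← norm_corner k₀]
  refine le_trans (le_of_eq ?_) (norm_conj_le Z T hZ)
  congr 2
  ext s t
  rw [Matrix.mul_apply, Fintype.sum_prod_type, Matrix.of_apply]
  by_cases hs : s.2 = k₀ <;> by_cases ht : t.2 = k₀
  all_goals simp [Z, Matrix.mul_apply, Fintype.sum_prod_type, hs, ht, ite_and, Finset.sum_mul,
    apply_ite (star : D → D), mul_ite, Finset.sum_ite_irrel]
  exact Finset.sum_comm

/-- The norm of a column. -/
theorem norm_column_sq [DecidableEq n] (i₀ : n) (x : n → D) :
    ‖mk (Matrix.of fun i j : n => if j = i₀ then x i else 0)‖ ^ 2 = ‖∑ i, star (x i) * x i‖ := by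
  rw [sq, ← CStarRing.norm_star_mul_self, ← mk_conjTranspose, ← mk_mul]
  -- For a column matrix `M`, the product `M* M` has a single nonzero entry, and such matrices form
  -- an isometric copy of `D`.
  let f : D →⋆ₙₐ[ℂ] CMat n D :=
    { toFun := fun d => mk (Matrix.single i₀ i₀ d)
      map_smul' := fun c d => congrArg mk (Matrix.smul_single c i₀ i₀ d).symm
      map_zero' := congrArg mk (Matrix.single_zero i₀ i₀)
      map_add' := fun d e => congrArg mk (Matrix.single_add i₀ i₀ d e)
      map_mul' := fun d e => congrArg mk (Matrix.single_mul_single_same d i₀ i₀ i₀ e).symm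
      map_star' := fun d => congrArg mk (Matrix.conjTranspose_single i₀ i₀ d).symm }
  have hf : Function.Injective f := fun d e h => by
    have h' : Matrix.single i₀ i₀ d i₀ i₀ = Matrix.single i₀ i₀ e i₀ i₀ :=
      congrArg (fun M : CMat n D => M.entries i₀ i₀) h
    simpa using h'
  rw [← NonUnitalStarAlgHom.norm_map f hf]
  congr 2
  ext i j
  rw [Matrix.mul_apply, Matrix.single_apply]
  by_cases hi : i = i₀ <;> by_cases hj : j = i₀
  · simp [hi, hj]
  · simp [hi, hj, Ne.symm hj]
  · simp [hi, Ne.symm hi]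
  · simp [hi, hj, Ne.symm hi]

end CMat

end MatrixAlgebra

/-! ### The map from `ℓ¹(ℤ₊, C, α)_l` to a crossed product. -/

theorem Crossed.norm_delta_le {A : Type u} [NonUnitalCStarAlgebra A] {γ : A ≃⋆ₐ[ℂ] A} (n : ℤ)
    (a : A) : ‖delta γ n a‖ ≤ ‖a‖ := by
  have h := norm_shift_le (γ := γ) n (delta γ 0 a)
  rwa [shift_delta, add_zero, norm_delta_zero] at h

section ToCrossed

variable {C : Type u} [CStarAlgebra C] {α : C →⋆ₐ[ℂ] C} {A : Type u} [NonUnitalCStarAlgebra A]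
  (γ : A ≃⋆ₐ[ℂ] A) (ι : C →⋆ₙₐ[ℂ] A)

namespace Ell1

theorem summable_norm_toCrossed (F : Ell1 α) :
    Summable fun n : ℕ => ‖Crossed.delta γ n (ι (F.coeff n))‖ :=
  Summable.of_nonneg_of_le (fun _ => norm_nonneg _)
    (fun _ => (Crossed.norm_delta_le _ _).trans (NonUnitalStarAlgHom.norm_apply_le ι _)) F.summable

theorem summable_toCrossed (F : Ell1 α) :
    Summable fun n : ℕ => Crossed.delta γ n (ι (F.coeff n)) :=
  (summable_norm_toCrossed γ ι F).of_norm

/-- The map `∑ₙ δₙ ⊗ cₙ ↦ ∑ₙ Uⁿ ι(cₙ)` into a crossed product. -/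
def toCrossed : Ell1 α →ₗ[ℂ] Crossed γ where
  toFun F := ∑' n : ℕ, Crossed.delta γ n (ι (F.coeff n))
  map_add' F G := by
    rw [← (summable_toCrossed γ ι F).tsum_add (summable_toCrossed γ ι G)]
    exact tsum_congr fun n => by rw [coeff_add, map_add, Crossed.delta_add]
  map_smul' r F := by
    rw [RingHom.id_apply, ← tsum_const_smul'' r]
    exact tsum_congr fun n => by rw [coeff_smul, map_smul, Crossed.delta_smul]

theorem toCrossed_apply (F : Ell1 α) :
    toCrossed γ ι F = ∑' n : ℕ, Crossed.delta γ n (ι (F.coeff n)) := rfl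

theorem toCrossed_delta (n : ℕ) (c : C) :
    toCrossed γ ι (delta α n c) = Crossed.delta γ n (ι c) := by
  rw [toCrossed_apply, tsum_eq_single n]
  · rw [coeff_delta, if_pos rfl]
  · intro m hm
    rw [coeff_delta, if_neg hm, map_zero, Crossed.delta_zero]

theorem map_toCrossed {D : Type v} [NonUnitalCStarAlgebra D] (f : Crossed γ →⋆ₙₐ[ℂ] D)
    (F : Ell1 α) : f (toCrossed γ ι F) = ∑' n : ℕ, f (Crossed.delta γ n (ι (F.coeff n))) :=
  (summable_toCrossed γ ι F).map_tsum f (CStarCompletion.continuous_hom f)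

variable {γ ι}

/-- A faithful representation of the crossed product restricts to covariant pairs of every kind. -/
theorem exists_faithful_pair (hι : ∀ c, ι (α c) = γ (ι c)) (h1 : ∀ a, ι 1 * a = a)
    (t : PairKind) : ∃ (p : LeftCovariantPair α t) (σ : Crossed γ →⋆ₙₐ[ℂ] (p.H →L[ℂ] p.H)),
      Function.Injective σ ∧ ∀ F, p.integrated F = σ (toCrossed γ ι F) := by
  have h1' : ∀ a, a * ι 1 = a := fun a => star_injective <| by
    rw [star_mul, ← map_star, star_one, h1]
  have hγ : γ (ι 1) = ι 1 := by rw [← hι, map_one]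
  -- An automorphism maps the unit `ι 1` of `A` to a unit, and the unit is unique.
  have hγn : ∀ n : ℤ, (γ ^ n) (ι 1) = ι 1 := by
    intro n
    have := h1' ((γ ^ n) ((γ ^ (-n)) (ι 1)))
    rw [← FinConv.zpow_add_apply, add_neg_cancel, zpow_zero] at this
    have e : (γ ^ n) (ι 1) * ι 1 = (γ ^ n) (ι 1) := h1' _
    have e2 : (γ ^ n) (ι 1) * (γ ^ n) ((γ ^ (-n)) (ι 1)) = (γ ^ n) ((γ ^ (-n)) (ι 1)) := by
      rw [← map_mul, h1]
    rw [← FinConv.zpow_add_apply, add_neg_cancel, zpow_zero] at e2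
    exact e.symm.trans e2
  obtain ⟨H, _, _, _, σ, hσ⟩ := exists_faithful_rep (Crossed γ)
  set u := Crossed.delta γ 1 (ι 1) with hu
  set e := Crossed.delta γ 0 (ι 1) with he
  have hum : ∀ (n : ℤ) (a : A), u * Crossed.delta γ n a = Crossed.delta γ (1 + n) a := fun n a => by
    rw [hu, Crossed.delta_mul_delta, hγn, h1]
  have hem : ∀ (n : ℤ) (a : A), e * Crossed.delta γ n a = Crossed.delta γ n a := fun n a => by
    rw [he, Crossed.delta_mul_delta, hγn, h1, zero_add]
  have hsu : star u = Crossed.delta γ (-1) (ι 1) := by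
    rw [hu, Crossed.star_delta, ← map_star, star_one, hγn]
  have hse : star e = e := by
    rw [he, Crossed.star_delta, neg_zero, ← map_star, star_one, hγn]
  have hee : e * e = e := hem 0 _
  have heu : e * u = u := hem 1 _
  have hue : u * e = u := by rw [he, hum]; rfl
  have huu : u * star u = e := by rw [hsu, hum]; rfl
  have huu' : star u * u = e := by
    rw [hsu, hu, Crossed.delta_mul_delta, hγn, h1]; rfl
  have hsue : star u * e = star u := by
    have := congrArg star heu
    rwa [star_mul, hse] at this
  have hesu : e * star u = star u := by
    have := congrArg star hue
    rwa [star_mul, hse] at this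
  -- The representation `σ` may be degenerate. The projection `σ e` is the image of the unit of the
  -- crossed product, and adding `1 - σ e` makes `V` unitary on all of `H`, hence admissible for
  -- each of the four kinds, without changing its products with `σ`.
  let V : H →L[ℂ] H := σ u + (1 - σ e)
  have hsV : star V = σ (star u) + (1 - σ e) := by
    simp only [V, star_add, star_sub, star_one, ← map_star, hse]
  have hVV : star V * V = 1 ∧ V * star V = 1 := by
    rw [hsV]
    simp only [V, mul_add, add_mul, mul_sub, sub_mul, mul_one, one_mul, ← map_mul, huu, huu', hue,
      heu, hsue, hesu, hee]
    constructor <;> abel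
  have hVm : ∀ (n : ℤ) (a : A), V * σ (Crossed.delta γ n a) = σ (Crossed.delta γ (1 + n) a) :=
    fun n a => by
      simp only [V, add_mul, sub_mul, one_mul, ← map_mul, hum, hem]
      abel
  let p : LeftCovariantPair α t :=
    { H := H
      π := (σ.comp (Crossed.inclHom γ)).comp ι
      V := V
      kind := by
        cases t with
        | contractive => exact PairKind.Holds.norm_le_one (t := .unitary) hVV
        | isometric => exact hVV.1
        | coisometric => exact hVV.2
        | unitary => exact hVV
      covariant := fun c => by
        change σ (Crossed.delta γ 0 (ι c)) * V = V * σ (Crossed.delta γ 0 (ι (α c)))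
        rw [hVm, hι]
        have e1 : Crossed.delta γ 0 (ι c) * u = Crossed.delta γ (1 + 0) (γ (ι c)) := by
          rw [hu, Crossed.delta_mul_delta, h1', zpow_one, add_comm]
        have e2 : Crossed.delta γ 0 (ι c) * e = Crossed.delta γ 0 (ι c) := by
          rw [he, Crossed.delta_mul_delta, h1', zpow_zero, zero_add]; rfl
        simp only [V, mul_add, mul_sub, mul_one, ← map_mul, e1, e2]
        abel }
  refine ⟨p, σ, hσ, fun F => ?_⟩
  rw [p.integrated_apply, map_toCrossed]
  refine tsum_congr fun n => ?_
  generalize F.coeff n = c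
  change V ^ n * σ (Crossed.delta γ 0 (ι c)) = _
  induction n with
  | zero => rw [pow_zero, one_mul]; rfl
  | succ k ih => rw [pow_succ', mul_assoc, ih, hVm, Nat.cast_succ, add_comm]

/-- Multiplicativity is inherited from the integrated form of a covariant pair through a faithful
representation. -/
theorem toCrossed_mul (hι : ∀ c, ι (α c) = γ (ι c)) (h1 : ∀ a, ι 1 * a = a) (F G : Ell1 α) :
    toCrossed γ ι (F * G) = toCrossed γ ι F * toCrossed γ ι G := by
  obtain ⟨p, σ, hσ, h⟩ := exists_faithful_pair hι h1 PairKind.unitary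
  apply hσ
  rw [map_mul σ, ← h, ← h, ← h, p.integrated_mul]

end Ell1

end ToCrossed

/-! ### Toeplitz matrices and the Poisson kernel. -/

section Toeplitz

variable {C : Type u} [CStarAlgebra C] {α : C →⋆ₐ[ℂ] C}

namespace Ell1

/-- The entries of the Toeplitz matrix of an element of `ℓ¹(ℤ₊, C, α)_l`. -/
def toeplitz (F : Ell1 α) (i j : ℕ) : C := if j ≤ i then (α ^ j) (F.coeff (i - j)) else 0

/-- The finite sections of the Toeplitz matrices of a matrix over `ℓ¹(ℤ₊, C, α)_l`. -/
def toeplitzMatrix {n : Type*} (N : ℕ) (M : Matrix n n (Ell1 α)) :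
    Matrix (n × Fin N) (n × Fin N) C :=
  Matrix.of fun s t => (M s.1 t.1).toeplitz s.2 t.2

variable {A : Type u} [NonUnitalCStarAlgebra A] {γ : A ≃⋆ₐ[ℂ] A} {ι : C →⋆ₙₐ[ℂ] A}

theorem zpow_apply_of_intertwine (hι : ∀ c, ι (α c) = γ (ι c)) (j : ℕ) (c : C) :
    (γ ^ (j : ℤ)) (ι c) = ι ((α ^ j) c) := by
  induction j with
  | zero => rfl
  | succ k ih =>
    rw [Nat.cast_succ, add_comm, FinConv.zpow_add_apply, ih, zpow_one, ← hι, pow_succ']; rfl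

/-- Toeplitz matrices are compressions of the regular representation. -/
theorem norm_toeplitzMatrix_le {n : Type*} [Fintype n] [DecidableEq n]
    (hι : ∀ c, ι (α c) = γ (ι c))
    (hinj : Function.Injective ι) (N : ℕ) (M : Matrix n n (Ell1 α)) :
    ‖CMat.mk (toeplitzMatrix (N + 1) M)‖ ≤ ‖CMat.mk (M.map (toCrossed γ ι))‖ := by
  obtain ⟨q, p, hp, hpp, hcomm, horth, hfaith⟩ := exists_regular_pair γ
  let κ : C →⋆ₙₐ[ℂ] (q.H →L[ℂ] q.H) :=
    { toFun := fun c => p * q.π (ι c)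
      map_smul' := fun r c => by simp only [map_smul, mul_smul_comm, MonoidHom.id_apply]
      map_zero' := by simp only [map_zero, mul_zero]
      map_add' := fun c d => by simp only [map_add, mul_add]
      map_mul' := fun c d => by
        change p * q.π (ι (c * d)) = p * q.π (ι c) * (p * q.π (ι d))
        rw [hcomm (ι c), mul_assoc, ← mul_assoc p, hpp, hcomm (ι d), ← mul_assoc, hcomm,
          map_mul, map_mul]
      map_star' := fun c => by rw [star_mul, hp, ← map_star, ← map_star, hcomm] }
  have hκ : Function.Injective κ := by
    rw [injective_iff_map_eq_zero]
    intro c hc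
    exact hinj ((hfaith _ hc).trans (map_zero ι).symm)
  have hx : ∀ i j : Fin (N + 1), (p * q.pow (-(i : ℤ))) * star (p * q.pow (-(j : ℤ))) =
      if i = j then p else 0 := by
    intro i j
    rw [star_mul, hp, q.star_pow, neg_neg, mul_assoc, ← mul_assoc (q.pow _), ← q.pow_add,
      ← mul_assoc]
    split_ifs with h
    · rw [h, neg_add_cancel, q.pow_zero, mul_one, hpp]
    · refine horth _ fun h0 => h (Fin.ext ?_)
      omega
  -- The operators `p U⁻ⁱ` have orthogonal translates, so of `Uⁿ π(ι cₙ)` only `p Uⁿ⁺ʲ⁻ⁱ p π(ι(αʲ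
  -- cₙ))` is left, which vanishes unless `n = i - j`.
  have key : ∀ (F : Ell1 α) (i j : ℕ), (p * q.pow (-(i : ℤ))) *
      Crossed.repHom γ q (toCrossed γ ι F) * star (p * q.pow (-(j : ℤ))) =
        κ (F.toeplitz i j) := by
    intro F i j
    have hs : Summable fun n : ℕ => Crossed.repHom γ q (Crossed.delta γ n (ι (F.coeff n))) :=
      (summable_toCrossed γ ι F).map (Crossed.repHom γ q) (CStarCompletion.continuous_hom _)
    rw [map_toCrossed, ← hs.tsum_mul_left, ← (hs.mul_left _).tsum_mul_right]
    have hterm : ∀ n : ℕ, (p * q.pow (-(i : ℤ))) *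
        Crossed.repHom γ q (Crossed.delta γ n (ι (F.coeff n))) * star (p * q.pow (-(j : ℤ))) =
        p * q.pow (n + j - i) * p * q.π (ι ((α ^ j) (F.coeff n))) := by
      intro n
      rw [Crossed.repHom_delta, star_mul, hp, q.star_pow, neg_neg]
      calc p * q.pow (-(i : ℤ)) * (q.pow n * q.π (ι (F.coeff n))) * (q.pow j * p)
          = p * (q.pow (-(i : ℤ)) * q.pow n) * (q.π (ι (F.coeff n)) * q.pow j) * p := by
            simp only [mul_assoc]
        _ = p * q.pow (n + j - i) * (q.π (ι ((α ^ j) (F.coeff n))) * p) := by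
            rw [q.pi_mul_pow, zpow_apply_of_intertwine hι,
              show (n : ℤ) + j - i = (-i + n) + j by ring, q.pow_add, q.pow_add]
            simp only [mul_assoc]
        _ = _ := by rw [← hcomm]; simp only [mul_assoc]
    -- For `i < j` the truncated difference is `0`; the term there vanishes as well, in accordance
    -- with the zero entry of the lower triangular Toeplitz matrix.
    rw [tsum_congr hterm, tsum_eq_single (i - j)]
    · rw [toeplitz]
      split_ifs with h
      · rw [show (((i - j : ℕ) : ℤ) + j - i) = 0 by omega, q.pow_zero, mul_one, hpp]; rfl
      · rw [horth _ (by omega), zero_mul, map_zero]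
    · intro m hm
      by_cases h0 : (m : ℤ) + j - i = 0
      · omega
      · rw [horth _ h0, zero_mul]
  calc ‖CMat.mk (toeplitzMatrix (N + 1) M)‖
      = ‖CMat.mk ((toeplitzMatrix (N + 1) M).map κ)‖ := (CMat.norm_map κ hκ _).symm
    _ = ‖CMat.mk (Matrix.of fun s t : n × Fin (N + 1) => (p * q.pow (-((s.2 : ℕ) : ℤ))) *
        ((M.map (toCrossed γ ι)).map (Crossed.repHom γ q)) s.1 t.1 *
          star (p * q.pow (-((t.2 : ℕ) : ℤ))))‖ := by
        congr 2
        ext1 s t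
        exact (key (M s.1 t.1) s.2 t.2).symm
    _ ≤ ‖CMat.mk ((M.map (toCrossed γ ι)).map (Crossed.repHom γ q))‖ :=
        CMat.norm_column_conj_le hp hpp (fun i : Fin (N + 1) => p * q.pow (-((i : ℕ) : ℤ))) hx _
    _ ≤ ‖CMat.mk (M.map (toCrossed γ ι))‖ := CMat.norm_map_le _ _

end Ell1

namespace LeftCovariantPair

variable {t : PairKind} (p : LeftCovariantPair α t)

theorem pi_mul_star (c : C) : star p.V * p.π c = p.π (α c) * star p.V := by
  have h := congrArg star (p.covariant (star c))
  rwa [star_mul, star_mul, ← map_star, star_star, ← map_star, ← map_star, star_star] at h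

theorem pi_pow_mul_star (j : ℕ) (c : C) :
    p.π ((α ^ j) c) * star p.V ^ j = star p.V ^ j * p.π c := by
  induction j with
  | zero => rw [pow_zero, pow_zero, one_mul, mul_one]; rfl
  | succ k ih =>
    have e : (α ^ (k + 1)) c = α ((α ^ k) c) := by rw [pow_succ']; rfl
    rw [e, pow_succ', ← mul_assoc, ← p.pi_mul_star, mul_assoc, ih, mul_assoc]

/-- The dilated Toeplitz sums. -/
theorem exists_row (N : ℕ) : ∃ X : ℕ → (p.H →L[ℂ] p.H),
    (‖∑ i : Fin (N + 1), X i * star (X i)‖ ≤ 1) ∧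
    ∀ F : Ell1 α, ∑ i : Fin (N + 1), ∑ j : Fin (N + 1), X i * p.π (F.toeplitz i j) * star (X j) =
      ∑ n ∈ Finset.range (N + 1), p.V ^ n * (1 - p.V ^ (N + 1 - n) * star p.V ^ (N + 1 - n)) *
        p.π (F.coeff n) := by
  have hV := p.kind.norm_le_one
  set W := p.V with hW
  have hP : 0 ≤ 1 - W * star W := by
    rw [sub_nonneg]
    have h1 : ‖W * star W‖ ≤ 1 := by
      rw [CStarRing.norm_self_mul_star]
      exact mul_le_one₀ hV (norm_nonneg _) hV
    exact CStarAlgebra.norm_le_one_iff_of_nonneg (W * star W) (mul_star_self_nonneg W) |>.1 h1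
  -- The defect operator. Covariance and its adjoint show that `W W*` commutes with `π(C)`, hence so
  -- does `D`. The row will be `Xᵢ = Wⁱ D`.
  set D := CFC.sqrt (1 - W * star W) with hD
  have hDD : D * D = 1 - W * star W := CFC.sqrt_mul_sqrt_self _ hP
  have hDs : star D = D := (IsSelfAdjoint.of_nonneg (CFC.sqrt_nonneg _)).star_eq
  have hcomm : ∀ c, p.π c * D = D * p.π c := by
    intro c
    have h0 : Commute (1 - W * star W) (p.π c) := by
      refine (Commute.one_left _).sub_left ?_
      change W * star W * p.π c = p.π c * (W * star W)
      rw [mul_assoc, hW, p.pi_mul_star, ← mul_assoc, ← p.covariant, mul_assoc]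
    exact (h0.cfcₙ_nnreal NNReal.sqrt).symm
  have hE : ∀ j, W ^ j * (1 - W * star W) * star W ^ j =
      W ^ j * star W ^ j - W ^ (j + 1) * star W ^ (j + 1) := by
    intro j
    rw [pow_succ W, pow_succ' (star W)]
    noncomm_ring
  -- This telescoping sum yields both the bound `∑ Xᵢ Xᵢ* ≤ 1` and the correction factor in the
  -- compressed Toeplitz sum.
  have htel : ∀ K, ∑ j ∈ Finset.range K, W ^ j * (1 - W * star W) * star W ^ j =
      1 - W ^ K * star W ^ K := by
    intro K
    simp_rw [hE]
    rw [Finset.sum_range_sub' (fun j => W ^ j * star W ^ j), pow_zero, pow_zero, one_mul]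
  have hterm : ∀ (c : C) (n j : ℕ), W ^ (n + j) * D * p.π ((α ^ j) c) * star (W ^ j * D) =
      W ^ n * (W ^ j * (1 - W * star W) * star W ^ j) * p.π c := by
    intro c n j
    rw [star_mul, hDs, star_pow, ← hDD]
    calc W ^ (n + j) * D * p.π ((α ^ j) c) * (D * star W ^ j)
        = W ^ (n + j) * D * (p.π ((α ^ j) c) * D) * star W ^ j := by simp only [mul_assoc]
      _ = W ^ (n + j) * D * D * (p.π ((α ^ j) c) * star W ^ j) := by
          rw [hcomm]; simp only [mul_assoc]
      _ = _ := by rw [hW, p.pi_pow_mul_star, _root_.pow_add]; simp only [mul_assoc]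
  refine ⟨fun i => W ^ i * D, ?_, fun F => ?_⟩
  · have e : ∑ i : Fin (N + 1), W ^ (i : ℕ) * D * star (W ^ (i : ℕ) * D) =
        1 - W ^ (N + 1) * star W ^ (N + 1) := by
      rw [← htel, ← Fin.sum_univ_eq_sum_range
        (fun j => W ^ j * (1 - W * star W) * star W ^ j)]
      refine Finset.sum_congr rfl fun i _ => ?_
      rw [star_mul, hDs, star_pow, ← hDD]
      simp only [mul_assoc]
    have h0 : 0 ≤ ∑ i : Fin (N + 1), W ^ (i : ℕ) * D * star (W ^ (i : ℕ) * D) :=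
      Finset.sum_nonneg fun i _ => mul_star_self_nonneg _
    refine (CStarAlgebra.norm_le_one_iff_of_nonneg _ h0).2 ?_
    rw [e, ← star_pow, sub_le_self_iff]
    exact mul_star_self_nonneg _
  · rw [Fin.sum_univ_eq_sum_range (fun i => ∑ j : Fin (N + 1), W ^ i * D *
      p.π (F.toeplitz i j) * star (W ^ (j : ℕ) * D))]
    have h1 : ∀ i ∈ Finset.range (N + 1), ∑ j : Fin (N + 1), W ^ i * D *
        p.π (F.toeplitz i j) * star (W ^ (j : ℕ) * D) = ∑ j ∈ Finset.range (i + 1),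
          W ^ i * D * p.π ((α ^ j) (F.coeff (i - j))) * star (W ^ j * D) := by
      intro i hi
      rw [Fin.sum_univ_eq_sum_range (fun j => W ^ i * D *
        p.π (F.toeplitz i j) * star (W ^ j * D))]
      rw [Finset.mem_range] at hi
      rw [← Finset.sum_subset (Finset.range_subset_range.2 (by omega : i + 1 ≤ N + 1))]
      · refine Finset.sum_congr rfl fun j hj => ?_
        rw [Finset.mem_range] at hj
        rw [Ell1.toeplitz, if_pos (by omega)]
      · intro j _ hj
        rw [Finset.mem_range] at hj
        rw [Ell1.toeplitz, if_neg (by omega), map_zero, mul_zero, zero_mul]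
    have h2 : ∀ n ∈ Finset.range (N + 1), W ^ n * (1 - W ^ (N + 1 - n) * star W ^ (N + 1 - n)) *
        p.π (F.coeff n) = ∑ j ∈ Finset.range (N + 1 - n),
          W ^ (n + j) * D * p.π ((α ^ j) (F.coeff n)) * star (W ^ j * D) := by
      intro n _
      simp_rw [hterm, ← htel, Finset.mul_sum, Finset.sum_mul]
    rw [Finset.sum_congr rfl h1, Finset.sum_congr rfl h2, Finset.sum_sigma', Finset.sum_sigma']
    -- The index pairs with `j ≤ i ≤ N` are regrouped by the degree `n = i - j`.
    refine Finset.sum_nbij' (fun x => ⟨x.1 - x.2, x.2⟩) (fun x => ⟨x.1 + x.2, x.2⟩) ?_ ?_ ?_ ?_ ?_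
    · rintro ⟨i, j⟩ h
      simp only [Finset.mem_sigma, Finset.mem_range] at h ⊢
      omega
    · rintro ⟨i, j⟩ h
      simp only [Finset.mem_sigma, Finset.mem_range] at h ⊢
      omega
    · rintro ⟨i, j⟩ h
      simp only [Finset.mem_sigma, Finset.mem_range] at h
      simp only [Sigma.mk.injEq, heq_eq_eq, and_true]
      omega
    · rintro ⟨i, j⟩ h
      simp
    · rintro ⟨i, j⟩ h
      simp only [Finset.mem_sigma, Finset.mem_range] at h
      dsimp only
      rw [Nat.sub_add_cancel (by omega)]

theorem norm_pow_le {r : ℝ} (hV : ‖p.V‖ ≤ r) (n : ℕ) : ‖p.V ^ n‖ ≤ r ^ n := by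
  induction n with
  | zero => rw [pow_zero, pow_zero]; exact ContinuousLinearMap.norm_id_le
  | succ k ih =>
    rw [pow_succ, pow_succ]
    exact (norm_mul_le _ _).trans (mul_le_mul ih hV (norm_nonneg _)
      (pow_nonneg ((norm_nonneg _).trans hV) _))

/-- The truncated sums converge to the integrated representation if the operator is a strict
contraction. -/
theorem tendsto_row {r : ℝ} (hV : ‖p.V‖ ≤ r) (hr : r < 1) (F : Ell1 α) :
    Tendsto (fun N => ∑ n ∈ Finset.range (N + 1),
      p.V ^ n * (1 - p.V ^ (N + 1 - n) * star p.V ^ (N + 1 - n)) * p.π (F.coeff n)) atTop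
      (𝓝 (p.integrated F)) := by
  have hr0 : 0 ≤ r := (norm_nonneg _).trans hV
  have h1 : Tendsto (fun N => ∑ n ∈ Finset.range (N + 1), p.V ^ n * p.π (F.coeff n)) atTop
      (𝓝 (p.integrated F)) :=
    (p.summable F).hasSum.tendsto_sum_nat.comp (tendsto_add_atTop_nat 1)
  have h2 : Tendsto (fun N => ∑ n ∈ Finset.range (N + 1),
      p.V ^ n * (p.V ^ (N + 1 - n) * star p.V ^ (N + 1 - n)) * p.π (F.coeff n)) atTop (𝓝 0) := by
    -- In the term of degree `n` the powers `Vⁿ` and `Vᴺ⁺¹⁻ⁿ` combine to `Vᴺ⁺¹`, whence the factor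
    -- `r^(N + 1)` uniformly in `n`.
    refine squeeze_zero_norm (a := fun N => r ^ (N + 1) * ∑' n, ‖F.coeff n‖) (fun N => ?_) ?_
    · calc _ ≤ ∑ n ∈ Finset.range (N + 1), r ^ (N + 1) * ‖F.coeff n‖ := by
            refine (norm_sum_le _ _).trans (Finset.sum_le_sum fun n hn => ?_)
            rw [Finset.mem_range] at hn
            rw [← mul_assoc, ← _root_.pow_add, Nat.add_sub_cancel' hn.le, ← star_pow]
            have hs : ‖star (p.V ^ (N + 1 - n))‖ ≤ 1 := by
              rw [norm_star]
              exact (p.norm_pow_le hV _).trans (pow_le_one₀ hr0 hr.le)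
            calc _ ≤ ‖p.V ^ (N + 1)‖ * ‖star (p.V ^ (N + 1 - n))‖ * ‖p.π (F.coeff n)‖ :=
                  (norm_mul_le _ _).trans
                    (mul_le_mul_of_nonneg_right (norm_mul_le _ _) (norm_nonneg _))
              _ ≤ r ^ (N + 1) * 1 * ‖F.coeff n‖ := by
                  gcongr
                  · exact p.norm_pow_le hV _
                  · exact NonUnitalStarAlgHom.norm_apply_le p.π _
              _ = _ := by rw [mul_one]
        _ = r ^ (N + 1) * ∑ n ∈ Finset.range (N + 1), ‖F.coeff n‖ := by rw [Finset.mul_sum]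
        _ ≤ _ := mul_le_mul_of_nonneg_left
            (F.summable.sum_le_tsum _ fun _ _ => norm_nonneg _) (pow_nonneg hr0 _)
    · have := ((tendsto_pow_atTop_nhds_zero_of_lt_one hr0 hr).comp
        (tendsto_add_atTop_nat 1)).mul_const (∑' n, ‖F.coeff n‖)
      rwa [zero_mul] at this
  have h3 := h1.sub h2
  rw [sub_zero] at h3
  refine h3.congr fun N => ?_
  rw [← Finset.sum_sub_distrib]
  exact Finset.sum_congr rfl fun n _ => by rw [mul_sub, mul_one, sub_mul]

variable {A : Type u} [NonUnitalCStarAlgebra A] {γ : A ≃⋆ₐ[ℂ] A} {ι : C →⋆ₙₐ[ℂ] A}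
  {n : Type*} [Fintype n] [DecidableEq n]

/-- The row of `exists_row` compresses the Toeplitz matrices, which the crossed product dominates,
to sums converging to `(V × π)(F)`. Strictness of the contraction is needed only for this
convergence. -/
theorem norm_map_integrated_le_of_lt (hι : ∀ c, ι (α c) = γ (ι c))
    (hinj : Function.Injective ι) (hV : ‖p.V‖ < 1) (M : Matrix n n (Ell1 α)) :
    ‖CMat.mk (M.map p.integrated)‖ ≤ ‖CMat.mk (M.map (Ell1.toCrossed γ ι))‖ := by
  have ht : Tendsto (fun N => CMat.mk (Matrix.of fun a b : n => ∑ n ∈ Finset.range (N + 1),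
      p.V ^ n * (1 - p.V ^ (N + 1 - n) * star p.V ^ (N + 1 - n)) * p.π ((M a b).coeff n))) atTop
      (𝓝 (CMat.mk (M.map p.integrated))) := by
    refine (CMat.continuous_mk.tendsto _).comp ?_
    exact tendsto_pi_nhds.2 fun a => tendsto_pi_nhds.2 fun b => p.tendsto_row le_rfl hV _
  refine le_of_tendsto ht.norm (Eventually.of_forall fun N => ?_)
  obtain ⟨X, hX, hsum⟩ := p.exists_row N
  calc _ = ‖CMat.mk (Matrix.of fun a b : n => ∑ i : Fin (N + 1), ∑ j : Fin (N + 1), X i *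
        ((Ell1.toeplitzMatrix (N + 1) M).map p.π) (a, i) (b, j) * star (X j))‖ := by
        congr 2
        ext1 a b
        exact (hsum (M a b)).symm
    _ ≤ ‖CMat.mk ((Ell1.toeplitzMatrix (N + 1) M).map p.π)‖ :=
        CMat.norm_row_conj_le (fun i : Fin (N + 1) => X i) hX _
    _ ≤ ‖CMat.mk (Ell1.toeplitzMatrix (N + 1) M)‖ := CMat.norm_map_le _ _
    _ ≤ _ := Ell1.norm_toeplitzMatrix_le hι hinj N M

/-- The pair with the operator multiplied by a number in `[0, 1]`. -/
def scale (r : ℝ) (hr : |r| ≤ 1) : LeftCovariantPair α PairKind.contractive where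
  H := p.H
  π := p.π
  V := (r : ℂ) • p.V
  kind := by
    change ‖(r : ℂ) • p.V‖ ≤ 1
    rw [norm_smul, Complex.norm_real]
    exact mul_le_one₀ hr (norm_nonneg _) p.kind.norm_le_one
  covariant c := by rw [mul_smul_comm, smul_mul_assoc, p.covariant]

theorem tendsto_scale (F : Ell1 α) :
    Tendsto (fun k : ℕ => ∑' n, ((1 - 1 / ((k : ℝ) + 1) : ℝ) : ℂ) ^ n •
      (p.V ^ n * p.π (F.coeff n))) atTop (𝓝 (p.integrated F)) := by
  refine tendsto_tsum_of_dominated_convergence (bound := fun n => ‖F.coeff n‖) F.summable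
    (fun n => ?_) (Eventually.of_forall fun k n => ?_)
  · have h : Tendsto (fun k : ℕ => ((1 - 1 / ((k : ℝ) + 1) : ℝ) : ℂ)) atTop (𝓝 ((1 - 0 : ℝ) : ℂ)) :=
      (Complex.continuous_ofReal.tendsto _).comp
        (tendsto_const_nhds.sub tendsto_one_div_add_atTop_nhds_zero_nat)
    have h' := (h.pow n).smul_const (p.V ^ n * p.π (F.coeff n))
    simpa using h'
  · rw [norm_smul, norm_pow, Complex.norm_real]
    refine (mul_le_of_le_one_left (norm_nonneg _) (pow_le_one₀ (norm_nonneg _) ?_)).trans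
      (p.norm_pow_mul_le n _)
    have h1 : 0 < 1 / ((k : ℝ) + 1) := by positivity
    have h2 : 1 / ((k : ℝ) + 1) ≤ 1 := by
      rw [div_le_one (by positivity)]
      linarith [(Nat.cast_nonneg k : (0 : ℝ) ≤ k)]
    rw [Real.norm_eq_abs, abs_le]
    constructor <;> linarith

/-- The regular representation of the crossed product dominates all covariant pairs. -/
theorem norm_map_integrated_le (hι : ∀ c, ι (α c) = γ (ι c))
    (hinj : Function.Injective ι) (M : Matrix n n (Ell1 α)) :
    ‖CMat.mk (M.map p.integrated)‖ ≤ ‖CMat.mk (M.map (Ell1.toCrossed γ ι))‖ := by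
  -- The factors `1 - 1/(k + 1)` lie in `[0, 1)`, so that the scaled operators are strict
  -- contractions, and they tend to `1`.
  have ht : Tendsto (fun k : ℕ => CMat.mk (Matrix.of fun a b : n => ∑' n,
      ((1 - 1 / ((k : ℝ) + 1) : ℝ) : ℂ) ^ n • (p.V ^ n * p.π ((M a b).coeff n)))) atTop
      (𝓝 (CMat.mk (M.map p.integrated))) := by
    refine (CMat.continuous_mk.tendsto _).comp ?_
    exact tendsto_pi_nhds.2 fun a => tendsto_pi_nhds.2 fun b => p.tendsto_scale _
  refine le_of_tendsto ht.norm (Eventually.of_forall fun k => ?_)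
  have h1 : 0 < 1 / ((k : ℝ) + 1) := by positivity
  have h2 : 1 / ((k : ℝ) + 1) ≤ 1 := by
    rw [div_le_one (by positivity)]
    linarith [(Nat.cast_nonneg k : (0 : ℝ) ≤ k)]
  have habs : |1 - 1 / ((k : ℝ) + 1)| < 1 := by
    rw [abs_lt]
    constructor <;> linarith
  refine le_trans (le_of_eq ?_)
    ((p.scale (1 - 1 / ((k : ℝ) + 1)) habs.le).norm_map_integrated_le_of_lt hι hinj ?_ M)
  · congr 2
    ext1 a b
    refine tsum_congr fun n => ?_
    change _ = ((((1 - 1 / ((k : ℝ) + 1) : ℝ) : ℂ) • p.V) ^ n) * p.π _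
    rw [smul_pow, smul_mul_assoc]
  · change ‖((1 - 1 / ((k : ℝ) + 1) : ℝ) : ℂ) • p.V‖ < 1
    rw [norm_smul, Complex.norm_real]
    exact mul_lt_one_of_nonneg_of_lt_one_left (norm_nonneg _) habs p.kind.norm_le_one

end LeftCovariantPair

end Toeplitz

/-! ### Semicrossed products inside the crossed product. -/

theorem CMat.norm_diagonal {D : Type u} [NonUnitalCStarAlgebra D] {n : Type v} [Fintype n]
    [DecidableEq n] [Nonempty n] (d : D) : ‖CMat.mk (Matrix.diagonal fun _ : n => d)‖ = ‖d‖ := by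
  rw [← CMat.diagHom_apply]
  refine NonUnitalStarAlgHom.norm_map (A := D) (B := CMat n D) (CMat.diagHom n D)
    (fun a b h => ?_) d
  obtain ⟨i⟩ := ‹Nonempty n›
  have h' : Matrix.diagonal (fun _ : n => a) i i = Matrix.diagonal (fun _ : n => b) i i :=
    congrArg (fun M : CMat n D => M.entries i i) h
  simpa using h'

section SemicrossedToCrossed

variable {C : Type u} [CStarAlgebra C] {α : C →⋆ₐ[ℂ] C} {A : Type u} [NonUnitalCStarAlgebra A]
  {γ : A ≃⋆ₐ[ℂ] A} {ι : C →⋆ₙₐ[ℂ] A} {t : PairKind}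

namespace Semicrossed

theorem induction_on {P : Semicrossed α t → Prop} (x : Semicrossed α t) (hP : IsClosed {x | P x})
    (h : ∀ F, P (of α t F)) : P x :=
  Completion.induction_on x hP h

theorem induction_on₂ {P : Semicrossed α t → Semicrossed α t → Prop} (x y : Semicrossed α t)
    (hP : IsClosed {x : Semicrossed α t × Semicrossed α t | P x.1 x.2})
    (h : ∀ F G, P (of α t F) (of α t G)) : P x y :=
  Completion.induction_on₂ x y hP h

theorem denseRange_of : DenseRange (of α t) :=
  Completion.denseRange_coe (α := SemiEll1 α t)

theorem of_add (F G : Ell1 α) : of α t (F + G) = of α t F + of α t G := Completion.coe_add _ _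

theorem of_smul (r : ℂ) (F : Ell1 α) : of α t (r • F) = r • of α t F :=
  Completion.coe_smul r (SemiEll1.mk F : SemiEll1 α t)

theorem of_zero : of α t 0 = 0 := Completion.coe_zero

theorem of_mul (F G : Ell1 α) : of α t (F * G) = of α t F * of α t G := Completion.coe_mul _ _

theorem of_one : of α t 1 = 1 := Completion.coe_one _

theorem norm_of (F : Ell1 α) : ‖of α t F‖ = ⨆ p : LeftCovariantPair α t, ‖p.integrated F‖ :=
  Completion.norm_coe (SemiEll1.mk F : SemiEll1 α t)

theorem norm_integrated_le_norm_of (p : LeftCovariantPair α t) (F : Ell1 α) :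
    ‖p.integrated F‖ ≤ ‖of α t F‖ := by
  rw [norm_of]
  exact le_ciSup (SemiEll1.bddAbove (SemiEll1.mk F : SemiEll1 α t)) p

/-- The upper bound is the Poisson kernel estimate, read on one-by-one matrices; the lower bound
comes from a faithful pair. The right side does not involve the kind `t`. -/
theorem norm_of_eq (hι : ∀ c, ι (α c) = γ (ι c)) (h1 : ∀ a, ι 1 * a = a)
    (hinj : Function.Injective ι) (F : Ell1 α) : ‖of α t F‖ = ‖Ell1.toCrossed γ ι F‖ := by
  apply le_antisymm
  · rw [norm_of]
    refine Real.iSup_le (fun p => ?_) (norm_nonneg _)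
    have h := p.norm_map_integrated_le hι hinj (Matrix.diagonal fun _ : Unit => F)
    rwa [Matrix.diagonal_map (map_zero _), Matrix.diagonal_map (map_zero _), CMat.norm_diagonal,
      CMat.norm_diagonal] at h
  · obtain ⟨p, σ, hσ, h⟩ := Ell1.exists_faithful_pair hι h1 t
    rw [← NonUnitalStarAlgHom.norm_map σ hσ, ← h]
    exact norm_integrated_le_norm_of p F

/-- The embedding of a semicrossed product into a crossed product. -/
theorem exists_toCrossed (hι : ∀ c, ι (α c) = γ (ι c)) (h1 : ∀ a, ι 1 * a = a)
    (hinj : Function.Injective ι) (t : PairKind) : ∃ j : Semicrossed α t →ₙₐ[ℂ] Crossed γ,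
      (∀ F, j (of α t F) = Ell1.toCrossed γ ι F) ∧ ∀ x, ‖j x‖ = ‖x‖ := by
  let L : SemiEll1 α t →L[ℂ] Crossed γ :=
    LinearMap.mkContinuous (Ell1.toCrossed γ ι : Ell1 α →ₗ[ℂ] Crossed γ) 1 fun F => by
      rw [one_mul]
      exact (norm_of_eq (t := t) hι h1 hinj F).symm.le.trans (Completion.norm_coe F).le
  have hc : Continuous (Completion.extension L) := Completion.continuous_extension
  have hof : ∀ F, Completion.extension L (of α t F) = Ell1.toCrossed γ ι F := fun F =>
    Completion.extension_coe L.uniformContinuous _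
  refine ⟨{ toFun := Completion.extension L
            map_smul' := fun r x => ?_
            map_zero' := by rw [← of_zero (α := α) (t := t), hof, map_zero]
            map_add' := fun x y => ?_
            map_mul' := fun x y => ?_ }, hof, fun x => ?_⟩
  · induction x using induction_on with
    | hP => exact isClosed_eq (hc.comp (continuous_const_smul r)) (hc.const_smul r)
    | h F => rw [← of_smul, hof, hof, map_smul]; rfl
  · induction x, y using induction_on₂ with
    | hP =>
      exact isClosed_eq (hc.comp continuous_add)
        ((hc.comp continuous_fst).add (hc.comp continuous_snd))
    | h F G => rw [← of_add, hof, hof, hof, map_add]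
  · induction x, y using induction_on₂ with
    | hP =>
      exact isClosed_eq (hc.comp continuous_mul)
        ((hc.comp continuous_fst).mul (hc.comp continuous_snd))
    | h F G => rw [← of_mul, hof, hof, hof, Ell1.toCrossed_mul hι h1]
  · induction x using induction_on with
    | hP => exact isClosed_eq hc.norm continuous_norm
    | h F => exact (congrArg norm (hof F)).trans (norm_of_eq hι h1 hinj F).symm

variable {j : Semicrossed α t →ₙₐ[ℂ] Crossed γ}

theorem isometry_of_norm_eq (hj : ∀ x, ‖j x‖ = ‖x‖) : Isometry j :=
  AddMonoidHomClass.isometry_of_norm j hj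

/-- The matrix norms of a semicrossed product are those of the crossed product. -/
theorem norms_eq (hι : ∀ c, ι (α c) = γ (ι c)) (h1 : ∀ a, ι 1 * a = a)
    (hinj : Function.Injective ι) (hof : ∀ F, j (of α t F) = Ell1.toCrossed γ ι F)
    (hj : ∀ x, ‖j x‖ = ‖x‖) {ν : ℕ} (M : Matrix (Fin ν) (Fin ν) (Semicrossed α t)) :
    norms α t ν M = cstarNorms (Crossed γ) ν (M.map j) := by
  have hjc : Continuous j := (isometry_of_norm_eq hj).continuous
  have hle : ∀ p : LeftCovariantPair α t,
      ‖CMat.mk (M.map p.extended)‖ ≤ ‖CMat.mk (M.map j)‖ := by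
    intro p
    have hpc : Continuous p.extended := Completion.continuous_extension
    have hd : DenseRange fun N : Fin ν → Fin ν → Ell1 α => fun a b => of α t (N a b) :=
      DenseRange.piMap fun _ => DenseRange.piMap fun _ => denseRange_of
    refine hd.induction_on (p := fun M : Fin ν → Fin ν → Semicrossed α t =>
      ‖CMat.mk (Matrix.map (Matrix.of M) p.extended)‖ ≤ ‖CMat.mk (Matrix.map (Matrix.of M) j)‖)
      M ?_ ?_
    · refine isClosed_le ?_ ?_
      · refine (CMat.continuous_mk.comp (continuous_pi fun a => continuous_pi fun b => ?_)).norm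
        exact hpc.comp (continuous_apply_apply a b)
      · refine (CMat.continuous_mk.comp (continuous_pi fun a => continuous_pi fun b => ?_)).norm
        exact hjc.comp (continuous_apply_apply a b)
    · intro N
      have h := p.norm_map_integrated_le hι hinj (Matrix.of N)
      have e1 : Matrix.map (Matrix.of fun a b => of α t (N a b)) p.extended =
          (Matrix.of N).map p.integrated := by
        ext1 a b
        exact p.extended_of _
      have e2 : Matrix.map (Matrix.of fun a b => of α t (N a b)) j =
          (Matrix.of N).map (Ell1.toCrossed γ ι) := by
        ext1 a b
        exact hof _
      rwa [e1, e2]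
  apply le_antisymm
  · exact Real.iSup_le hle (norm_nonneg (CMat.mk (M.map j)))
  -- For the pair of a faithful `σ` the extended representation is `σ ∘ j`, so this pair attains the
  -- supremum.
  · obtain ⟨p, σ, hσ, h⟩ := Ell1.exists_faithful_pair hι h1 t
    have he : ∀ x, p.extended x = σ (j x) := by
      intro x
      induction x using induction_on with
      | hP =>
        exact isClosed_eq Completion.continuous_extension
          ((CStarCompletion.continuous_hom σ).comp hjc)
      | h F => rw [p.extended_of, hof, h]
    have e : M.map p.extended = (M.map j).map σ := by
      ext1 a b
      exact he _
    refine le_trans (le_of_eq ?_) (le_ciSup (f := fun p : LeftCovariantPair α t =>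
      cstarNorms (p.H →L[ℂ] p.H) ν (M.map p.extended)) ⟨_, Set.forall_mem_range.2 hle⟩ p)
    simp only [CMat.cstarNorms_eq]
    rw [e, CMat.norm_map σ hσ]

/-- The semicrossed products for the four kinds of covariant pairs agree. -/
theorem exists_algEquiv (hι : ∀ c, ι (α c) = γ (ι c)) (h1 : ∀ a, ι 1 * a = a)
    (hinj : Function.Injective ι) (s t : PairKind) :
    ∃ Φ : Semicrossed α s ≃ₐ[ℂ] Semicrossed α t,
      IsCompletelyIsometric (norms α s) (norms α t) Φ ∧ ∀ F, Φ (of α s F) = of α t F := by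
  have key : ∀ s t : PairKind, ∀ (i : Semicrossed α s →ₙₐ[ℂ] Crossed γ)
      (j : Semicrossed α t →ₙₐ[ℂ] Crossed γ), (∀ F, i (of α s F) = Ell1.toCrossed γ ι F) →
      (∀ F, j (of α t F) = Ell1.toCrossed γ ι F) → (∀ x, ‖i x‖ = ‖x‖) → (∀ x, ‖j x‖ = ‖x‖) →
      ∃ Φ : Semicrossed α s →ₐ[ℂ] Semicrossed α t, ∀ x, j (Φ x) = i x := by
    intro s t i j hi hj hi' hj'
    have hiso := isometry_of_norm_eq hj'
    have hinj' : Function.Injective j := hiso.injective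
    -- The range of the isometry `j` is closed and contains the image of `ℓ¹`, which is dense in the
    -- range of `i`.
    have hex : ∀ x, ∃ y, j y = i x := by
      intro x
      induction x using induction_on with
      | hP =>
        exact hiso.isClosedEmbedding.isClosed_range.preimage
          (isometry_of_norm_eq hi').continuous
      | h F => exact ⟨of α t F, by rw [hi, hj]⟩
    choose Φ hΦ using hex
    let L : Semicrossed α s →ₗ[ℂ] Semicrossed α t :=
      { toFun := Φ
        map_add' := fun x y => hinj' (by simp only [hΦ, map_add])
        map_smul' := fun r x => hinj' (by simp only [hΦ, map_smul, RingHom.id_apply]) }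
    refine ⟨AlgHom.ofLinearMap L (hinj' ?_) fun x y => hinj' ?_, hΦ⟩
    · rw [← of_one, ← of_one, hj, ← hi]
      exact hΦ _
    · change j (Φ (x * y)) = j (Φ x * Φ y)
      rw [map_mul j, hΦ, hΦ, hΦ, map_mul i]
  obtain ⟨i, hi, hi'⟩ := exists_toCrossed hι h1 hinj s
  obtain ⟨j, hj, hj'⟩ := exists_toCrossed hι h1 hinj t
  have hii := (isometry_of_norm_eq hi').injective
  have hjj := (isometry_of_norm_eq hj').injective
  obtain ⟨Φ, hΦ⟩ := key s t i j hi hj hi' hj'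
  obtain ⟨Ψ, hΨ⟩ := key t s j i hj hi hj' hi'
  refine ⟨AlgEquiv.ofAlgHom Φ Ψ (AlgHom.ext fun x => hjj ?_) (AlgHom.ext fun x => hii ?_),
    fun ν M => ?_, fun F => hjj ?_⟩
  · exact (hΦ _).trans (hΨ _)
  · exact (hΨ _).trans (hΦ _)
  · rw [norms_eq hι h1 hinj hj hj', norms_eq hι h1 hinj hi hi']
    congr 1
    ext1 a b
    exact hΦ _
  · exact (hΦ _).trans ((hi F).trans (hj F).symm)

end Semicrossed

end SemicrossedToCrossed

/-! ### GNS seminorms and contractive homomorphisms. -/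

section StateSeminorm

/-- A contractive positive functional `f` with its GNS seminorm `q`. -/
structure StateSeminorm (D : Type u) [NonUnitalCStarAlgebra D] where
  f : D →ₗ[ℂ] ℂ
  q : Seminorm ℂ D
  norm_le : ∀ x, ‖f x‖ ≤ ‖x‖
  sq_eq : ∀ x, f (star x * x) = ((q x ^ 2 : ℝ) : ℂ)
  mul_le : ∀ x y, q (x * y) ≤ ‖x‖ * q y
  isometric : ∀ v x, ‖v‖ ≤ 1 → q (v * x) = q x → q (star v * (v * x) - x) = 0

namespace StateSeminorm

variable {D : Type u} [NonUnitalCStarAlgebra D]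

theorem q_le_norm (s : StateSeminorm D) (x : D) : s.q x ≤ ‖x‖ := by
  refine abs_le_of_sq_le_sq' ?_ (norm_nonneg x) |>.2
  have h := s.norm_le (star x * x)
  rwa [s.sq_eq, Complex.norm_real, CStarRing.norm_star_mul_self, Real.norm_of_nonneg (sq_nonneg _),
    ← sq] at h

theorem sum_sq {κ : Type*} [Fintype κ] (s : StateSeminorm D) (x : κ → D) :
    s.f (∑ i, star (x i) * x i) = ((∑ i, s.q (x i) ^ 2 : ℝ) : ℂ) := by
  rw [map_sum, Complex.ofReal_sum]
  exact Finset.sum_congr rfl fun i _ => s.sq_eq _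

theorem sum_sq_le {κ : Type*} [Fintype κ] (s : StateSeminorm D) (x : κ → D) :
    ∑ i, s.q (x i) ^ 2 ≤ ‖∑ i, star (x i) * x i‖ := by
  have h := s.norm_le (∑ i, star (x i) * x i)
  rwa [sum_sq, Complex.norm_real,
    Real.norm_of_nonneg (Finset.sum_nonneg fun _ _ => sq_nonneg _)] at h

open scoped ComplexOrder in
theorem exists_sum_sq_eq {κ : Type*} [Fintype κ] (x : κ → D) :
    ∃ s : StateSeminorm D, ∑ i, s.q (x i) ^ 2 = ‖∑ i, star (x i) * x i‖ := by
  let _ := CStarAlgebra.spectralOrder D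
  let _ := CStarAlgebra.spectralOrderedRing D
  obtain ⟨f, hf, hfx⟩ := exists_state (∑ i, star (x i) * x i)
    (Finset.sum_nonneg fun i _ => star_mul_self_nonneg _)
  let q : Seminorm ℂ D := (normSeminorm ℂ f.PreGNS).comp (f.toPreGNS : D →ₗ[ℂ] f.PreGNS)
  have hq : ∀ x, q x = ‖f.toPreGNS x‖ := fun _ => rfl
  have hsq : ∀ x, f (star x * x) = ((q x ^ 2 : ℝ) : ℂ) := fun x => by
    rw [hq, Complex.ofReal_pow, f.preGNS_norm_sq]; rfl
  have hmul : ∀ x y, q (x * y) ≤ ‖x‖ * q y := fun x y => by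
    refine ((f.leftMulMapPreGNS x).le_opNorm (f.toPreGNS y)).trans
      (mul_le_mul_of_nonneg_right ?_ (norm_nonneg _))
    exact LinearMap.mkContinuous_norm_le _ (norm_nonneg _) _
  let s : StateSeminorm D :=
    { f := f.toLinearMap
      q := q
      norm_le := hf
      sq_eq := hsq
      mul_le := hmul
      -- Expanding the square gives `q(v* v x - x)² = q(v* v x)² - 2 q(v x)² + q(x)²`, which is at
      -- most zero when `q(v x) = q(x)` and `v` is a contraction.
      isometric := fun v x hv hx => by
        have h1 : f (star (star v * (v * x) - x) * (star v * (v * x) - x)) =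
            ((q (star v * (v * x)) ^ 2 - 2 * q (v * x) ^ 2 + q x ^ 2 : ℝ) : ℂ) := by
          push_cast
          have e1 := hsq (star v * (v * x))
          have e2 := hsq (v * x)
          have e3 := hsq x
          push_cast at e1 e2 e3
          rw [← e1, ← e2, ← e3, star_sub, sub_mul, mul_sub, mul_sub, map_sub, map_sub, map_sub]
          have e4 : star (star v * (v * x)) * x = star (v * x) * (v * x) := by
            simp only [star_mul, star_star, mul_assoc]
          have e5 : star x * (star v * (v * x)) = star (v * x) * (v * x) := by
            simp only [star_mul, mul_assoc]
          rw [e4, e5]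
          ring
        rw [hsq, Complex.ofReal_inj, hx] at h1
        have h2 : q (star v * (v * x)) ≤ q x := by
          refine (hmul _ _).trans ?_
          rw [hx, norm_star]
          exact mul_le_of_le_one_left (apply_nonneg q x) hv
        have h3 : q (star v * (v * x)) ^ 2 ≤ q x ^ 2 := by
          gcongr
        exact pow_eq_zero_iff two_ne_zero |>.1 (le_antisymm (by linarith) (sq_nonneg _)) }
  refine ⟨s, ?_⟩
  have h := s.sum_sq x
  rw [← Complex.ofReal_inj, ← h]
  exact hfx

theorem exists_eq_norm (x : D) : ∃ s : StateSeminorm D, s.q x = ‖x‖ := by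
  obtain ⟨s, hs⟩ := exists_sum_sq_eq fun _ : Unit => x
  refine ⟨s, ?_⟩
  simp only [Finset.univ_unique, Finset.sum_const, Finset.card_singleton, one_smul,
    CStarRing.norm_star_mul_self, ← sq] at hs
  exact (sq_eq_sq₀ (apply_nonneg s.q x) (norm_nonneg x)).1 hs

end StateSeminorm

variable {D : Type u} [NonUnitalCStarAlgebra D]

/-- Since `w` can restore `x` from `v x`, both being contractions, `v` preserves the length of `x`
for every GNS seminorm. It then suffices to look at a seminorm that norms the difference. -/
theorem star_mul_mul_self_of_contractive {v w x : D} (hv : ‖v‖ ≤ 1) (hw : ‖w‖ ≤ 1)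
    (h : w * (v * x) = x) : star v * (v * x) = x := by
  obtain ⟨s, hs⟩ := StateSeminorm.exists_eq_norm (star v * (v * x) - x)
  rw [← sub_eq_zero, ← norm_eq_zero, ← hs]
  refine s.isometric v x hv (le_antisymm ?_ ?_)
  · exact (s.mul_le _ _).trans (mul_le_of_le_one_left (apply_nonneg s.q x) hv)
  · calc s.q x = s.q (w * (v * x)) := by rw [h]
      _ ≤ ‖w‖ * s.q (v * x) := s.mul_le _ _
      _ ≤ s.q (v * x) := mul_le_of_le_one_left (apply_nonneg s.q _) hw

/-- Contractive homomorphisms of a unital `C*`-algebra are `*`-preserving. -/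
theorem map_star_of_contractive {C : Type v} [CStarAlgebra C] (ρ : C →ₙₐ[ℂ] D)
    (hρ : ∀ c, ‖ρ c‖ ≤ ‖c‖) (c : C) : ρ (star c) = star (ρ c) := by
  have hu : ∀ u : unitary C, ‖ρ u‖ ≤ 1 := fun u =>
    (hρ u).trans (by
      rcases subsingleton_or_nontrivial C with h | h
      · rw [Subsingleton.elim (u : C) 0, norm_zero]; exact zero_le_one
      · exact (CStarRing.norm_coe_unitary u).le)
  -- A contractive idempotent `e` satisfies `e* e = e` and is therefore self-adjoint.
  have h1 : star (ρ 1) = ρ 1 := by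
    have hee : ρ 1 * ρ 1 = ρ 1 := by rw [← map_mul, one_mul]
    have h := star_mul_mul_self_of_contractive (v := ρ 1) (w := ρ 1) (x := ρ 1)
      (hu 1) (hu 1) (by rw [hee, hee])
    rw [hee] at h
    have h' := congrArg star h
    rw [star_mul, star_star, h] at h'
    exact h'.symm
  -- Both `ρ(u)` and `ρ(u*)` are contractions, and they are inverse to each other up to `ρ(1)`.
  -- Hence `ρ(u)* ρ(u) = ρ(1)`, and multiplication by `ρ(u*)` gives the claim. Unitaries span `C`.
  have hun : ∀ u : unitary C, ρ (star (u : C)) = star (ρ u) := fun u => by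
    have h := star_mul_mul_self_of_contractive (v := ρ u) (w := ρ (star (u : C))) (x := ρ 1)
      (hu u) (hu (star u)) (by rw [← map_mul, ← map_mul, mul_one, Unitary.coe_star_mul_self])
    rw [← map_mul, mul_one] at h
    calc ρ (star (u : C)) = ρ 1 * ρ (star (u : C)) := by rw [← map_mul, one_mul]
      _ = star (ρ u) * (ρ u * ρ (star (u : C))) := by rw [← h, mul_assoc]
      _ = star (ρ u) * star (ρ 1) := by
          rw [← map_mul, ← Unitary.coe_star, Unitary.coe_mul_star_self, h1]
      _ = star (ρ u) := by rw [← star_mul, ← map_mul, one_mul]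
  have hmem : c ∈ Submodule.span ℂ (unitary C : Set C) := by
    rw [CStarAlgebra.span_unitary]; trivial
  induction hmem using Submodule.span_induction with
  | mem x hx => exact hun ⟨x, hx⟩
  | zero => rw [star_zero, map_zero, star_zero]
  | add x y _ _ hx hy => rw [star_add, map_add, map_add, star_add, hx, hy]
  | smul r x _ hx => rw [star_smul, map_smul, map_smul, star_smul, hx]

/-- The image of a `*`-homomorphism of `C*`-algebras is closed. -/
theorem isClosed_range_nonUnital {D' : Type v} [NonUnitalCStarAlgebra D'] (f : D →⋆ₙₐ[ℂ] D') :
    IsClosed (Set.range f) := by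
  have h := (isClosed_range (Unitization.starMap f)).preimage
    (Unitization.isometry_inr (𝕜 := ℂ) (A := D')).continuous
  convert h using 1
  ext y
  constructor
  · rintro ⟨x, rfl⟩
    exact ⟨(x : Unitization ℂ D), Unitization.starMap_inr f x⟩
  · rintro ⟨x, hx⟩
    refine ⟨x.snd, ?_⟩
    simpa [Unitization.algebraMap_eq_inl] using congrArg (fun z => z.snd) hx

end StateSeminorm

/-! ### Functionals for which the generator acts isometrically. -/

section Envelope

variable {C : Type u} [CStarAlgebra C] {α : C →⋆ₐ[ℂ] C}

namespace Ell1

theorem delta_mul_delta (n m : ℕ) (c d : C) :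
    delta α n c * delta α m d = delta α (n + m) ((α ^ m) c * d) := by
  refine ext fun k => ?_
  rw [coeff_mul, coeff_delta]
  split_ifs with hk
  · rw [Finset.sum_eq_single (n, m)]
    · rw [coeff_delta, if_pos rfl, coeff_delta, if_pos rfl]
    · rintro ⟨i, l⟩ hp hne
      rw [coeff_delta, coeff_delta]
      by_cases hi : i = n
      · have hl : l ≠ m := fun hl => hne (by rw [hi, hl])
        simp only [if_neg hl, mul_zero]
      · simp only [if_neg hi, map_zero, zero_mul]
    · intro h
      exact absurd (Finset.HasAntidiagonal.mem_antidiagonal.2 hk.symm) h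
  · refine Finset.sum_eq_zero fun p hp => ?_
    have := Finset.HasAntidiagonal.mem_antidiagonal.1 hp
    rw [coeff_delta, coeff_delta]
    by_cases hi : p.1 = n
    · have hl : p.2 ≠ m := fun hl => hk (by rw [← this, hi, hl])
      rw [if_neg hl, mul_zero]
    · rw [if_neg hi, map_zero, zero_mul]

theorem delta_add (n : ℕ) (c d : C) : delta α n (c + d) = delta α n c + delta α n d :=
  ext fun k => by
    rw [coeff_add, coeff_delta, coeff_delta, coeff_delta]
    split_ifs <;> simp

theorem delta_smul (n : ℕ) (r : ℂ) (c : C) : delta α n (r • c) = r • delta α n c :=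
  ext fun k => by
    rw [coeff_smul, coeff_delta, coeff_delta]
    split_ifs <;> simp

end Ell1

namespace Semicrossed

/-- The element `δₙ ⊗ c` of a semicrossed product. -/
def delta (α : C →⋆ₐ[ℂ] C) (t : PairKind) (n : ℕ) (c : C) : Semicrossed α t :=
  of α t (Ell1.delta α n c)

variable {t : PairKind}

theorem delta_mul_delta (n m : ℕ) (c d : C) :
    delta α t n c * delta α t m d = delta α t (n + m) ((α ^ m) c * d) := by
  rw [delta, delta, ← of_mul, Ell1.delta_mul_delta]; rfl

theorem delta_eq_mul (l : ℕ) (c : C) : delta α t l c = delta α t l 1 * delta α t 0 c := by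
  rw [delta_mul_delta, add_zero, pow_zero]
  congr 1
  exact (one_mul c).symm

theorem delta_zero_one : delta α t 0 1 = 1 := of_one

/-- The span of the elements `δₘ ⊗ c` with `m ≥ l`. -/
def tailSpan (α : C →⋆ₐ[ℂ] C) (t : PairKind) (l : ℕ) : Submodule ℂ (Semicrossed α t) :=
  Submodule.span ℂ {x | ∃ m c, l ≤ m ∧ x = delta α t m c}

theorem delta_mem_tailSpan {l m : ℕ} (h : l ≤ m) (c : C) : delta α t m c ∈ tailSpan α t l :=
  Submodule.subset_span ⟨m, c, h, rfl⟩

theorem tailSpan_anti {l l' : ℕ} (h : l ≤ l') : tailSpan α t l' ≤ tailSpan α t l := by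
  refine Submodule.span_mono ?_
  rintro _ ⟨m, c, hm, rfl⟩
  exact ⟨m, c, h.trans hm, rfl⟩

theorem delta_mul_mem_tailSpan {l : ℕ} (n : ℕ) (d : C) {a : Semicrossed α t}
    (ha : a ∈ tailSpan α t l) : delta α t n d * a ∈ tailSpan α t l := by
  induction ha using Submodule.span_induction with
  | mem x hx =>
    obtain ⟨m, c, hm, rfl⟩ := hx
    rw [delta_mul_delta]
    exact delta_mem_tailSpan (by omega) _
  | zero => rw [mul_zero]; exact zero_mem _
  | add x y _ _ hx hy => rw [mul_add]; exact add_mem hx hy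
  | smul r x _ hx => rw [mul_smul_comm]; exact Submodule.smul_mem _ r hx

end Semicrossed

theorem norm_one_le (C : Type u) [CStarAlgebra C] : ‖(1 : C)‖ ≤ 1 := by
  rcases subsingleton_or_nontrivial C with h | h
  · rw [Subsingleton.elim (1 : C) 0, norm_zero]; exact zero_le_one
  · exact CStarRing.norm_one.le

/-- Finitely many elements of a unital `C*`-algebra can be completed by one element to a column
whose square is scalar. -/
theorem exists_column_completion {κ : Type*} [Fintype κ] (c : κ → C) :
    ∃ (K : ℝ) (c₀ : C), 0 ≤ K ∧ ∑ i, star (c i) * c i + star c₀ * c₀ = (K : ℂ) • 1 := by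
  let _ := CStarAlgebra.spectralOrder C
  let _ := CStarAlgebra.spectralOrderedRing C
  set b := ∑ i, star (c i) * c i with hb
  have hb0 : 0 ≤ b := Finset.sum_nonneg fun i _ => star_mul_self_nonneg _
  have hle : b ≤ algebraMap ℝ C ‖b‖ := (IsSelfAdjoint.of_nonneg hb0).le_algebraMap_norm_self
  refine ⟨‖b‖, CFC.sqrt (algebraMap ℝ C ‖b‖ - b), norm_nonneg _, ?_⟩
  rw [(IsSelfAdjoint.of_nonneg (CFC.sqrt_nonneg _)).star_eq,
    CFC.sqrt_mul_sqrt_self _ (sub_nonneg.2 hle), add_sub_cancel, Algebra.algebraMap_eq_smul_one,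
    Complex.coe_smul]

/-- Applying the functional to the scalar identity fixes the total squared length of the
coefficients; this is the reason for completing the column. -/
theorem StateSeminorm.sum_sq_completion {E : Type v} [NonUnitalCStarAlgebra E]
    (s : StateSeminorm E) (ρ : C →⋆ₙₐ[ℂ] E) {κ : Type*} [Fintype κ] {c : κ → C} {K : ℝ} {c₀ : C}
    (h : ∑ i, star (c i) * c i + star c₀ * c₀ = (K : ℂ) • 1) :
    ∑ i, s.q (ρ (c i)) ^ 2 + s.q (ρ c₀) ^ 2 = K * s.q (ρ 1) ^ 2 := by
  have h1 := congrArg (fun x => s.f (ρ x)) h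
  have e : (K : ℂ) • (1 : C) = (K : ℂ) • (star (1 : C) * 1) := by rw [star_one, one_mul]
  simp only [e, map_add, map_smul, map_sum, map_mul, map_star, s.sq_eq, smul_eq_mul] at h1
  exact_mod_cast h1

variable {A : Type u} [NonUnitalCStarAlgebra A] {γ : A ≃⋆ₐ[ℂ] A} {ι : C →⋆ₙₐ[ℂ] A}
  {t : PairKind} {D : Type v} [NonUnitalCStarAlgebra D]

/-- Two isometric homomorphisms of a semicrossed product with the same norms of columns, the first
one being the standard homomorphism to the crossed product. -/
structure IsColumnPair (ι : C →⋆ₙₐ[ℂ] A) (j : Semicrossed α t →ₙₐ[ℂ] Crossed γ)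
    (i : Semicrossed α t →ₙₐ[ℂ] D) : Prop where
  intertwine : ∀ c, ι (α c) = γ (ι c)
  unit_mul : ∀ a, ι 1 * a = a
  j_delta : ∀ n c, j (Semicrossed.delta α t n c) = Crossed.delta γ n (ι c)
  norm_fst : ∀ x, ‖j x‖ = ‖x‖
  norm_snd : ∀ x, ‖i x‖ = ‖x‖
  column : ∀ (ν : ℕ) (x : Fin (ν + 1) → Semicrossed α t),
    ‖∑ k, star (j (x k)) * j (x k)‖ = ‖∑ k, star (i (x k)) * i (x k)‖

namespace IsColumnPair

open Semicrossed

variable {j : Semicrossed α t →ₙₐ[ℂ] Crossed γ} {i : Semicrossed α t →ₙₐ[ℂ] D}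

theorem norm_delta_le (H : IsColumnPair ι j i) (n : ℕ) (c : C) :
    ‖Semicrossed.delta α t n c‖ ≤ ‖c‖ := by
  rw [← H.norm_fst, H.j_delta]
  exact (Crossed.norm_delta_le _ _).trans (NonUnitalStarAlgHom.norm_apply_le ι c)

theorem norm_snd_delta_one_le (H : IsColumnPair ι j i) (n : ℕ) :
    ‖i (Semicrossed.delta α t n 1)‖ ≤ 1 := by
  rw [H.norm_snd]
  exact (H.norm_delta_le n 1).trans (norm_one_le C)

theorem column_fintype (H : IsColumnPair ι j i) {κ : Type*} [Fintype κ] [Nonempty κ]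
    (x : κ → Semicrossed α t) :
    ‖∑ k, star (j (x k)) * j (x k)‖ = ‖∑ k, star (i (x k)) * i (x k)‖ := by
  obtain ⟨ν, hν⟩ := Nat.exists_eq_succ_of_ne_zero (Fintype.card_ne_zero (α := κ))
  let e : κ ≃ Fin (ν + 1) := Fintype.equivFinOfCardEq hν
  have h := H.column ν (x ∘ e.symm)
  simp only [Function.comp_apply] at h
  rwa [e.symm.sum_comp fun k => star (j (x k)) * j (x k),
    e.symm.sum_comp fun k => star (i (x k)) * i (x k)] at h

/-- The restriction of the second homomorphism to the coefficient algebra. -/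
theorem exists_coeffHom (H : IsColumnPair ι j i) :
    ∃ ρ : C →⋆ₙₐ[ℂ] D, ∀ c, ρ c = i (Semicrossed.delta α t 0 c) := by
  let ρ : C →ₙₐ[ℂ] D :=
    { toFun := fun c => i (Semicrossed.delta α t 0 c)
      map_smul' := fun r c => by
        rw [Semicrossed.delta, Ell1.delta_smul, of_smul, map_smul]; rfl
      map_zero' := by
        have h := H.norm_delta_le 0 0
        rw [norm_zero, norm_le_zero_iff] at h
        rw [h, map_zero]
      map_add' := fun c d => by
        rw [Semicrossed.delta, Ell1.delta_add, of_add, map_add]; rfl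
      map_mul' := fun c d => by rw [← map_mul, delta_mul_delta]; rfl }
  exact ⟨{ ρ with map_star' := map_star_of_contractive ρ fun c =>
    (H.norm_snd _).le.trans (H.norm_delta_le 0 c) }, fun _ => rfl⟩

/-- The state seminorms for which finitely many of the operators act isometrically. -/
def Good (i : Semicrossed α t →ₙₐ[ℂ] D) (s : StateSeminorm D) (S : List (ℕ × C)) : Prop :=
  ∀ p ∈ S, s.q (i (Semicrossed.delta α t p.1 p.2)) = s.q (i (Semicrossed.delta α t 0 p.2))

/-- An extremal argument on the column with entries `a`, the elements `Uˡ c` of the list, and an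
element `c₀` that completes the `c` to total square `K`. In the crossed product its squared norm is
at least `‖j a‖² + K`. By the equality of column norms some functional on `D` attains the same
value, but there the entry `a` contributes at most `‖j a‖²` and the others at most `K`. So all these
estimates are equalities. -/
theorem exists_good (H : IsColumnPair ι j i) {a : Semicrossed α t} (ha : j a ≠ 0)
    (S : List (ℕ × C)) :
    ∃ s : StateSeminorm D, Good i s S ∧ ‖j a‖ ≤ s.q (i a) := by
  obtain ⟨K, c₀, hK, hc₀⟩ := exists_column_completion fun k : Fin S.length => (S.get k).2
  obtain ⟨ρ, hρ⟩ := H.exists_coeffHom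
  let x : Option (Option (Fin S.length)) → Semicrossed α t := fun k =>
    k.elim a fun k => k.elim (Semicrossed.delta α t 0 c₀) fun k =>
      Semicrossed.delta α t (S.get k).1 (S.get k).2
  obtain ⟨p, hp⟩ := StateSeminorm.exists_eq_norm (j a)
  obtain ⟨s, hs⟩ := StateSeminorm.exists_sum_sq_eq fun k => i (x k)
  have hlow := p.sum_sq_le fun k => j (x k)
  rw [H.column_fintype x, ← hs] at hlow
  simp only [Fintype.sum_option, x, Option.elim_none, Option.elim_some, hp] at hlow
  have hpsum := p.sum_sq_completion ((Crossed.inclHom γ).comp ι) hc₀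
  have hssum := s.sum_sq_completion ρ hc₀
  -- The functional `p` norms `j a`, and `q(j a) ≤ ‖j a‖ q(j 1)`; this bounds the length of the unit
  -- from below.
  have hp1 : 1 ≤ p.q (Crossed.delta γ 0 (ι 1)) := by
    have h := p.mul_le (j a) (j 1)
    rw [← map_mul, mul_one, hp, ← delta_zero_one, H.j_delta] at h
    exact (le_mul_iff_one_le_right (norm_pos_iff.2 ha)).1 h
  -- In the crossed product multiplication by `Uˡ` is undone by a contraction, so it does not
  -- shorten vectors.
  have hp2 : ∀ (l : ℕ) (c : C), p.q (Crossed.delta γ 0 (ι c)) ≤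
      p.q (j (Semicrossed.delta α t l c)) := by
    intro l c
    have e : Crossed.delta γ (-l) ((γ ^ (-l : ℤ)) (ι 1)) * Crossed.delta γ l (ι c) =
        Crossed.delta γ 0 (ι c) := by
      rw [Crossed.delta_mul_delta, ← FinConv.zpow_add_apply, add_neg_cancel, neg_add_cancel,
        zpow_zero, ← H.unit_mul (ι c)]
      exact congrArg _ (H.unit_mul _)
    have hn : ‖Crossed.delta γ (-l) ((γ ^ (-l : ℤ)) (ι 1))‖ ≤ 1 :=
      ((Crossed.norm_delta_le _ _).trans (NonUnitalStarAlgHom.norm_apply_le (γ ^ (-l : ℤ)) _)).trans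
        ((NonUnitalStarAlgHom.norm_apply_le ι 1).trans (norm_one_le C))
    rw [H.j_delta, ← e]
    exact (p.mul_le _ _).trans (mul_le_of_le_one_left (apply_nonneg p.q _) hn)
  have hs1 : s.q (ρ 1) ≤ 1 := (s.q_le_norm _).trans (by rw [hρ]; exact H.norm_snd_delta_one_le 0)
  -- In `D` only this opposite inequality is available beforehand, because the image of `Uˡ` is a
  -- contraction.
  have hs2 : ∀ (l : ℕ) (c : C), s.q (i (Semicrossed.delta α t l c)) ≤ s.q (ρ c) := by
    intro l c
    rw [delta_eq_mul, map_mul, ← hρ]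
    exact (s.mul_le _ _).trans
      (mul_le_of_le_one_left (apply_nonneg s.q _) (H.norm_snd_delta_one_le l))
  have hsa : s.q (i a) ≤ ‖j a‖ := (s.q_le_norm _).trans (by rw [H.norm_snd, H.norm_fst])
  have hK1 : K ≤ K * p.q (Crossed.delta γ 0 (ι 1)) ^ 2 :=
    le_mul_of_one_le_right hK (one_le_pow₀ hp1)
  have hK2 : K * s.q (ρ 1) ^ 2 ≤ K :=
    mul_le_of_le_one_right hK (pow_le_one₀ (apply_nonneg s.q _) hs1)
  have hP : ∑ k : Fin S.length, p.q (Crossed.delta γ 0 (ι (S.get k).2)) ^ 2 ≤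
      ∑ k : Fin S.length, p.q (j (Semicrossed.delta α t (S.get k).1 (S.get k).2)) ^ 2 :=
    Finset.sum_le_sum fun k _ => pow_le_pow_left₀ (apply_nonneg p.q _) (hp2 _ _) 2
  have hP0 := pow_le_pow_left₀ (apply_nonneg p.q _) (hp2 0 c₀) 2
  have hle : ∀ k ∈ Finset.univ, s.q (i (Semicrossed.delta α t (S.get k).1 (S.get k).2)) ^ 2 ≤
      s.q (ρ (S.get k).2) ^ 2 :=
    fun k _ => pow_le_pow_left₀ (apply_nonneg s.q _) (hs2 _ _) 2
  have hS := Finset.sum_le_sum hle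
  have hsa' := pow_le_pow_left₀ (apply_nonneg s.q _) hsa 2
  change ∑ k, p.q (Crossed.delta γ 0 (ι (S.get k).2)) ^ 2 + p.q (Crossed.delta γ 0 (ι c₀)) ^ 2 =
    K * p.q (Crossed.delta γ 0 (ι 1)) ^ 2 at hpsum
  rw [← hρ] at hlow
  refine ⟨s, ?_, abs_le_of_sq_le_sq' (by linarith) (apply_nonneg s.q _) |>.2⟩
  -- The sums agree while each term is bounded by its counterpart, so the terms agree one by one.
  have heq := (Finset.sum_eq_sum_iff_of_le hle).1 (le_antisymm hS (by linarith))
  intro x hx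
  obtain ⟨k, rfl⟩ := List.mem_iff_get.1 hx
  rw [← hρ]
  exact (sq_eq_sq₀ (apply_nonneg s.q _) (apply_nonneg s.q _)).1 (heq k (Finset.mem_univ k))

end IsColumnPair

end Envelope

/-! ### Absorption of words into the semicrossed product. -/

section Envelope

variable {C : Type u} [CStarAlgebra C] {α : C →⋆ₐ[ℂ] C}
  {A : Type u} [NonUnitalCStarAlgebra A] {γ : A ≃⋆ₐ[ℂ] A} {ι : C →⋆ₙₐ[ℂ] A}
  {t : PairKind} {D : Type v} [NonUnitalCStarAlgebra D]

namespace IsColumnPair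

open Semicrossed

variable {j : Semicrossed α t →ₙₐ[ℂ] Crossed γ} {i : Semicrossed α t →ₙₐ[ℂ] D}

theorem Good.left {s : StateSeminorm D} {S T : List (ℕ × C)} (h : Good i s (S ++ T)) :
    Good i s S := fun p hp => h p (List.mem_append_left _ hp)

theorem Good.right {s : StateSeminorm D} {S T : List (ℕ × C)} (h : Good i s (S ++ T)) :
    Good i s T := fun p hp => h p (List.mem_append_right _ hp)

/-- `y` vanishes for all state seminorms for which certain operators are isometric. -/
def Negligible (i : Semicrossed α t →ₙₐ[ℂ] D) (y : D) : Prop :=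
  ∃ S : List (ℕ × C), ∀ s : StateSeminorm D, Good i s S → s.q y = 0

theorem negligible_zero : Negligible i (0 : D) := ⟨[], fun s _ => map_zero s.q⟩

theorem Negligible.add {x y : D} (hx : Negligible i x) (hy : Negligible i y) :
    Negligible i (x + y) := by
  obtain ⟨S, hS⟩ := hx
  obtain ⟨T, hT⟩ := hy
  refine ⟨S ++ T, fun s hs => le_antisymm ((map_add_le_add s.q x y).trans ?_) (apply_nonneg s.q _)⟩
  rw [hS s hs.left, hT s hs.right, add_zero]

theorem Negligible.smul {x : D} (r : ℂ) (hx : Negligible i x) : Negligible i (r • x) := by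
  obtain ⟨S, hS⟩ := hx
  exact ⟨S, fun s hs => by rw [map_smul_eq_mul, hS s hs, mul_zero]⟩

theorem Negligible.mul_left {x : D} (y : D) (hx : Negligible i x) : Negligible i (y * x) := by
  obtain ⟨S, hS⟩ := hx
  refine ⟨S, fun s hs => le_antisymm ((s.mul_le y x).trans ?_) (apply_nonneg s.q _)⟩
  rw [hS s hs, mul_zero]

/-- In the crossed product `(Uⁿ d)* Uⁿ⁺ᵏ c = Uᵏ αᵏ(d*) c`, an element of the semicrossed product
again. In `D` the same reduction holds for the functionals that see `Uⁿ` as isometric on `Uᵏ c`. The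
hypothesis `n ≤ l` keeps the degrees nonnegative. -/
theorem star_delta_mul (H : IsColumnPair ι j i) {n l : ℕ} (hn : n ≤ l) (d : C)
    {a : Semicrossed α t} (ha : a ∈ tailSpan α t l) : ∃ b ∈ tailSpan α t (l - n),
      star (j (Semicrossed.delta α t n d)) * j a = j b ∧
      Negligible i (star (i (Semicrossed.delta α t n d)) * i a - i b) := by
  induction ha using Submodule.span_induction with
  | mem x hx =>
    obtain ⟨m, c, hm, rfl⟩ := hx
    obtain ⟨k, rfl⟩ := Nat.exists_eq_add_of_le (hn.trans hm)
    refine ⟨Semicrossed.delta α t k ((α ^ k) (star d) * c), delta_mem_tailSpan (by omega) _, ?_, ?_⟩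
    · rw [H.j_delta, H.j_delta, H.j_delta, Crossed.star_delta, Crossed.delta_mul_delta,
        ← FinConv.zpow_add_apply, map_mul, ← Ell1.zpow_apply_of_intertwine H.intertwine,
        ← map_star]
      push_cast
      congr 2 <;> ring_nf
    · obtain ⟨ρ, hρ⟩ := H.exists_coeffHom
      -- Both `Uⁿ⁺ᵏ c` and `Uᵏ c` then have the length of `c`, so the image of `Uⁿ` preserves the
      -- length of that of `Uᵏ c`.
      refine ⟨[(n + k, c), (k, c)], fun s hs => ?_⟩
      have h1 := hs (n + k, c) (by simp)
      have h2 := hs (k, c) (by simp)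
      dsimp only at h1 h2
      have e1 : i (Semicrossed.delta α t (n + k) c) =
          i (Semicrossed.delta α t n 1) * i (Semicrossed.delta α t k c) := by
        rw [← map_mul, delta_mul_delta, map_one, one_mul]
      have e2 : star (i (Semicrossed.delta α t n d)) =
          ρ (star d) * star (i (Semicrossed.delta α t n 1)) := by
        rw [delta_eq_mul, map_mul, star_mul, ← hρ, map_star]
      have e3 : i (Semicrossed.delta α t k ((α ^ k) (star d) * c)) =
          ρ (star d) * i (Semicrossed.delta α t k c) := by
        rw [hρ, ← map_mul, delta_mul_delta, zero_add]
      rw [e1, e2, e3, mul_assoc, ← mul_sub]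
      refine le_antisymm ((s.mul_le _ _).trans ?_) (apply_nonneg s.q _)
      rw [s.isometric _ _ (H.norm_snd_delta_one_le n) (by rw [← e1, h1, h2]), mul_zero]
  | zero =>
    exact ⟨0, zero_mem _, by rw [map_zero, mul_zero], by
      rw [map_zero, mul_zero, sub_zero]; exact negligible_zero⟩
  | add x y _ _ hx hy =>
    obtain ⟨b, hb, hb1, hb2⟩ := hx
    obtain ⟨b', hb', hb1', hb2'⟩ := hy
    refine ⟨b + b', add_mem hb hb', by rw [map_add, mul_add, hb1, hb1', map_add], ?_⟩
    rw [map_add, map_add, mul_add, add_sub_add_comm]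
    exact hb2.add hb2'
  | smul r x _ hx =>
    obtain ⟨b, hb, hb1, hb2⟩ := hx
    refine ⟨r • b, Submodule.smul_mem _ r hb, by rw [map_smul, mul_smul_comm, hb1, map_smul], ?_⟩
    rw [map_smul, map_smul, mul_smul_comm, ← smul_sub]
    exact hb2.smul r

/-- Pairs that, multiplied by a large power of the generator, lie in the semicrossed product up to
negligible elements. -/
def Absorbed (j : Semicrossed α t →ₙₐ[ℂ] Crossed γ) (i : Semicrossed α t →ₙₐ[ℂ] D)
    (x : Crossed γ × D) : Prop :=
  ∃ K : ℕ, ∀ k ≥ K, ∃ a ∈ tailSpan α t (k - K), x.1 * j (Semicrossed.delta α t k 1) = j a ∧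
    Negligible i (x.2 * i (Semicrossed.delta α t k 1) - i a)

/-- Pairs that multiply absorbed pairs into absorbed pairs. -/
def IsAbsorbing (j : Semicrossed α t →ₙₐ[ℂ] Crossed γ) (i : Semicrossed α t →ₙₐ[ℂ] D)
    (y : Crossed γ × D) : Prop :=
  ∀ x, Absorbed j i x → Absorbed j i (y * x)

theorem Absorbed.add {x y : Crossed γ × D} (hx : Absorbed j i x) (hy : Absorbed j i y) :
    Absorbed j i (x + y) := by
  obtain ⟨K, hK⟩ := hx
  obtain ⟨L, hL⟩ := hy
  refine ⟨K + L, fun k hk => ?_⟩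
  obtain ⟨a, ha, ha1, ha2⟩ := hK k (by omega)
  obtain ⟨b, hb, hb1, hb2⟩ := hL k (by omega)
  refine ⟨a + b, add_mem (tailSpan_anti (by omega) ha) (tailSpan_anti (by omega) hb), ?_, ?_⟩
  · rw [Prod.fst_add, add_mul, ha1, hb1, map_add]
  · rw [Prod.snd_add, add_mul, map_add, add_sub_add_comm]
    exact ha2.add hb2

theorem Absorbed.smul {x : Crossed γ × D} (r : ℂ) (hx : Absorbed j i x) :
    Absorbed j i (r • x) := by
  obtain ⟨K, hK⟩ := hx
  refine ⟨K, fun k hk => ?_⟩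
  obtain ⟨a, ha, ha1, ha2⟩ := hK k hk
  refine ⟨r • a, Submodule.smul_mem _ r ha, ?_, ?_⟩
  · rw [Prod.smul_fst, smul_mul_assoc, ha1, map_smul]
  · rw [Prod.smul_snd, smul_mul_assoc, map_smul, ← smul_sub]
    exact ha2.smul r

theorem absorbed_zero : Absorbed j i (0 : Crossed γ × D) :=
  ⟨0, fun k _ => ⟨0, zero_mem _, by rw [Prod.fst_zero, zero_mul, map_zero], by
    rw [Prod.snd_zero, zero_mul, map_zero, sub_zero]; exact negligible_zero⟩⟩

theorem absorbed_one : Absorbed j i (j 1, i 1) :=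
  ⟨0, fun k _ => ⟨Semicrossed.delta α t k 1, delta_mem_tailSpan (by omega) _, by
    rw [← map_mul, one_mul], by rw [← map_mul, one_mul, sub_self]; exact negligible_zero⟩⟩

theorem isAbsorbing_delta (n : ℕ) (d : C) :
    IsAbsorbing j i (j (Semicrossed.delta α t n d), i (Semicrossed.delta α t n d)) := by
  rintro x ⟨K, hK⟩
  refine ⟨K, fun k hk => ?_⟩
  obtain ⟨a, ha, ha1, ha2⟩ := hK k hk
  refine ⟨Semicrossed.delta α t n d * a, delta_mul_mem_tailSpan n d ha, ?_, ?_⟩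
  · rw [Prod.fst_mul, mul_assoc, ha1, map_mul]
  · rw [Prod.snd_mul, mul_assoc, map_mul, ← mul_sub]
    exact ha2.mul_left _

/-- The adjoint of `Uⁿ d` lowers degrees by `n`, so the threshold grows from `K` to `K + n`; this is
why the absorbed degree is tracked as `k - K`. -/
theorem isAbsorbing_star_delta (H : IsColumnPair ι j i) (n : ℕ) (d : C) :
    IsAbsorbing j i (star (j (Semicrossed.delta α t n d), i (Semicrossed.delta α t n d))) := by
  rintro x ⟨K, hK⟩
  refine ⟨K + n, fun k hk => ?_⟩
  obtain ⟨a, ha, ha1, ha2⟩ := hK k (by omega)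
  obtain ⟨b, hb, hb1, hb2⟩ := H.star_delta_mul (n := n) (by omega) d ha
  refine ⟨b, by rwa [Nat.sub_sub] at hb, ?_, ?_⟩
  · rw [Prod.fst_mul, Prod.fst_star, mul_assoc, ha1, hb1]
  · have h := (ha2.mul_left (star (i (Semicrossed.delta α t n d)))).add hb2
    rw [mul_sub, sub_add_sub_cancel, ← mul_assoc] at h
    exact h

theorem mul_unit (H : IsColumnPair ι j i) (a : A) : a * ι 1 = a :=
  star_injective <| by rw [star_mul, ← map_star, star_one, H.unit_mul]

theorem zpow_unit (H : IsColumnPair ι j i) (n : ℤ) : (γ ^ n) (ι 1) = ι 1 := by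
  have h : (γ ^ n) (ι 1) * ι 1 = ι 1 := by
    have h1 : ι 1 = (γ ^ n) ((γ ^ (-n)) (ι 1)) := by
      rw [← FinConv.zpow_add_apply, add_neg_cancel, zpow_zero]; rfl
    calc (γ ^ n) (ι 1) * ι 1 = (γ ^ n) (ι 1) * (γ ^ n) ((γ ^ (-n)) (ι 1)) := by rw [← h1]
      _ = ι 1 := by rw [← map_mul, H.unit_mul, ← h1]
  rwa [H.mul_unit] at h

theorem mul_delta_unit (H : IsColumnPair ι j i) (F : Crossed γ) :
    F * Crossed.delta γ 0 (ι 1) = F := by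
  refine Crossed.induction (P := fun F => F * Crossed.delta γ 0 (ι 1) = F) F
    (isClosed_eq (continuous_id.mul continuous_const) continuous_id) (zero_mul _)
    (fun F G hF hG => by rw [add_mul, hF, hG]) fun n a => ?_
  rw [Crossed.delta_mul_delta, zpow_zero, add_zero]
  exact congrArg _ (H.mul_unit a)

/-- On absorbing pairs the norm of the second component dominates that of the first one. -/
theorem IsAbsorbing.norm_le (H : IsColumnPair ι j i) {y : Crossed γ × D}
    (hy : IsAbsorbing j i y) : ‖y.1‖ ≤ ‖y.2‖ := by
  obtain ⟨K, hK⟩ := hy _ absorbed_one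
  obtain ⟨a, -, ha1, S, hS⟩ := hK K le_rfl
  have e1 : y.1 * j 1 * j (Semicrossed.delta α t K 1) = y.1 * Crossed.delta γ K (ι 1) := by
    rw [mul_assoc, ← map_mul, one_mul, H.j_delta]
  have e2 : y.2 * i 1 * i (Semicrossed.delta α t K 1) = y.2 * i (Semicrossed.delta α t K 1) := by
    rw [mul_assoc, ← map_mul, one_mul]
  change y.1 * j 1 * j (Semicrossed.delta α t K 1) = j a at ha1
  change ∀ s : StateSeminorm D, Good i s S →
    s.q (y.2 * i 1 * i (Semicrossed.delta α t K 1) - i a) = 0 at hS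
  rw [e1] at ha1
  rw [e2] at hS
  -- In the crossed product `Uᴷ` is unitary, so multiplying by it on the right does not change the
  -- norm.
  have hnorm : ‖y.1‖ = ‖j a‖ := by
    have h : y.1 * Crossed.delta γ K (ι 1) * star (y.1 * Crossed.delta γ K (ι 1)) =
        y.1 * star y.1 := by
      rw [star_mul, mul_assoc, ← mul_assoc (Crossed.delta γ K (ι 1)), Crossed.star_delta,
        Crossed.delta_mul_delta, add_neg_cancel, ← map_mul, H.unit_mul, ← map_star, star_one,
        H.zpow_unit, ← mul_assoc, H.mul_delta_unit]
    have h2 := congrArg norm h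
    rw [CStarRing.norm_self_mul_star, CStarRing.norm_self_mul_star, ha1] at h2
    nlinarith [norm_nonneg y.1, norm_nonneg (j a)]
  by_cases h0 : j a = 0
  · rw [hnorm, h0, norm_zero]
    exact norm_nonneg _
  -- The functional is chosen after the list `S`, so the negligible error vanishes for it while it
  -- still sees the full norm of `j a`.
  obtain ⟨s, hs, hsa⟩ := H.exists_good h0 S
  have h3 := map_sub_le_add s.q (y.2 * i (Semicrossed.delta α t K 1))
    (y.2 * i (Semicrossed.delta α t K 1) - i a)
  rw [sub_sub_cancel, hS s hs, add_zero] at h3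
  calc ‖y.1‖ = ‖j a‖ := hnorm
    _ ≤ s.q (i a) := hsa
    _ ≤ s.q (y.2 * i (Semicrossed.delta α t K 1)) := h3
    _ ≤ ‖y.2‖ * s.q (i (Semicrossed.delta α t K 1)) := s.mul_le _ _
    _ ≤ ‖y.2‖ * 1 := mul_le_mul_of_nonneg_left
        ((s.q_le_norm _).trans (H.norm_snd_delta_one_le K)) (norm_nonneg _)
    _ = ‖y.2‖ := mul_one _

/-- The `*`-algebra generated by the pairs of generators. -/
def pairAlg (j : Semicrossed α t →ₙₐ[ℂ] Crossed γ) (i : Semicrossed α t →ₙₐ[ℂ] D) :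
    NonUnitalStarSubalgebra ℂ (Crossed γ × D) :=
  NonUnitalStarAlgebra.adjoin ℂ
    {y | ∃ n c, y = (j (Semicrossed.delta α t n c), i (Semicrossed.delta α t n c))}

/-- The property is not visibly stable under adjoints, so the induction carries it for `y` and `y*`
together. -/
theorem isAbsorbing_of_mem (H : IsColumnPair ι j i) {y : Crossed γ × D} (hy : y ∈ pairAlg j i) :
    IsAbsorbing j i y ∧ IsAbsorbing j i (star y) := by
  induction hy using NonUnitalStarAlgebra.adjoin_induction with
  | mem x hx =>
    obtain ⟨n, c, rfl⟩ := hx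
    exact ⟨isAbsorbing_delta n c, H.isAbsorbing_star_delta n c⟩
  | add x y _ _ hx hy =>
    refine ⟨fun z hz => ?_, fun z hz => ?_⟩
    · rw [add_mul]; exact (hx.1 z hz).add (hy.1 z hz)
    · rw [star_add, add_mul]; exact (hx.2 z hz).add (hy.2 z hz)
  | zero =>
    refine ⟨fun z hz => ?_, fun z hz => ?_⟩
    · rw [zero_mul]; exact absorbed_zero
    · rw [star_zero, zero_mul]; exact absorbed_zero
  | mul x y _ _ hx hy =>
    refine ⟨fun z hz => ?_, fun z hz => ?_⟩
    · rw [mul_assoc]; exact hx.1 _ (hy.1 z hz)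
    · rw [star_mul, mul_assoc]; exact hy.2 _ (hx.2 z hz)
  | smul r x _ hx =>
    refine ⟨fun z hz => ?_, fun z hz => ?_⟩
    · rw [smul_mul_assoc]; exact (hx.1 z hz).smul r
    · rw [star_smul, smul_mul_assoc]; exact (hx.2 z hz).smul _
  | star x _ hx => exact ⟨hx.2, by rw [star_star]; exact hx.1⟩

theorem norm_fst_le_of_mem (H : IsColumnPair ι j i) {y : Crossed γ × D}
    (hy : y ∈ (pairAlg j i).topologicalClosure) : ‖y.1‖ ≤ ‖y.2‖ := by
  have hc : IsClosed {y : Crossed γ × D | ‖y.1‖ ≤ ‖y.2‖} :=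
    isClosed_le continuous_fst.norm continuous_snd.norm
  exact closure_minimal (fun y hy => (H.isAbsorbing_of_mem hy).1.norm_le H) hc hy

end IsColumnPair

end Envelope

/-- A closed `*`-subalgebra of `E × D` on which the norm of the second component is the larger one
is the graph of a homomorphism if its second components are dense. -/
theorem exists_hom_of_graph {E : Type u} {D : Type v} [NonUnitalCStarAlgebra E]
    [NonUnitalCStarAlgebra D] (G : NonUnitalStarSubalgebra ℂ (E × D))
    (hGc : IsClosed (G : Set (E × D))) (hle : ∀ y ∈ G, ‖y.1‖ ≤ ‖y.2‖) {X : Type*}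
    (j : X → E) (i : X → D) (hG : ∀ a, (j a, i a) ∈ G)
    (hj : (NonUnitalStarAlgebra.adjoin ℂ (Set.range j)).topologicalClosure = ⊤)
    (hi : (NonUnitalStarAlgebra.adjoin ℂ (Set.range i)).topologicalClosure = ⊤) :
    ∃ Φ : D →⋆ₙₐ[ℂ] E, Function.Surjective Φ ∧ ∀ a, Φ (i a) = j a := by
  have huniq : ∀ x x' y, (x, y) ∈ G → (x', y) ∈ G → x = x' := fun x x' y h h' => by
    have := hle _ (sub_mem h h')
    rw [Prod.snd_sub, sub_self, norm_zero, Prod.fst_sub, norm_le_zero_iff, sub_eq_zero] at this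
    exact this
  -- On `G` the second projection is isometric by `hle`, so its image is complete, hence closed; it
  -- contains the dense algebra generated by the range of `i`.
  have hex : ∀ y, ∃ x, (x, y) ∈ G := by
    let R := G.map (NonUnitalStarAlgHom.snd ℂ E D)
    have hR : IsClosed (R : Set D) := by
      have : CompleteSpace G := hGc.completeSpace_coe
      have hiso : Isometry fun y : G => (y : E × D).2 :=
        Isometry.of_dist_eq fun y z => by
          rw [Subtype.dist_eq, Prod.dist_eq, dist_eq_norm, dist_eq_norm]
          exact (max_eq_right (hle _ (sub_mem y.2 z.2))).symm
      convert hiso.isClosedEmbedding.isClosed_range using 1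
      ext y
      constructor
      · rintro ⟨z, hz, rfl⟩
        exact ⟨⟨z, hz⟩, rfl⟩
      · rintro ⟨z, rfl⟩
        exact ⟨z, z.2, rfl⟩
    have hRtop : (⊤ : NonUnitalStarSubalgebra ℂ D) ≤ R := by
      rw [← hi]
      refine NonUnitalStarSubalgebra.topologicalClosure_minimal _
        (NonUnitalStarAlgebra.adjoin_le ?_) hR
      rintro _ ⟨a, rfl⟩
      exact ⟨(j a, i a), hG a, rfl⟩
    intro y
    obtain ⟨z, hz, hzy⟩ := hRtop (show y ∈ (⊤ : NonUnitalStarSubalgebra ℂ D) from trivial)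
    exact ⟨z.1, by rw [← hzy]; exact hz⟩
  choose φ hφ using hex
  let Φ : D →⋆ₙₐ[ℂ] E :=
    { toFun := φ
      map_smul' := fun r y => huniq _ _ _ (hφ _) (SMulMemClass.smul_mem r (hφ y))
      map_zero' := huniq _ _ _ (hφ _) (zero_mem G)
      map_add' := fun y z => huniq _ _ _ (hφ _) (add_mem (hφ y) (hφ z))
      map_mul' := fun y z => huniq _ _ _ (hφ _) (mul_mem (hφ y) (hφ z))
      map_star' := fun y => huniq _ _ _ (hφ _) (star_mem (hφ y)) }
  have hΦ : ∀ a, Φ (i a) = j a := fun a => huniq _ _ _ (hφ _) (hG a)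
  refine ⟨Φ, fun x => ?_, hΦ⟩
  -- The range of a `*`-homomorphism is closed, and this one contains a generating set.
  have htop : (⊤ : NonUnitalStarSubalgebra ℂ E) ≤ NonUnitalStarAlgHom.range Φ := by
    rw [← hj]
    refine NonUnitalStarSubalgebra.topologicalClosure_minimal _
      (NonUnitalStarAlgebra.adjoin_le ?_) ?_
    · rintro _ ⟨a, rfl⟩
      exact ⟨i a, hΦ a⟩
    · rw [NonUnitalStarAlgHom.coe_range]
      exact isClosed_range_nonUnital Φ
  exact htop (show x ∈ (⊤ : NonUnitalStarSubalgebra ℂ E) from trivial)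

/-! ### The crossed product as `C*`-envelope. -/

section Envelope

variable {C : Type u} [CStarAlgebra C] {α : C →⋆ₐ[ℂ] C}
  {A : Type u} [NonUnitalCStarAlgebra A] {γ : A ≃⋆ₐ[ℂ] A} {ι : C →⋆ₙₐ[ℂ] A}
  {t : PairKind}

section Pair

variable {D : Type v} [NonUnitalCStarAlgebra D]
  {j : Semicrossed α t →ₙₐ[ℂ] Crossed γ} {i : Semicrossed α t →ₙₐ[ℂ] D}

theorem Semicrossed.tendsto_delta (hj : ∀ x, ‖j x‖ = ‖x‖)
    (hof : ∀ F, j (of α t F) = Ell1.toCrossed γ ι F) (F : Ell1 α) :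
    Tendsto (fun N => ∑ n ∈ Finset.range N, delta α t n (F.coeff n)) atTop (𝓝 (of α t F)) := by
  rw [(isometry_of_norm_eq hj).isEmbedding.tendsto_nhds_iff, hof]
  refine (Ell1.summable_toCrossed γ ι F).hasSum.tendsto_sum_nat.congr fun N => ?_
  rw [Function.comp_apply, map_sum]
  exact Finset.sum_congr rfl fun n _ => by rw [delta, hof, Ell1.toCrossed_delta]

namespace IsColumnPair

/-- Elements of `ℓ¹` are limits of their partial sums, for which membership is clear, and both maps
are isometric. -/
theorem pair_mem (H : IsColumnPair ι j i) (hof : ∀ F, j (Semicrossed.of α t F) =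
    Ell1.toCrossed γ ι F) (x : Semicrossed α t) :
    (j x, i x) ∈ (pairAlg j i).topologicalClosure := by
  have hjc := (Semicrossed.isometry_of_norm_eq H.norm_fst).continuous
  have hic : Continuous i := (AddMonoidHomClass.isometry_of_norm i H.norm_snd).continuous
  have hclosed : IsClosed {x : Semicrossed α t | (j x, i x) ∈ (pairAlg j i).topologicalClosure} :=
    (pairAlg j i).isClosed_topologicalClosure.preimage (hjc.prodMk hic)
  refine Semicrossed.induction_on x hclosed fun F => ?_
  refine hclosed.mem_of_tendsto (Semicrossed.tendsto_delta H.norm_fst hof F)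
    (Eventually.of_forall fun N => ?_)
  have e : (j (∑ n ∈ Finset.range N, Semicrossed.delta α t n (F.coeff n)),
      i (∑ n ∈ Finset.range N, Semicrossed.delta α t n (F.coeff n))) =
      ∑ n ∈ Finset.range N, (j (Semicrossed.delta α t n (F.coeff n)),
        i (Semicrossed.delta α t n (F.coeff n))) := by
    rw [map_sum, map_sum]
    exact Prod.ext (by rw [Prod.fst_sum]) (by rw [Prod.snd_sum])
  change _ ∈ (pairAlg j i).topologicalClosure
  rw [e]
  exact sum_mem fun n _ => (pairAlg j i).le_topologicalClosure
    (NonUnitalStarAlgebra.subset_adjoin ℂ _ ⟨n, _, rfl⟩)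

/-- The crossed product is a quotient of every algebra generated by a second homomorphism. -/
theorem exists_hom (H : IsColumnPair ι j i)
    (hof : ∀ F, j (Semicrossed.of α t F) = Ell1.toCrossed γ ι F)
    (hj : (NonUnitalStarAlgebra.adjoin ℂ (Set.range j)).topologicalClosure = ⊤)
    (hi : (NonUnitalStarAlgebra.adjoin ℂ (Set.range i)).topologicalClosure = ⊤) :
    ∃ Φ : D →⋆ₙₐ[ℂ] Crossed γ, Function.Surjective Φ ∧ ∀ a, Φ (i a) = j a :=
  exists_hom_of_graph (pairAlg j i).topologicalClosure (pairAlg j i).isClosed_topologicalClosure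
    (fun _ hy => H.norm_fst_le_of_mem hy) j i (H.pair_mem hof) hj hi

end IsColumnPair

end Pair

/-- The semicrossed product generates the crossed product. -/
theorem Semicrossed.adjoin_range_toCrossed {j : Semicrossed α t →ₙₐ[ℂ] Crossed γ}
    (hι : ∀ c, ι (α c) = γ (ι c)) (h1 : ∀ a, a * ι 1 = a)
    (hd : ∀ (x : A) (ε : ℝ), 0 < ε → ∃ (N : ℕ) (c : C), ‖(γ ^ (-(N : ℤ))) (ι c) - x‖ < ε)
    (hj : ∀ n c, j (delta α t n c) = Crossed.delta γ n (ι c)) :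
    (NonUnitalStarAlgebra.adjoin ℂ (Set.range j)).topologicalClosure = ⊤ := by
  set S := NonUnitalStarAlgebra.adjoin ℂ (Set.range j) with hS
  have hgen : ∀ (n : ℕ) c, Crossed.delta γ n (ι c) ∈ S := fun n c =>
    NonUnitalStarAlgebra.subset_adjoin ℂ _ ⟨_, hj n c⟩
  have hword : ∀ (n : ℤ) (N : ℕ) (c : C), Crossed.delta γ n ((γ ^ (-(N : ℤ))) (ι c)) ∈ S := by
    intro n N c
    -- Right multiplication by the adjoint of a power of `U` realizes the inverse powers of `γ`. The
    -- extra `n.natAbs` makes the exponent of the first factor nonnegative and is compensated by `α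
    -- ^ n.natAbs`.
    have e : Crossed.delta γ n ((γ ^ (-(N : ℤ))) (ι c)) =
        Crossed.delta γ ((n + N + n.natAbs).toNat : ℕ) (ι ((α ^ n.natAbs) c)) *
          star (Crossed.delta γ ((N + n.natAbs : ℕ) : ℤ) (ι 1)) := by
      rw [Crossed.star_delta, Crossed.delta_mul_delta, ← map_mul, ← map_star, star_one, h1,
        ← Ell1.zpow_apply_of_intertwine hι, ← FinConv.zpow_add_apply]
      have h2 : 0 ≤ n + N + n.natAbs := by omega
      congr 1
      · omega
      · congr 2
        push_cast; ring
    rw [e]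
    exact mul_mem (hgen _ _) (star_mem (hgen _ _))
  rw [eq_top_iff]
  rintro F -
  refine Crossed.induction (P := fun F => F ∈ S.topologicalClosure) F
    S.isClosed_topologicalClosure (zero_mem _) (fun F G => add_mem) fun n a => ?_
  refine Metric.mem_closure_iff.2 fun ε hε => ?_
  obtain ⟨N, c, h⟩ := hd a ε hε
  refine ⟨_, hword n N c, ?_⟩
  have e : Crossed.delta γ n ((γ ^ (-(N : ℤ))) (ι c)) - Crossed.delta γ n a =
      Crossed.delta γ n ((γ ^ (-(N : ℤ))) (ι c) - a) := by
    rw [sub_eq_iff_eq_add, ← Crossed.delta_add, sub_add_cancel]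
  rw [dist_comm, dist_eq_norm, e]
  exact (Crossed.norm_delta_le _ _).trans_lt h

/-- The crossed product is the `C*`-envelope of the semicrossed product. -/
theorem Semicrossed.isCStarEnvelope {j : Semicrossed α t →ₙₐ[ℂ] Crossed γ}
    (hι : ∀ c, ι (α c) = γ (ι c)) (h1 : ∀ a, ι 1 * a = a) (hinj : Function.Injective ι)
    (hd : ∀ (x : A) (ε : ℝ), 0 < ε → ∃ (N : ℕ) (c : C), ‖(γ ^ (-(N : ℤ))) (ι c) - x‖ < ε)
    (hof : ∀ F, j (of α t F) = Ell1.toCrossed γ ι F) (hj : ∀ x, ‖j x‖ = ‖x‖) :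
    IsCStarEnvelope.{u, v} (norms α t) j := by
  have hdelta : ∀ n c, j (delta α t n c) = Crossed.delta γ n (ι c) := fun n c => by
    rw [delta, hof, Ell1.toCrossed_delta]
  have h1' : ∀ a, a * ι 1 = a := fun a => star_injective <| by
    rw [star_mul, ← map_star, star_one, h1]
  have hcover : IsCStarCover (norms α t) j :=
    ⟨fun ν M => (norms_eq hι h1 hinj hof hj M).symm, adjoin_range_toCrossed hι h1' hd hdelta⟩
  refine ⟨hcover, fun D _ i hi => ?_⟩
  have hcol : ∀ (ν : ℕ) (x : Fin (ν + 1) → Semicrossed α t),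
      ‖∑ k, star (j (x k)) * j (x k)‖ = ‖∑ k, star (i (x k)) * i (x k)‖ := by
    intro ν x
    -- Of the complete isometry only the norms of columns are used; the column is placed in column
    -- `0` of a square matrix, which requires size `ν + 1`.
    let M : Matrix (Fin (ν + 1)) (Fin (ν + 1)) (Semicrossed α t) :=
      Matrix.of fun a b => if b = 0 then x a else 0
    have h := (hcover.completelyIsometric _ M).trans (hi.completelyIsometric _ M).symm
    rw [CMat.cstarNorms_eq, CMat.cstarNorms_eq] at h
    have ej : M.map j = Matrix.of fun a b => if b = 0 then j (x a) else 0 := by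
      ext1 a b
      simp only [M, Matrix.map_apply, Matrix.of_apply]
      split_ifs <;> simp
    have ei : M.map i = Matrix.of fun a b => if b = 0 then i (x a) else 0 := by
      ext1 a b
      simp only [M, Matrix.map_apply, Matrix.of_apply]
      split_ifs <;> simp
    rw [ej, ei] at h
    rw [← CMat.norm_column_sq 0, ← CMat.norm_column_sq 0, h]
  have hnorm : ∀ x, ‖i x‖ = ‖x‖ := by
    intro x
    have h := hcol 0 fun _ => x
    simp only [Finset.sum_const, Finset.card_univ, Fintype.card_fin, zero_add, one_smul,
      CStarRing.norm_star_mul_self, hj] at h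
    nlinarith [norm_nonneg (i x), norm_nonneg x]
  have H : IsColumnPair ι j i := ⟨hι, h1, hdelta, hj, hnorm, hcol⟩
  exact H.exists_hom hof hcover.generates hi.generates

end Envelope

/-! ### The unit of the direct limit. -/

section DirectLimitUnit

theorem DirLim.of_one_mul {C : Type u} [CStarAlgebra C] (α : C →⋆ₐ[ℂ] C)
    (x : DirLim (α : C →⋆ₙₐ[ℂ] C)) : DirLim.of (α : C →⋆ₙₐ[ℂ] C) 1 * x = x := by
  induction x using CStarCompletion.induction_on with
  | hp => exact isClosed_eq (continuous_const.mul continuous_id) continuous_id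
  | ih y =>
    refine (map_mul CStarCompletion.of _ y).symm.trans (congrArg CStarCompletion.of ?_)
    refine Subtype.ext (funext fun n => ?_)
    have h : (α : C →⋆ₙₐ[ℂ] C)^[n] 1 = 1 := Function.iterate_fixed (map_one α) n
    change (α : C →⋆ₙₐ[ℂ] C)^[n] 1 * y.1 n = y.1 n
    rw [h, one_mul]

end DirectLimitUnit

end CStarDyn

end

theorem mainTheorem4 {C : Type u} [CStarAlgebra C] (α : C →⋆ₐ[ℂ] C) :
    List.TFAE [
      CStarDyn.IsMinimal (α : C →⋆ₙₐ[ℂ] C),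
      CStarDyn.IsMinimal (CStarDyn.tailEnd α),
      CStarDyn.IsBiMinimal (CStarDyn.limAut (CStarDyn.tailEnd α)),
      CStarDyn.NoFourierInvariantIdeals (CStarDyn.limAut (CStarDyn.tailEnd α))] ∧
    (CStarDyn.IsMinimal (α : C →⋆ₙₐ[ℂ] C) →
      Function.Injective α ∧
      (Function.Bijective (CStarDyn.tailIncl α) ∧
        ∀ c, CStarDyn.tailEnd α (CStarDyn.tailIncl α c) = CStarDyn.tailIncl α (α c)) ∧
      (∀ s t : CStarDyn.PairKind,
        ∃ Φ : CStarDyn.Semicrossed α s ≃ₐ[ℂ] CStarDyn.Semicrossed α t,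
          CStarDyn.IsCompletelyIsometric (CStarDyn.Semicrossed.norms α s)
            (CStarDyn.Semicrossed.norms α t) Φ ∧
          ∀ F, Φ (CStarDyn.Semicrossed.of α s F) = CStarDyn.Semicrossed.of α t F) ∧
      (∀ t : CStarDyn.PairKind,
        ∃ j : CStarDyn.Semicrossed α t →ₙₐ[ℂ]
            CStarDyn.Crossed (CStarDyn.limAut (α : C →⋆ₙₐ[ℂ] C)),
          (∀ (n : ℕ) (c : C), j (CStarDyn.Semicrossed.of α t (CStarDyn.Ell1.delta α n c)) =
            CStarDyn.Crossed.delta (CStarDyn.limAut (α : C →⋆ₙₐ[ℂ] C)) n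
              (CStarDyn.DirLim.of (α : C →⋆ₙₐ[ℂ] C) c)) ∧
          CStarDyn.IsCStarEnvelope.{u, v} (CStarDyn.Semicrossed.norms α t) j)) := by
  refine ⟨CStarDyn.minimality_tfae α, fun h => ?_⟩
  -- From here on minimality enters only through injectivity, and the general results apply to `A =
  -- C_∞`, `γ = α_∞` and the canonical map of `C` into `C_∞`.
  have hα : Function.Injective α := h.injective
  have hι : ∀ c, CStarDyn.DirLim.of (α : C →⋆ₙₐ[ℂ] C) (α c) =
      CStarDyn.limAut (α : C →⋆ₙₐ[ℂ] C) (CStarDyn.DirLim.of (α : C →⋆ₙₐ[ℂ] C) c) :=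
    fun c => (CStarDyn.DirLim.limAut_dirLimOf c).symm
  have h1 := CStarDyn.DirLim.of_one_mul α
  have hinj : Function.Injective (CStarDyn.DirLim.of (α : C →⋆ₙₐ[ℂ] C)) :=
    CStarDyn.DirLim.of_injective hα
  refine ⟨hα, ⟨CStarDyn.tailIncl_bijective hα, CStarDyn.tailEnd_tailIncl hα⟩,
    CStarDyn.Semicrossed.exists_algEquiv hι h1 hinj, fun t => ?_⟩
  obtain ⟨j, hof, hj⟩ := CStarDyn.Semicrossed.exists_toCrossed hι h1 hinj t
  refine ⟨j, fun n c => ?_, CStarDyn.Semicrossed.isCStarEnvelope hι h1 hinj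
    (fun x _ hε => CStarDyn.DirLim.exists_approx x hε) hof hj⟩
  rw [hof, CStarDyn.Ell1.toCrossed_delta]
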